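/- Fix $d,n\ge 0$, $\alpha_1,\dots,\alpha_n\in(0,1)$, an integer $r>0$, and a smooth radial dyadic partition of unity $(\chi,\rho)$ on $\mathbb R^d$: $\operatorname{supp}\chi\subset\{|x|<\frac43\}$, $\operatorname{supp}\rho\subset\{\frac34<|x|<\frac83\}$, $\chi+\sum_{j\ge0}\rho(2^{-j}\cdot)=1$. Put $\rho_{-1}=\chi$, $\rho_j=\rho(2^{-j}\cdot)$ for $j\ge 0$, $\Delta_ju=\mathcal F^{-1}(\rho_j\mathcal Fu)$ for $u\in\mathcal S'(\mathbb R^d)$, $\|u\|_a=\sup_{j\ge-1}2^{ja}\|\Delta_ju\|_{L^\infty}$, and let $\mathcal C^a$ be the space of real $u\in\mathcal S'(\mathbb R^d)$ with $\|u\|_a<\infty$. Let $u\prec v=\sum_{k}\big(\sum_{j<k-1}\Delta_ju\big)\Delta_kv$, and let $(f_1)^\prec=f_1$, $(f_1,\dots,f_k)^\prec=(f_1,\dots,f_{k-1})^\prec\prec f_k$. Let $\mathcal W^{<1}$ be the commutative real algebra freely generated by the nonempty words $(i_1\dots i_k)$ in the letters $1,\dots,n$ whose homogeneity $|i_1\dots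 i_k|=\alpha_{i_1}+\dots+\alpha_{i_k}$ is $<1$, the empty word being the unit. It is a Hopf algebra with the multiplicative coproduct $\Delta(i_1\dots i_k)=\sum_{\ell=0}^k(i_{\ell+1}\dots i_k)\otimes(i_1\dots i_\ell)$ and the counit that vanishes on nonempty words. Let $\mathcal B$ be its basis of monomials in words, with $|\tau_1\cdots\tau_m|=|\tau_1|+\dots+|\tau_m|$, and let $G$ be its group of characters (algebra morphisms to $\mathbb R$) with the product $f*g=(f\otimes g)\Delta$. For $g:\mathbb R^d\to G$ and a linear $\Pi:\mathcal W^{<1}\to\mathcal S'(\mathbb R^d)$ put $g_{yx}=(g_y\otimes g_x^{-1})\Delta$, $\Pi_x=(\Pi\otimes g_x^{-1})\Delta$ and, for $\gamma\in\mathbb R$, $$\|(g,\Pi)\|_{\gamma}=\sup_{\tau,x}|g_x(\tau)|+\sup_{\tau,x,y}\frac{|g_{yx}(\tau)|}{|y-x|^{|\tau|}}+\sup_\tau\|\Pi\tau\|_{0}+\sup_{\tau,x,\varphi,\lambda}\lambda^{-|\tau|}|\langle\Pi_x\tau,\varphi_x^\lambda\rangle|,$$ where $\tau$ runs over the elements of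 $\mathcal B$ with $|\tau|<\gamma$, $x,y$ over $\mathbb R^d$ (with $0^0=1$ and $0/0=0$), $\lambda$ over $(0,1]$, $\varphi$ over the smooth real functions supported in the closed unit ball whose partial derivatives of order $\le r$ are bounded by $1$, and $\varphi_x^\lambda=\lambda^{-d}\varphi(\lambda^{-1}(\cdot-x))$. The distance $d_\gamma$ of two pairs is defined by the same formula with $g,g_{yx},\Pi,\Pi_x$ replaced by their differences. A pair is a model if $\|(g,\Pi)\|_\gamma<\infty$ for all $\gamma$; the function $g$ alone is a model on $\mathcal W^{<1}$ if each $x\mapsto g_x(\tau)$ is a continuous function of at most polynomial growth and the pair $(g,g)$ is a model, where $g$ as second component sends $\tau$ to the distribution $x\mapsto g_x(\tau)$. **Theorem.** Let $f_i\in\mathcal C^{\alpha_i}$, $i=1,\dots,n$. For every word of homogeneity $<1$ the iterated paraproduct $(f_{i_1},\dots,f_{i_k})^\prec$ is well defined (the series of each paraproduct in it converges unconditionally in $\mathcal S'(\mathbb R^d)$ with the topology of pointwise convergence) and is a real continuous function of at most polynomial growth, and the function $g:\mathbb R^d\to G$ defined by $$g_x(i_1\dots i_k)=(f_{i_1},\dots,f_{i_k})^\prec(x)$$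 is a model on $\mathcal W^{<1}$. Moreover, the map $(f_1,\dots,f_n)\mapsto g$ is continuous from $\mathcal C^{\alpha_1}\times\dots\times\mathcal C^{\alpha_n}$ to the models on $\mathcal W^{<1}$ with the topology of the distances $d_\gamma$, $\gamma\in\mathbb R$. -/

import Mathlib

open MeasureTheory
open scoped TensorProduct SchwartzMap ENNReal ContDiff

noncomputable section

namespace WordModel

/-- The homogeneity `α i₁ + ⋯ + α iₖ` of the word `i₁ … iₖ`. -/
def weight {n : ℕ} (α : Fin n → Set.Ioo (0 : ℝ) 1) (l : List (Fin n)) : ℝ :=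
  (l.map fun i => (α i : ℝ)).sum

/-- The nonempty words of homogeneity less than `1`. -/
abbrev LowWord {n : ℕ} (α : Fin n → Set.Ioo (0 : ℝ) 1) : Type :=
  {l : List (Fin n) // l ≠ [] ∧ weight α l < 1}

/-- The commutative algebra freely generated by the nonempty words of homogeneity less than `1`;
the empty word is its unit. -/
def WordAlg {n : ℕ} (α : Fin n → Set.Ioo (0 : ℝ) 1) : Type := MvPolynomial (LowWord α) ℝ

section Hopf

variable {n : ℕ} (α : Fin n → Set.Ioo (0 : ℝ) 1)

instance : CommRing (WordAlg α) := inferInstanceAs (CommRing (MvPolynomial (LowWord α) ℝ))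

instance : Algebra ℝ (WordAlg α) := inferInstanceAs (Algebra ℝ (MvPolynomial (LowWord α) ℝ))

/-- A generator of the word algebra. -/
def gen (w : LowWord α) : WordAlg α := MvPolynomial.X w

/-- The algebra morphism on the word algebra with prescribed values on the generators. -/
def evalHom {A : Type*} [CommRing A] [Algebra ℝ A] (v : LowWord α → A) : WordAlg α →ₐ[ℝ] A :=
  MvPolynomial.aeval v

variable {α} in
@[simp] theorem evalHom_gen {A : Type*} [CommRing A] [Algebra ℝ A] (v : LowWord α → A)
    (w : LowWord α) : evalHom α v (gen α w) = v w :=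
  MvPolynomial.aeval_X v w

variable {α} in
theorem hom_ext {A : Type*} [CommRing A] [Algebra ℝ A] {f g : WordAlg α →ₐ[ℝ] A}
    (h : ∀ w, f (gen α w) = g (gen α w)) : f = g :=
  MvPolynomial.algHom_ext h

open Classical in
/-- The word `l` as an element of the word algebra: the unit if `l` is empty, a generator if `l` is
nonempty of homogeneity less than `1`; the value `0` in the remaining case is never used. -/
def word (l : List (Fin n)) : WordAlg α :=
  if h : l ≠ [] ∧ weight α l < 1 then gen α ⟨l, h⟩ else if l = [] then 1 else 0

/-- The coproduct: `i₁ … iₖ` is sent to `∑_{ℓ=0}^k (i_{ℓ+1} … iₖ) ⊗ (i₁ … i_ℓ)`. -/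
def coprod : WordAlg α →ₐ[ℝ] WordAlg α ⊗[ℝ] WordAlg α :=
  evalHom α fun w => ∑ k ∈ Finset.range (w.1.length + 1),
    word α (w.1.drop k) ⊗ₜ[ℝ] word α (w.1.take k)

/-- The counit: it vanishes on all nonempty words. -/
def coun : WordAlg α →ₐ[ℝ] ℝ := evalHom α fun _ => 0

/-- The antipode on words. -/
def antipodeWord (l : List (Fin n)) : WordAlg α :=
  if l = [] then 1
  else -∑ k : Fin l.length, antipodeWord (l.drop (k + 1)) * word α (l.take (k + 1))
termination_by l.length
decreasing_by
  have := k.2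
  simp only [List.length_drop]
  omega

/-- The right-sided antipode on words (equal to `antipodeWord`; used for the second antipode
identity only). -/
def antipodeWord' (l : List (Fin n)) : WordAlg α :=
  if l = [] then 1
  else -∑ k : Fin l.length, word α (l.drop k) * antipodeWord' (l.take k)
termination_by l.length
decreasing_by
  have := k.2
  simp only [List.length_take]
  omega

variable {α}

theorem weight_nonneg (l : List (Fin n)) : 0 ≤ weight α l :=
  List.sum_nonneg (by
    intro x hx
    obtain ⟨i, -, rfl⟩ := List.mem_map.1 hx
    exact (α i).2.1.le)

theorem weight_drop_add_take (l : List (Fin n)) (k : ℕ) :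
    weight α (l.take k) + weight α (l.drop k) = weight α l := by
  unfold weight
  rw [← List.sum_append, ← List.map_append, List.take_append_drop]

theorem weight_drop_le (l : List (Fin n)) (k : ℕ) : weight α (l.drop k) ≤ weight α l := by
  have := weight_drop_add_take (α := α) l k
  have := weight_nonneg (α := α) (l.take k)
  linarith

theorem weight_take_le (l : List (Fin n)) (k : ℕ) : weight α (l.take k) ≤ weight α l := by
  have := weight_drop_add_take (α := α) l k
  have := weight_nonneg (α := α) (l.drop k)
  linarith

@[simp] theorem word_nil : word α [] = 1 := by simp [word]

theorem word_of {l : List (Fin n)} (h : l ≠ [] ∧ weight α l < 1) : word α l = gen α ⟨l, h⟩ :=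
  dif_pos h

theorem coprod_word {l : List (Fin n)} (h : weight α l < 1) :
    coprod α (word α l) = ∑ k ∈ Finset.range (l.length + 1),
      word α (l.drop k) ⊗ₜ[ℝ] word α (l.take k) := by
  by_cases hl : l = []
  · subst hl
    simp [Algebra.TensorProduct.one_def]
  · rw [word_of ⟨hl, h⟩, coprod, evalHom_gen]

theorem coun_word {l : List (Fin n)} (hl : l ≠ []) : coun α (word α l) = 0 := by
  by_cases h : weight α l < 1
  · rw [word_of ⟨hl, h⟩, coun, evalHom_gen]
  · simp [word, hl, h]

theorem gen_eq_word (w : LowWord α) : gen α w = word α w.1 := (word_of w.2).symm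

theorem coprod_coassoc :
    (Algebra.TensorProduct.assoc ℝ ℝ ℝ (WordAlg α) (WordAlg α) (WordAlg α)).toAlgHom.comp
      ((Algebra.TensorProduct.map (coprod α) (.id ℝ (WordAlg α))).comp (coprod α))
      = (Algebra.TensorProduct.map (.id ℝ (WordAlg α)) (coprod α)).comp (coprod α) := by
  refine hom_ext fun w => ?_
  rw [gen_eq_word]
  obtain ⟨l, hl, hw⟩ := w
  have h1 : ∀ k, coprod α (word α (l.drop k)) = _ :=
    fun k => coprod_word ((weight_drop_le l k).trans_lt hw)
  have h2 : ∀ k, coprod α (word α (l.take k)) = _ :=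
    fun k => coprod_word ((weight_take_le l k).trans_lt hw)
  simp only [AlgHom.comp_apply, coprod_word hw, map_sum, Algebra.TensorProduct.map_tmul, h1, h2,
    AlgHom.coe_id, id_eq, TensorProduct.sum_tmul, TensorProduct.tmul_sum]
  rw [Finset.sum_sigma', Finset.sum_sigma']
  refine Finset.sum_bij' (fun x _ => ⟨x.1 + x.2, x.1⟩) (fun x _ => ⟨x.2, x.1 - x.2⟩) ?_ ?_ ?_ ?_ ?_
  · rintro ⟨k, m⟩ h
    simp only [Finset.mem_sigma, Finset.mem_range, List.length_drop, List.length_take] at h ⊢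
    omega
  · rintro ⟨k, m⟩ h
    simp only [Finset.mem_sigma, Finset.mem_range, List.length_drop, List.length_take] at h ⊢
    omega
  · rintro ⟨k, m⟩ h
    simp
  · rintro ⟨k, m⟩ h
    simp only [Finset.mem_sigma, Finset.mem_range, List.length_take] at h
    have : m + (k - m) = k := by omega
    simp [this]
  · rintro ⟨k, m⟩ h
    have e1 : List.take m (List.drop k l) = List.drop k (List.take (k + m) l) := by
      rw [List.drop_take]; simp
    have e2 : List.take k (List.take (k + m) l) = List.take k l := by
      rw [List.take_take]; simp
    simp [List.drop_drop, e1, e2]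

theorem coun_left :
    (Algebra.TensorProduct.map (coun α) (.id ℝ (WordAlg α))).comp (coprod α)
      = (Algebra.TensorProduct.lid ℝ (WordAlg α)).symm := by
  refine hom_ext fun w => ?_
  rw [gen_eq_word]
  obtain ⟨l, hl, hw⟩ := w
  simp only [AlgHom.comp_apply, coprod_word hw, map_sum, Algebra.TensorProduct.map_tmul,
    AlgHom.coe_id, id_eq]
  rw [Finset.sum_eq_single l.length]
  · simp
  · intro k hk hne
    have : l.drop k ≠ [] := by
      simp only [Finset.mem_range] at hk
      simp; omega
    rw [coun_word this, TensorProduct.zero_tmul]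
  · simp

theorem coun_right :
    (Algebra.TensorProduct.map (.id ℝ (WordAlg α)) (coun α)).comp (coprod α)
      = (Algebra.TensorProduct.rid ℝ ℝ (WordAlg α)).symm := by
  refine hom_ext fun w => ?_
  rw [gen_eq_word]
  obtain ⟨l, hl, hw⟩ := w
  simp only [AlgHom.comp_apply, coprod_word hw, map_sum, Algebra.TensorProduct.map_tmul,
    AlgHom.coe_id, id_eq]
  rw [Finset.sum_eq_single 0]
  · simp
  · intro k hk hne
    have : l.take k ≠ [] := by
      simp [hl, hne]
    rw [coun_word this, TensorProduct.tmul_zero]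
  · simp

instance : Bialgebra ℝ (WordAlg α) :=
  Bialgebra.ofAlgHom (coprod α) (coun α) coprod_coassoc coun_left coun_right

theorem comulAlgHom_eq : Bialgebra.comulAlgHom ℝ (WordAlg α) = coprod α := rfl

theorem counitAlgHom_eq : Bialgebra.counitAlgHom ℝ (WordAlg α) = coun α := rfl

theorem antipodeWord_of {l : List (Fin n)} (hl : l ≠ []) : antipodeWord α l =
    -∑ k : Fin l.length, antipodeWord α (l.drop (k + 1)) * word α (l.take (k + 1)) := by
  rw [antipodeWord, if_neg hl]

theorem antipodeWord'_of {l : List (Fin n)} (hl : l ≠ []) : antipodeWord' α l =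
    -∑ k : Fin l.length, word α (l.drop k) * antipodeWord' α (l.take k) := by
  rw [antipodeWord', if_neg hl]

theorem antipode_left :
    (Algebra.TensorProduct.lift (evalHom α fun w => antipodeWord α w.1) (.id ℝ (WordAlg α))
      fun _ _ => Commute.all _ _).comp (Bialgebra.comulAlgHom ℝ (WordAlg α)) =
      (Algebra.ofId ℝ (WordAlg α)).comp (Bialgebra.counitAlgHom ℝ (WordAlg α)) := by
  refine hom_ext fun w => ?_
  rw [gen_eq_word, comulAlgHom_eq, counitAlgHom_eq]
  obtain ⟨l, hl, hw⟩ := w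
  have h1 : ∀ m : List (Fin n), weight α m < 1 →
      evalHom α (fun w => antipodeWord α w.1) (word α m) = antipodeWord α m := by
    intro m hm
    by_cases hm' : m = []
    · subst hm'
      rw [antipodeWord]; simp
    · rw [word_of ⟨hm', hm⟩, evalHom_gen]
  have h2 : ∀ k, evalHom α (fun w => antipodeWord α w.1) (word α (l.drop k)) = _ :=
    fun k => h1 _ ((weight_drop_le l k).trans_lt hw)
  simp only [AlgHom.comp_apply, coprod_word hw, map_sum, Algebra.TensorProduct.lift_tmul, h2,
    AlgHom.coe_id, id_eq, coun_word hl, map_zero]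
  rw [Finset.sum_range_succ', List.drop_zero, antipodeWord_of hl]
  simp [Finset.sum_range]

theorem antipode_right' :
    (Algebra.TensorProduct.lift (.id ℝ (WordAlg α)) (evalHom α fun w => antipodeWord' α w.1)
      fun _ _ => Commute.all _ _).comp (Bialgebra.comulAlgHom ℝ (WordAlg α)) =
      (Algebra.ofId ℝ (WordAlg α)).comp (Bialgebra.counitAlgHom ℝ (WordAlg α)) := by
  refine hom_ext fun w => ?_
  rw [gen_eq_word, comulAlgHom_eq, counitAlgHom_eq]
  obtain ⟨l, hl, hw⟩ := w
  have h1 : ∀ m : List (Fin n), weight α m < 1 →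
      evalHom α (fun w => antipodeWord' α w.1) (word α m) = antipodeWord' α m := by
    intro m hm
    by_cases hm' : m = []
    · subst hm'
      rw [antipodeWord']; simp
    · rw [word_of ⟨hm', hm⟩, evalHom_gen]
  have h2 : ∀ k, evalHom α (fun w => antipodeWord' α w.1) (word α (l.take k)) = _ :=
    fun k => h1 _ ((weight_take_le l k).trans_lt hw)
  simp only [AlgHom.comp_apply, coprod_word hw, map_sum, Algebra.TensorProduct.lift_tmul, h2,
    AlgHom.coe_id, id_eq, coun_word hl, map_zero]
  rw [Finset.sum_range_succ, List.take_length, List.drop_length, antipodeWord'_of hl]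
  simp [Finset.sum_range]

open WithConv in
theorem antipode_eq :
    (toConv (evalHom α fun w => antipodeWord α w.1) : WithConv (WordAlg α →ₐ[ℝ] WordAlg α)) =
      toConv (evalHom α fun w => antipodeWord' α w.1) := by
  refine left_inv_eq_right_inv (a := toConv (AlgHom.id ℝ (WordAlg α))) ?_ ?_
  · refine WithConv.ext (AlgHom.ext fun x => ?_)
    exact (AlgHom.convMul_apply _ _ x).trans (DFunLike.congr_fun antipode_left x)
  · refine WithConv.ext (AlgHom.ext fun x => ?_)
    exact (AlgHom.convMul_apply _ _ x).trans (DFunLike.congr_fun antipode_right' x)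

theorem antipode_right :
    (Algebra.TensorProduct.lift (.id ℝ (WordAlg α)) (evalHom α fun w => antipodeWord α w.1)
      fun _ _ => Commute.all _ _).comp (Bialgebra.comulAlgHom ℝ (WordAlg α)) =
      (Algebra.ofId ℝ (WordAlg α)).comp (Bialgebra.counitAlgHom ℝ (WordAlg α)) := by
  have h : (evalHom α fun w => antipodeWord α w.1) = evalHom α fun w => antipodeWord' α w.1 :=
    congrArg WithConv.ofConv antipode_eq
  simp only [h]
  exact antipode_right'

/-- The word Hopf algebra. -/
instance : HopfAlgebra ℝ (WordAlg α) :=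
  HopfAlgebra.ofAlgHom (evalHom α fun w => antipodeWord α w.1) antipode_left antipode_right

/-- The character group of the word Hopf algebra: algebra morphisms to `ℝ` with the convolution
product `f * g = (f ⊗ g) Δ`. -/
abbrev CharGroup {n : ℕ} (α : Fin n → Set.Ioo (0 : ℝ) 1) : Type :=
  WithConv (WordAlg α →ₐ[ℝ] ℝ)

/-- The homogeneity of a monomial in words. -/
def hom (m : LowWord α →₀ ℕ) : ℝ := m.sum fun w k => k * weight α w.1

/-- The monomials in words: the basis of the word algebra. -/
def mono (m : LowWord α →₀ ℕ) : WordAlg α := MvPolynomial.monomial m (1 : ℝ)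

end Hopf

/-! ### Littlewood-Paley blocks, Besov spaces, paraproducts -/

/-- The space `ℝ^d`. -/
abbrev Sp (d : ℕ) : Type := EuclideanSpace ℝ (Fin d)

/-- A smooth radial dyadic partition of unity `(χ, ρ)`. -/
structure DyadicPartition (d : ℕ) where
  χ : Sp d → ℝ
  ρ : Sp d → ℝ
  smooth_χ : ContDiff ℝ ∞ χ
  smooth_ρ : ContDiff ℝ ∞ ρ
  radial_χ : ∀ x y, ‖x‖ = ‖y‖ → χ x = χ y
  radial_ρ : ∀ x y, ‖x‖ = ‖y‖ → ρ x = ρ y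
  supp_χ : tsupport χ ⊆ {x | ‖x‖ < 4 / 3}
  supp_ρ : tsupport ρ ⊆ {x | 3 / 4 < ‖x‖ ∧ ‖x‖ < 8 / 3}
  sum_eq : ∀ x, HasSum (fun j : ℕ => ρ (((2 : ℝ) ^ j)⁻¹ • x)) (1 - χ x)

variable {d n : ℕ}

/-- The symbols, with the index shifted by one: `symbol m` is `ρ_{m-1}`, that is `χ` for `m = 0`
and `ρ (2^{-j} ·)` for `m = j + 1`. -/
def DyadicPartition.symbol (P : DyadicPartition d) : ℕ → Sp d → ℝ
  | 0 => P.χ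
  | j + 1 => fun x => P.ρ (((2 : ℝ) ^ j)⁻¹ • x)

/-- The Littlewood-Paley block `Δ_{m-1} u = 𝓕⁻¹ (ρ_{m-1} 𝓕 u)` of a tempered distribution. -/
def block (P : DyadicPartition d) (m : ℕ) (u : 𝓢'(Sp d, ℂ)) : 𝓢'(Sp d, ℂ) :=
  TemperedDistribution.fourierMultiplierCLM ℂ (fun ξ => (P.symbol m ξ : ℂ)) u

/-- The `L^∞` norm of a tempered distribution (`∞` if it is not given by an `L^∞` function). -/
def linftyNorm (u : 𝓢'(Sp d, ℂ)) : ℝ≥0∞ :=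
  ⨅ (h : Lp ℂ ⊤ (volume : Measure (Sp d))) (_ : Lp.toTemperedDistribution h = u), ‖h‖ₑ

/-- The Besov norm `‖u‖_a = sup_{j ≥ -1} 2^{ja} ‖Δ_j u‖_{L^∞}`, here with `j = m - 1`. -/
def besovNorm (P : DyadicPartition d) (a : ℝ) (u : 𝓢'(Sp d, ℂ)) : ℝ≥0∞ :=
  ⨆ m : ℕ, ENNReal.ofReal ((2 : ℝ) ^ (((m : ℝ) - 1) * a)) * linftyNorm (block P m u)

/-- A tempered distribution is real if it is real on real-valued test functions. -/
def IsRealDistribution (u : 𝓢'(Sp d, ℂ)) : Prop :=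
  ∀ φ : 𝓢(Sp d, ℂ), (∀ x, (φ x).im = 0) → (u φ).im = 0

/-- The (real) Besov space `𝓒^a`. -/
def besovSpace (P : DyadicPartition d) (a : ℝ) : Set 𝓢'(Sp d, ℂ) :=
  {u | IsRealDistribution u ∧ besovNorm P a u < ⊤}

/-- The distribution `u` is given by the continuous function `h` of at most polynomial growth. Such
an `h` is unique. -/
def Represents (u : 𝓢'(Sp d, ℂ)) (h : Sp d → ℂ) : Prop :=
  Continuous h ∧ (∃ (C : ℝ) (N : ℕ), ∀ x, ‖h x‖ ≤ C * (1 + ‖x‖) ^ N) ∧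
    ∀ φ : 𝓢(Sp d, ℂ), u φ = ∫ x, φ x * h x

open Classical in
/-- The continuous function of at most polynomial growth by which `u` is given (`0` if there is
none). -/
def toFun (u : 𝓢'(Sp d, ℂ)) : Sp d → ℂ :=
  if h : ∃ v, Represents u v then h.choose else 0

/-- The term `(∑_{j < k - 1} Δ_j u) Δ_k v` of the paraproduct, where `k = m - 1`. -/
def paraTerm (P : DyadicPartition d) (u v : 𝓢'(Sp d, ℂ)) (m : ℕ) : 𝓢'(Sp d, ℂ) :=
  ∑ j ∈ Finset.range (m - 1),
    TemperedDistribution.smulLeftCLM ℂ (toFun (block P j u)) (block P m v)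

/-- The paraproduct `u ≺ v`. -/
def para (P : DyadicPartition d) (u v : 𝓢'(Sp d, ℂ)) : 𝓢'(Sp d, ℂ) :=
  ∑' m, paraTerm P u v m

/-- The iterated paraproduct `(f i₁, …, f iₖ)^≺`, where `(f i)^≺ = f i` and
`(f i₁, …, f iₖ)^≺ = (f i₁, …, f i_{k-1})^≺ ≺ f iₖ`; for the empty word it is the constant `1`. -/
def iterPara (P : DyadicPartition d) (f : Fin n → 𝓢'(Sp d, ℂ)) : List (Fin n) → 𝓢'(Sp d, ℂ)
  | [] => Measure.toTemperedDistribution (volume : Measure (Sp d))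
  | i :: l => l.foldl (fun u j => para P u (f j)) (f i)

/-! ### Models on the word Hopf algebra -/

variable {α : Fin n → Set.Ioo (0 : ℝ) 1}

/-- A pair `(g, Π)` of a function `g` to the character group and a linear map `Π` from the word
algebra (a right comodule over itself) to distributions. -/
structure ModelData (d : ℕ) (α : Fin n → Set.Ioo (0 : ℝ) 1) where
  g : Sp d → CharGroup α
  Pi : WordAlg α →ₗ[ℝ] 𝓢'(Sp d, ℂ)

/-- `g_{yx} = (g_y ⊗ g_x⁻¹) Δ`. -/
def incr (g : Sp d → CharGroup α) (y x : Sp d) : CharGroup α := g y * (g x)⁻¹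

/-- `Π_x^g = (Π ⊗ g_x⁻¹) Δ`. -/
def ModelData.PiAt (Z : ModelData d α) (x : Sp d) : WordAlg α →ₗ[ℝ] 𝓢'(Sp d, ℂ) :=
  (TensorProduct.rid ℝ 𝓢'(Sp d, ℂ)).toLinearMap ∘ₗ
    TensorProduct.map Z.Pi ((Z.g x)⁻¹).ofConv.toLinearMap ∘ₗ Coalgebra.comul

/-- Real test functions supported in the unit ball all of whose partial derivatives of order at
most `r` are bounded by `1`. -/
def testClass (d r : ℕ) : Set (Sp d → ℝ) :=
  {φ | ContDiff ℝ ∞ φ ∧ tsupport φ ⊆ Metric.closedBall 0 1 ∧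
    ∀ k ≤ r, ∀ (σ : Fin k → Fin d) (x : Sp d),
      |iteratedFDeriv ℝ k φ x fun i => EuclideanSpace.single (σ i) 1| ≤ 1}

/-- The rescaled test functions `φ_x^l = l^{-d} φ (l⁻¹ (· - x))`, where `φ` is in the class above. -/
def rescaled (d r : ℕ) (x : Sp d) (l : ℝ) : Set 𝓢(Sp d, ℂ) :=
  {ψ | ∃ φ ∈ testClass d r, ∀ y, ψ y = ((l ^ d)⁻¹ * φ (l⁻¹ • (y - x)) : ℝ)}

/-- The size of a pair of a family `a x τ` and a two-parameter family `b y x τ`, measured on the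
monomials `τ` of homogeneity less than `γ`. -/
def gSize (γ : ℝ) (a : Sp d → WordAlg α → ℝ) (b : Sp d → Sp d → WordAlg α → ℝ) : ℝ≥0∞ :=
  (⨆ (m : LowWord α →₀ ℕ) (_ : hom m < γ) (x : Sp d), ‖a x (mono m)‖ₑ) +
    ⨆ (m : LowWord α →₀ ℕ) (_ : hom m < γ) (x : Sp d) (y : Sp d),
      ‖b y x (mono m)‖ₑ / ENNReal.ofReal (dist y x ^ hom m)

/-- The size of a pair of a family `A τ` and a family `B x τ` of distributions, measured on the
monomials `τ` of homogeneity less than `γ`: the first family is measured in `𝓒^0`, the second one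
by testing it locally. -/
def PiSize (P : DyadicPartition d) (r : ℕ) (γ : ℝ) (A : WordAlg α → 𝓢'(Sp d, ℂ))
    (B : Sp d → WordAlg α → 𝓢'(Sp d, ℂ)) : ℝ≥0∞ :=
  (⨆ (m : LowWord α →₀ ℕ) (_ : hom m < γ), besovNorm P 0 (A (mono m))) +
    ⨆ (m : LowWord α →₀ ℕ) (_ : hom m < γ) (x : Sp d) (l : Set.Ioc (0 : ℝ) 1)
      (ψ ∈ rescaled d r x l), ENNReal.ofReal ((l : ℝ) ^ (-hom m)) * ‖B x (mono m) ψ‖ₑ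

/-- The norm of a model, on monomials of homogeneity less than `γ`. -/
def modelNorm (P : DyadicPartition d) (r : ℕ) (γ : ℝ) (Z : ModelData d α) : ℝ≥0∞ :=
  gSize γ (fun x τ => Z.g x τ) (fun y x τ => incr Z.g y x τ) +
    PiSize P r γ (fun τ => Z.Pi τ) (fun x τ => Z.PiAt x τ)

/-- The distance of two models, on monomials of homogeneity less than `γ`. -/
def modelDist (P : DyadicPartition d) (r : ℕ) (γ : ℝ) (Z Z' : ModelData d α) : ℝ≥0∞ :=
  gSize γ (fun x τ => Z.g x τ - Z'.g x τ) (fun y x τ => incr Z.g y x τ - incr Z'.g y x τ) +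
    PiSize P r γ (fun τ => Z.Pi τ - Z'.Pi τ) (fun x τ => Z.PiAt x τ - Z'.PiAt x τ)

/-- `(g, Π)` is a model: all its norms are finite. -/
def IsModel (P : DyadicPartition d) (r : ℕ) (Z : ModelData d α) : Prop :=
  ∀ γ : ℝ, modelNorm P r γ Z < ⊤

/-- The linear map `Π` is the function `g`: each `Π τ` is given by the function `x ↦ g_x τ`. -/
def Realizes (g : Sp d → CharGroup α) (Q : WordAlg α →ₗ[ℝ] 𝓢'(Sp d, ℂ)) : Prop :=
  ∀ τ, Represents (Q τ) fun x => ((g x τ : ℝ) : ℂ)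

open Classical in
/-- The pair `(g, g)`; the second component is `0` if some `x ↦ g_x τ` does not define a
distribution. -/
def selfPair (g : Sp d → CharGroup α) : ModelData d α where
  g := g
  Pi := if h : ∃ Q, Realizes g Q then h.choose else 0

/-- The function `g` is a model on the word algebra: the functions `x ↦ g_x τ` define
distributions and the pair `(g, g)` is a model. -/
def IsWordModel (P : DyadicPartition d) (r : ℕ) (g : Sp d → CharGroup α) : Prop :=
  (∃ Q, Realizes g Q) ∧ IsModel P r (selfPair g)

variable (α) in
/-- The function `g` with `g_x (i₁ … iₖ) = (f i₁, …, f iₖ)^≺ (x)`. -/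
def canonicalModel (P : DyadicPartition d) (f : Fin n → 𝓢'(Sp d, ℂ)) (x : Sp d) : CharGroup α :=
  WithConv.toConv (evalHom α fun w => (toFun (iterPara P f w.1) x).re)

end WordModel

end

/-!
Littlewood-Paley blocks of bounded functions are differences of mollifications: if `κ` is the
inverse Fourier transform of `χ`, then `∑_{j < M} Δ_j H` is the convolution of `H` with `κ` at the
scale `2^{-M}`. So the paraproduct of a bounded continuous function `H` with `v ∈ 𝓒^b`, `b > 0`, is
the uniformly convergent sum `paraFun` of the products of these mollifications with the blocks of
`v`, and the blocks of `v` enter only through their sizes and their Lipschitz constants (`LPBound`,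
`exists_lpBound`, `summable_and_represents_para`). An element of `𝓒^b` itself is the paraproduct of
`1` with it, up to the two lowest blocks (`represents_of_lpBound`).

The estimate that carries the proof is `exists_norm_paraFun_sub_le`: if `|H z| ≤ M |z - x|^A` for
one fixed `x`, then the increments of the paraproduct of `H` and `v` at `x` are of order `A + b`,
provided that `A + b < 1`. No regularity of `H` is needed. At scales larger than the increment the
mollification of `H` is smooth, at smaller scales the sizes suffice, and the resulting series over
the dyadic scales is geometric in both directions.

The order of the increments `g_{yx}` on words follows by induction on the length. If `w = w' j`,
then the coproduct of `w` consists of the coproduct of `w'` with `j` appended to the left factors,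
and of `1 ⊗ w`. Hence `y ↦ g_{yx}(w)` is the paraproduct of `z ↦ g_{zx}(w')` with the letter `j`, up
to a constant and to a multiple of the two lowest blocks of the letter
(`ParaSystem.incr_append_singleton_eq`); as it vanishes at `y = x`, the estimate above applies with
`A = |w'|` (`lipBound_incr_word`). Characters being multiplicative, the bounds pass to monomials.
The distribution `Π_x τ` is the function `y ↦ g_{yx}(τ)`, so the bounds on test functions and in
`𝓒^0` follow from the pointwise ones.

Everything is polynomial in the letters, so all bounds are proved at once for two families of
letters and for the difference of the corresponding quantities (`PairBound`, `LipBound`); two equal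
families give the finiteness of the norms, and two close ones give the continuity. Below a given
homogeneity there are only finitely many monomials (`finite_hom_lt`).
-/

noncomputable section

namespace WordModel

/-! ### Mollification at a scale -/

section Mollifier

variable {d : ℕ} {F : Type} [NormedAddCommGroup F] [NormedSpace ℝ F]

/-- The weight `(1 + |w|)^{-(d + 2)}`, which is integrable together with its first moment. -/
def bracket (w : Sp d) : ℝ := ((1 + ‖w‖) ^ (d + 2))⁻¹

theorem bracket_nonneg (w : Sp d) : 0 ≤ bracket w := by unfold bracket; positivity

theorem integrable_one_add_norm_mul_bracket :
    Integrable fun w : Sp d => (1 + ‖w‖) * bracket w := by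
  have h := integrable_one_add_norm (E := Sp d) (μ := volume) (r := (d + 1 : ℕ)) (by simp)
  refine h.congr (Filter.Eventually.of_forall fun w => ?_)
  have h1 : 0 < 1 + ‖w‖ := by positivity
  simp only [bracket, Real.rpow_neg h1.le, Real.rpow_natCast]
  field_simp
  ring

theorem continuous_bracket : Continuous (bracket : Sp d → ℝ) := by
  unfold bracket
  refine Continuous.inv₀ (by fun_prop) fun w => ?_
  positivity

theorem integrable_bracket : Integrable (bracket : Sp d → ℝ) := by
  refine integrable_one_add_norm_mul_bracket.mono' continuous_bracket.aestronglyMeasurable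
    (Filter.Eventually.of_forall fun w => ?_)
  rw [Real.norm_of_nonneg (bracket_nonneg w)]
  have := bracket_nonneg w
  nlinarith [norm_nonneg w]

theorem bracket_add_le (w v : Sp d) (hv : ‖v‖ ≤ 1) :
    bracket (w + v) ≤ 2 ^ (d + 2) * bracket w := by
  have h1 : 1 + ‖w‖ ≤ 2 * (1 + ‖w + v‖) := by
    have : ‖w‖ ≤ ‖w + v‖ + ‖v‖ := by
      simpa using norm_sub_le (w + v) v
    nlinarith [norm_nonneg (w + v)]
  unfold bracket
  have h2 : (1 + ‖w‖) ^ (d + 2) ≤ 2 ^ (d + 2) * (1 + ‖w + v‖) ^ (d + 2) := by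
    rw [← mul_pow]; gcongr
  have hw : 0 < (1 + ‖w‖) ^ (d + 2) := by positivity
  have hv' : 0 < (1 + ‖w + v‖) ^ (d + 2) := by positivity
  rw [inv_le_iff_one_le_mul₀ hv']
  rw [show (2 : ℝ) ^ (d + 2) * ((1 + ‖w‖) ^ (d + 2))⁻¹ * (1 + ‖w + v‖) ^ (d + 2)
    = (2 ^ (d + 2) * (1 + ‖w + v‖) ^ (d + 2)) / (1 + ‖w‖) ^ (d + 2) by field_simp]
  rwa [one_le_div hw]

theorem exists_norm_iteratedFDeriv_le_bracket (f : 𝓢(Sp d, F)) (k : ℕ) :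
    ∃ C, 0 ≤ C ∧ ∀ w, ‖iteratedFDeriv ℝ k f w‖ ≤ C * bracket w := by
  refine ⟨2 ^ (d + 2) * (Finset.Iic (d + 2, k)).sup
    (fun m => SchwartzMap.seminorm ℝ m.1 m.2) f, by positivity, fun w => ?_⟩
  have h := SchwartzMap.one_add_le_sup_seminorm_apply (𝕜 := ℝ) (m := (d + 2, k)) le_rfl le_rfl f w
  have hw : 0 < (1 + ‖w‖) ^ (d + 2) := by positivity
  unfold bracket
  rw [← div_eq_mul_inv, le_div_iff₀ hw]
  linarith

theorem exists_norm_le_bracket (f : 𝓢(Sp d, F)) :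
    ∃ C, 0 ≤ C ∧ ∀ w, ‖f w‖ ≤ C * bracket w := by
  simpa using exists_norm_iteratedFDeriv_le_bracket f 0

theorem exists_norm_fderiv_le_bracket (f : 𝓢(Sp d, F)) :
    ∃ C, 0 ≤ C ∧ ∀ w v, ‖v‖ ≤ 1 → ‖fderiv ℝ f (w + v)‖ ≤ C * bracket w := by
  obtain ⟨C, hC, h⟩ := exists_norm_iteratedFDeriv_le_bracket f 1
  refine ⟨C * 2 ^ (d + 2), by positivity, fun w v hv => ?_⟩
  have := h (w + v)
  rw [norm_iteratedFDeriv_one] at this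
  refine this.trans ?_
  rw [mul_assoc]
  gcongr
  exact bracket_add_le w v hv

theorem exists_norm_sub_le_bracket (f : 𝓢(Sp d, F)) :
    ∃ C, 0 ≤ C ∧ ∀ w v, ‖v‖ ≤ 1 → ‖f (w + v) - f w‖ ≤ C * ‖v‖ * bracket w := by
  obtain ⟨C, hC, h⟩ := exists_norm_fderiv_le_bracket f
  refine ⟨C, hC, fun w v hv => ?_⟩
  have := (convex_closedBall w 1).norm_image_sub_le_of_norm_fderiv_le (𝕜 := ℝ) (f := f)
    (C := C * bracket w) (x := w) (y := w + v) (fun x _ => f.differentiableAt)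
    (fun x hx => by
      have := h w (x - w) (by simpa [dist_eq_norm] using hx)
      simpa using this) (by simp) (by simpa using hv)
  refine this.trans (le_of_eq ?_)
  simp; ring

/-- The mollification `∫ η w H (y - ε w) dw` of `H` at scale `ε`. -/
def mollify (η : 𝓢(Sp d, ℂ)) (ε : ℝ) (H : Sp d → ℂ) (y : Sp d) : ℂ :=
  ∫ w, η w * H (y - ε • w)

theorem measurable_comp_sub_smul {H : Sp d → ℂ} (hH : Measurable H) (ε : ℝ) (y : Sp d) :
    Measurable fun w => H (y - ε • w) := hH.comp (by fun_prop)

theorem integrable_mollify (η : 𝓢(Sp d, ℂ)) {H : Sp d → ℂ} (hH : Measurable H) {B : ℝ}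
    (hB : ∀ z, ‖H z‖ ≤ B) (ε : ℝ) (y : Sp d) : Integrable fun w => η w * H (y - ε • w) :=
  η.integrable.mul_bdd (c := B) (measurable_comp_sub_smul hH ε y).aestronglyMeasurable
    (Filter.Eventually.of_forall fun _ => hB _)

theorem mollify_sub (η : 𝓢(Sp d, ℂ)) {H H' : Sp d → ℂ} (hH : Measurable H) (hH' : Measurable H')
    {B B' : ℝ} (hB : ∀ z, ‖H z‖ ≤ B) (hB' : ∀ z, ‖H' z‖ ≤ B') (ε : ℝ) (y : Sp d) :
    mollify η ε (fun z => H z - H' z) y = mollify η ε H y - mollify η ε H' y := by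
  unfold mollify
  rw [← integral_sub (integrable_mollify η hH hB ε y) (integrable_mollify η hH' hB' ε y)]
  simp only [mul_sub]

theorem mollify_finset_sum {ι : Type*} (s : Finset ι) (η : 𝓢(Sp d, ℂ)) {H : ι → Sp d → ℂ}
    (hH : ∀ i, Measurable (H i)) {B : ι → ℝ} (hB : ∀ i z, ‖H i z‖ ≤ B i) (c : ι → ℂ)
    (ε : ℝ) (y : Sp d) :
    mollify η ε (fun z => ∑ i ∈ s, H i z * c i) y = ∑ i ∈ s, mollify η ε (H i) y * c i := by
  unfold mollify
  simp only [Finset.mul_sum, ← mul_assoc]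
  rw [integral_finsetSum _ fun i _ => (integrable_mollify η (hH i) (hB i) ε y).mul_const _]
  simp only [integral_mul_const]

/-- At the scale `ε`, the distance to `x` of the points near `y` is of order `|y - x| + ε`, up to
the first moment of the mollifier. -/
theorem norm_comp_sub_smul_le {H : Sp d → ℂ} {M A ε : ℝ} (hM : 0 ≤ M) (hA : 0 ≤ A) (hA' : A ≤ 1)
    (hε : 0 ≤ ε) {x : Sp d} (hH : ∀ z, ‖H z‖ ≤ M * ‖z - x‖ ^ A) (y w : Sp d) :
    ‖H (y - ε • w)‖ ≤ M * (‖y - x‖ + ε) ^ A * (1 + ‖w‖) := by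
  have h1 : ‖y - ε • w - x‖ ≤ (‖y - x‖ + ε) * (1 + ‖w‖) := by
    have : y - ε • w - x = (y - x) - ε • w := by abel
    rw [this]
    refine (norm_sub_le _ _).trans ?_
    rw [norm_smul, Real.norm_of_nonneg hε]
    nlinarith [norm_nonneg (y - x), norm_nonneg w, mul_nonneg (norm_nonneg (y - x)) (norm_nonneg w)]
  have h2 : (1 + ‖w‖) ^ A ≤ 1 + ‖w‖ := by
    have := Real.rpow_le_rpow_of_exponent_le (x := 1 + ‖w‖) (by linarith [norm_nonneg w]) hA'
    simpa using this
  calc ‖H (y - ε • w)‖ ≤ M * ‖y - ε • w - x‖ ^ A := hH _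
    _ ≤ M * ((‖y - x‖ + ε) * (1 + ‖w‖)) ^ A := by gcongr
    _ = M * (‖y - x‖ + ε) ^ A * (1 + ‖w‖) ^ A := by
      rw [Real.mul_rpow (by positivity) (by positivity)]; ring
    _ ≤ _ := by gcongr

/-- Size and modulus of continuity of a mollification of a function that is small near `x`. The
function need not be continuous. -/
theorem exists_mollify_bound (η : 𝓢(Sp d, ℂ)) : ∃ C, 0 ≤ C ∧
    ∀ (H : Sp d → ℂ) (M A ε : ℝ) (x : Sp d), 0 ≤ M → 0 ≤ A → A ≤ 1 → 0 < ε →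
      Measurable H → (∃ B, ∀ z, ‖H z‖ ≤ B) → (∀ z, ‖H z‖ ≤ M * ‖z - x‖ ^ A) →
      (∀ y, ‖mollify η ε H y‖ ≤ C * M * (‖y - x‖ + ε) ^ A) ∧
      ∀ y y', ‖y - y'‖ ≤ ε →
        ‖mollify η ε H y - mollify η ε H y'‖ ≤ C * M * (‖y - y'‖ / ε) * (‖y - x‖ + ε) ^ A := by
  obtain ⟨C₁, hC₁, h₁⟩ := exists_norm_le_bracket η
  obtain ⟨C₂, hC₂, h₂⟩ := exists_norm_sub_le_bracket η
  set I := ∫ w : Sp d, (1 + ‖w‖) * bracket w with hI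
  have hI0 : 0 ≤ I := integral_nonneg fun w => mul_nonneg (by positivity) (bracket_nonneg w)
  refine ⟨(C₁ + C₂) * I, by positivity, ?_⟩
  intro H M A ε x hM hA hA' hε hm ⟨B, hB⟩ hH
  have hint := integrable_one_add_norm_mul_bracket (d := d)
  constructor
  · intro y
    have hX : 0 ≤ (‖y - x‖ + ε) ^ A := by positivity
    calc ‖mollify η ε H y‖
        ≤ ∫ w, (C₁ * M * (‖y - x‖ + ε) ^ A) * ((1 + ‖w‖) * bracket w) := by
          refine norm_integral_le_of_norm_le (hint.const_mul _) (.of_forall fun w => ?_)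
          rw [norm_mul]
          calc _ ≤ (C₁ * bracket w) * (M * (‖y - x‖ + ε) ^ A * (1 + ‖w‖)) :=
                mul_le_mul (h₁ w) (norm_comp_sub_smul_le hM hA hA' hε.le hH y w) (norm_nonneg _)
                  (mul_nonneg hC₁ (bracket_nonneg w))
            _ = _ := by ring
      _ = C₁ * I * M * (‖y - x‖ + ε) ^ A := by rw [integral_const_mul]; ring
      _ ≤ _ := by gcongr; linarith
  · intro y y' hyy
    set u : Sp d := ε⁻¹ • (y - y') with hu
    have hun : ‖u‖ = ‖y - y'‖ / ε := by
      rw [hu, norm_smul, norm_inv, Real.norm_of_nonneg hε.le]; field_simp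
    have hu1 : ‖-u‖ ≤ 1 := by rw [norm_neg, hun]; exact (div_le_one hε).2 hyy
    have e : mollify η ε H y' = ∫ w, η (w + -u) * H (y - ε • w) := by
      unfold mollify
      rw [← integral_add_right_eq_self (fun w => η w * H (y' - ε • w)) (-u)]
      congr 1; ext w
      congr 2
      rw [smul_add, smul_neg, hu, smul_smul, mul_inv_cancel₀ hε.ne', one_smul]; abel
    have hi' : Integrable fun w => η (w + -u) * H (y - ε • w) :=
      (η.integrable.comp_add_right (-u)).mul_bdd (c := B)
        (measurable_comp_sub_smul hm ε y).aestronglyMeasurable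
        (Filter.Eventually.of_forall fun _ => hB _)
    rw [e, mollify, ← integral_sub (integrable_mollify η hm hB ε y) hi']
    have hX : 0 ≤ (‖y - x‖ + ε) ^ A := by positivity
    calc _ ≤ ∫ w, (C₂ * ‖u‖ * M * (‖y - x‖ + ε) ^ A) * ((1 + ‖w‖) * bracket w) := by
          refine norm_integral_le_of_norm_le (hint.const_mul _) (.of_forall fun w => ?_)
          rw [← sub_mul, norm_mul]
          have h3 := h₂ w (-u) hu1
          rw [norm_neg, norm_sub_rev] at h3
          calc _ ≤ (C₂ * ‖u‖ * bracket w) * (M * (‖y - x‖ + ε) ^ A * (1 + ‖w‖)) :=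
                mul_le_mul h3 (norm_comp_sub_smul_le hM hA hA' hε.le hH y w) (norm_nonneg _)
                  (mul_nonneg (by positivity) (bracket_nonneg w))
            _ = _ := by ring
      _ = C₂ * I * M * (‖y - y'‖ / ε) * (‖y - x‖ + ε) ^ A := by
          rw [integral_const_mul, hun]; ring
      _ ≤ _ := by
          have h4 : C₂ * I ≤ (C₁ + C₂) * I := by nlinarith
          exact mul_le_mul_of_nonneg_right (mul_le_mul_of_nonneg_right
            (mul_le_mul_of_nonneg_right h4 hM) (by positivity)) hX

theorem mollify_one (η : 𝓢(Sp d, ℂ)) (ε : ℝ) (y : Sp d) :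
    mollify η ε (fun _ => 1) y = ∫ w, η w := by simp [mollify]

end Mollifier

/-! ### Smoothness of mollifications -/

section Smooth

variable {d : ℕ}

theorem integrable_smul_schwartz {F : Type} [NormedAddCommGroup F] [NormedSpace ℝ F]
    [NormedSpace ℂ F] (κ : 𝓢(Sp d, F)) {H : Sp d → ℂ} (hH : Measurable H) {B : ℝ}
    (hB : ∀ z, ‖H z‖ ≤ B) (y : Sp d) : Integrable fun z => H z • κ (y - z) :=
  (κ.integrable.comp_sub_left y).bdd_smul B hH.aestronglyMeasurable
    (Filter.Eventually.of_forall fun _ => hB _)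

theorem hasFDerivAt_integral_smul_schwartz {F : Type} [NormedAddCommGroup F] [NormedSpace ℝ F]
    [NormedSpace ℂ F] [SMulCommClass ℝ ℂ F] (κ : 𝓢(Sp d, F)) {H : Sp d → ℂ} (hH : Measurable H)
    {B : ℝ} (hB : ∀ z, ‖H z‖ ≤ B) (y : Sp d) :
    HasFDerivAt (fun y => ∫ z, H z • κ (y - z))
      (∫ z, H z • SchwartzMap.fderivCLM ℝ (Sp d) F κ (y - z)) y := by
  obtain ⟨C, hC, h⟩ := exists_norm_fderiv_le_bracket κ
  have hB0 : 0 ≤ B := (norm_nonneg _).trans (hB 0)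
  refine hasFDerivAt_integral_of_dominated_of_fderiv_le (𝕜 := ℝ) (s := Metric.ball y 1)
    (bound := fun z => B * (C * bracket (y - z)))
    (F' := fun y z => H z • SchwartzMap.fderivCLM ℝ (Sp d) F κ (y - z))
    (Metric.ball_mem_nhds y one_pos)
    (.of_forall fun y => (integrable_smul_schwartz κ hH hB y).aestronglyMeasurable)
    (integrable_smul_schwartz κ hH hB y)
    (integrable_smul_schwartz (SchwartzMap.fderivCLM ℝ (Sp d) F κ) hH hB y).aestronglyMeasurable
    (.of_forall fun z y' hy' => ?_) (((integrable_bracket.comp_sub_left y).const_mul C).const_mul B)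
    (.of_forall fun z y' _ => ?_)
  · rw [norm_smul]
    refine mul_le_mul (hB z) ?_ (norm_nonneg _) hB0
    have := h (y - z) (y' - y) (by
      rw [← dist_eq_norm]; exact (Metric.mem_ball.1 hy').le)
    simpa using this
  · have h1 := (κ.hasFDerivAt (y' - z)).comp y' ((hasFDerivAt_id y').sub_const z)
    simpa [Function.comp_def] using! h1.const_smul (H z)

theorem contDiff_integral_smul_schwartz (k : ℕ) : ∀ {F : Type} [NormedAddCommGroup F]
    [NormedSpace ℝ F] [NormedSpace ℂ F] [SMulCommClass ℝ ℂ F] (κ : 𝓢(Sp d, F)) {H : Sp d → ℂ}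
    (_ : Measurable H) {B : ℝ} (_ : ∀ z, ‖H z‖ ≤ B),
    ContDiff ℝ k (fun y => ∫ z, H z • κ (y - z)) ∧
      ∃ C : ℝ, ∀ y, ‖iteratedFDeriv ℝ k (fun y => ∫ z, H z • κ (y - z)) y‖ ≤ C := by
  induction k with
  | zero =>
    intro F _ _ _ _ κ H hH B hB
    constructor
    · rw [Nat.cast_zero, contDiff_zero]
      exact continuous_iff_continuousAt.2 fun y =>
        (hasFDerivAt_integral_smul_schwartz κ hH hB y).continuousAt
    · obtain ⟨C, hC, h⟩ := exists_norm_le_bracket κ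
      have hB0 : 0 ≤ B := (norm_nonneg _).trans (hB 0)
      refine ⟨∫ z : Sp d, B * (C * bracket z), fun y => ?_⟩
      rw [norm_iteratedFDeriv_zero, ← integral_sub_left_eq_self _ _ y]
      refine norm_integral_le_of_norm_le
        ((integrable_bracket.const_mul C).const_mul B) (.of_forall fun z => ?_)
      rw [norm_smul, sub_sub_cancel]
      exact mul_le_mul (hB _) (h _) (norm_nonneg _) hB0
  | succ k ih =>
    intro F _ _ _ _ κ H hH B hB
    have hd : (fderiv ℝ fun y => ∫ z, H z • κ (y - z)) =
        fun y => ∫ z, H z • SchwartzMap.fderivCLM ℝ (Sp d) F κ (y - z) := by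
      ext1 y
      exact (hasFDerivAt_integral_smul_schwartz κ hH hB y).fderiv
    obtain ⟨h1, C, h2⟩ := ih (SchwartzMap.fderivCLM ℝ (Sp d) F κ) hH hB
    constructor
    · rw [Nat.cast_succ, contDiff_succ_iff_fderiv, hd]
      refine ⟨fun y => (hasFDerivAt_integral_smul_schwartz κ hH hB y).differentiableAt, ?_, h1⟩
      simp
    · refine ⟨C, fun y => ?_⟩
      rw [← norm_iteratedFDeriv_fderiv, hd]
      exact h2 y

theorem hasTemperateGrowth_integral_smul_schwartz (κ : 𝓢(Sp d, ℂ)) {H : Sp d → ℂ}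
    (hH : Measurable H) {B : ℝ} (hB : ∀ z, ‖H z‖ ≤ B) :
    Function.HasTemperateGrowth fun y => ∫ z, H z • κ (y - z) := by
  refine ⟨contDiff_infty.2 fun k => (contDiff_integral_smul_schwartz k κ hH hB).1, fun k => ?_⟩
  obtain ⟨C, h⟩ := (contDiff_integral_smul_schwartz k κ hH hB).2
  exact ⟨0, C, by simpa using h⟩

/-- Mollifications of bounded functions are smooth with bounded derivatives. -/
theorem hasTemperateGrowth_mollify (η : 𝓢(Sp d, ℂ)) {H : Sp d → ℂ} (hH : Measurable H) {B : ℝ}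
    (hB : ∀ z, ‖H z‖ ≤ B) {ε : ℝ} (hε : ε ≠ 0) :
    Function.HasTemperateGrowth (mollify η ε H) := by
  have h := hasTemperateGrowth_integral_smul_schwartz η (H := fun z => H (ε • z))
    (hH.comp (by fun_prop)) (fun z => hB _)
  have h2 := h.comp ((ε⁻¹ • ContinuousLinearMap.id ℝ (Sp d)).hasTemperateGrowth)
  convert h2 using 1
  ext y
  simp only [mollify, Function.comp_apply, smul_eq_mul]
  rw [← integral_sub_left_eq_self _ _ (ε⁻¹ • y)]
  congr 1
  ext w
  simp only [smul_apply, ContinuousLinearMap.id_apply]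
  rw [mul_comm, smul_sub, smul_smul, mul_inv_cancel₀ hε, one_smul]
  simp

end Smooth

/-! ### The paraproduct as an operation on functions -/

/-- The sum of `min ((2^m t)^δ, (2^m t)^{-δ})` over the dyadic scales is bounded uniformly in `t`:
it is dominated by two geometric series around the scale `2^m ∼ t⁻¹`. -/
theorem exists_tsum_min_rpow_le {δ : ℝ} (hδ : 0 < δ) : ∃ C, 0 ≤ C ∧ ∀ t : ℝ, 0 < t →
    Summable (fun m : ℕ => min (((2 : ℝ) ^ m * t) ^ δ) (((2 : ℝ) ^ m * t) ^ (-δ))) ∧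
      ∑' m : ℕ, min (((2 : ℝ) ^ m * t) ^ δ) (((2 : ℝ) ^ m * t) ^ (-δ)) ≤ C := by
  set q : ℝ := 2 ^ (-δ) with hq
  have hq0 : 0 < q := by positivity
  have hq1 : q < 1 := Real.rpow_lt_one_of_one_lt_of_neg one_lt_two (by linarith)
  set f : ℤ → ℝ := fun j => 2 ^ δ * q ^ j.natAbs with hf
  have hf0 : ∀ j, 0 ≤ f j := fun j => by positivity
  have hfs : Summable f := by
    have h := (summable_geometric_of_lt_one hq0.le hq1).mul_left ((2 : ℝ) ^ δ)
    refine Summable.of_nat_of_neg ?_ ?_ <;> simpa [hf] using h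
  refine ⟨∑' j, f j, tsum_nonneg hf0, fun t ht => ?_⟩
  obtain ⟨k, hk1, hk2⟩ := exists_mem_Ico_zpow ht (one_lt_two (α := ℝ))
  have hinj : Function.Injective fun m : ℕ => (m : ℤ) + k := fun a b h => by
    simpa using h
  have hle : ∀ m : ℕ, min (((2 : ℝ) ^ m * t) ^ δ) (((2 : ℝ) ^ m * t) ^ (-δ)) ≤ f (m + k) := by
    intro m
    have e1 : (2 : ℝ) ^ ((m : ℤ) + k) ≤ 2 ^ m * t := by
      rw [zpow_add₀ two_ne_zero, zpow_natCast]; gcongr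
    have e2 : (2 : ℝ) ^ m * t ≤ 2 * 2 ^ ((m : ℤ) + k) := by
      rw [zpow_add₀ two_ne_zero, zpow_natCast]
      rw [zpow_add_one₀ two_ne_zero] at hk2
      have : (0 : ℝ) < 2 ^ m := by positivity
      nlinarith
    generalize (m : ℤ) + k = j at e1 e2
    have hpos : (0 : ℝ) < 2 ^ j := by positivity
    rcases le_or_gt 0 j with hj | hj
    · refine (min_le_right _ _).trans ?_
      have h2 : (1 : ℝ) ≤ 2 ^ δ := Real.one_le_rpow one_le_two hδ.le
      calc ((2 : ℝ) ^ m * t) ^ (-δ) ≤ ((2 : ℝ) ^ j) ^ (-δ) :=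
            Real.rpow_le_rpow_of_nonpos hpos e1 (by linarith)
        _ = q ^ j.natAbs := by
          rw [hq, ← Real.rpow_intCast, ← Real.rpow_natCast, ← Real.rpow_mul zero_le_two,
            ← Real.rpow_mul zero_le_two]
          congr 1
          rw [Nat.cast_natAbs, abs_of_nonneg hj]; ring
        _ ≤ f j := by
          have : 0 ≤ q ^ j.natAbs := by positivity
          simp only [hf]; nlinarith
    · refine (min_le_left _ _).trans ?_
      calc ((2 : ℝ) ^ m * t) ^ δ ≤ (2 * (2 : ℝ) ^ j) ^ δ :=
            Real.rpow_le_rpow (by positivity) e2 hδ.le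
        _ = f j := by
          rw [Real.mul_rpow zero_le_two hpos.le, hf]
          simp only
          congr 1
          rw [hq, ← Real.rpow_intCast, ← Real.rpow_natCast, ← Real.rpow_mul zero_le_two,
            ← Real.rpow_mul zero_le_two]
          congr 1
          rw [Nat.cast_natAbs, abs_of_neg hj]; push_cast; ring
  have h0 : ∀ m : ℕ, 0 ≤ min (((2 : ℝ) ^ m * t) ^ δ) (((2 : ℝ) ^ m * t) ^ (-δ)) :=
    fun m => by positivity
  have hs := Summable.of_nonneg_of_le h0 hle (hfs.comp_injective hinj)
  exact ⟨hs, hs.tsum_le_tsum_of_inj _ hinj (fun c _ => hf0 c) hle hfs⟩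

section Paraproduct

variable {d : ℕ}

/-- Bounds satisfied by the sequence of Littlewood-Paley blocks of an element of a Besov space of
regularity `b`. The blocks enter only through these bounds; the index `m` is the shifted one, so
that `V m` has frequencies of order `2^m`. -/
structure LPBound (b N : ℝ) (V : ℕ → Sp d → ℂ) : Prop where
  norm_le : ∀ m y, ‖V m y‖ ≤ N * ((2 : ℝ) ^ m) ^ (-b)
  lip : ∀ m y x, ‖V m y - V m x‖ ≤ N * ((2 : ℝ) ^ m) ^ (1 - b) * ‖y - x‖

theorem LPBound.nonneg {b N : ℝ} {V : ℕ → Sp d → ℂ} (h : LPBound b N V) : 0 ≤ N := by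
  simpa using (norm_nonneg _).trans (h.norm_le 0 0)

theorem LPBound.continuous {b N : ℝ} {V : ℕ → Sp d → ℂ} (h : LPBound b N V) (m : ℕ) :
    Continuous (V m) := by
  have hN := h.nonneg
  refine LipschitzWith.continuous (K := ⟨N * ((2 : ℝ) ^ m) ^ (1 - b), by positivity⟩)
    (LipschitzWith.of_dist_le_mul fun y x => ?_)
  rw [dist_eq_norm, dist_eq_norm]
  exact h.lip m y x

theorem summable_two_pow_rpow_neg {b : ℝ} (hb : 0 < b) :
    Summable fun m : ℕ => ((2 : ℝ) ^ m) ^ (-b) := by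
  have hq1 : (2 : ℝ) ^ (-b) < 1 := Real.rpow_lt_one_of_one_lt_of_neg one_lt_two (by linarith)
  refine (summable_geometric_of_lt_one (by positivity) hq1).congr fun m => ?_
  rw [← Real.rpow_natCast, ← Real.rpow_natCast, ← Real.rpow_mul zero_le_two,
    ← Real.rpow_mul zero_le_two, mul_comm]

/-- The paraproduct `∑ₘ (η_{2⁻ᵐ} * H) V_{m+2}` of the function `H` and the function with
Littlewood-Paley blocks `V`; the shift by two is the one in `∑_{j < k - 1}`. -/
def paraFun (η : 𝓢(Sp d, ℂ)) (H : Sp d → ℂ) (V : ℕ → Sp d → ℂ) (y : Sp d) : ℂ :=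
  ∑' m : ℕ, mollify η ((2 : ℝ) ^ m)⁻¹ H y * V (m + 2) y

theorem two_pow_add_two_rpow_le {b : ℝ} (hb : 0 ≤ b) (m : ℕ) :
    ((2 : ℝ) ^ (m + 2)) ^ (-b) ≤ ((2 : ℝ) ^ m) ^ (-b) :=
  Real.rpow_le_rpow_of_nonpos (by positivity)
    (pow_le_pow_right₀ one_le_two (by omega)) (by linarith)

/-- Pointwise bound of the terms of the paraproduct. -/
theorem exists_norm_mollify_mul_le (η : 𝓢(Sp d, ℂ)) : ∃ C, 0 ≤ C ∧
    ∀ (H : Sp d → ℂ) (M b N : ℝ) (V : ℕ → Sp d → ℂ), 0 < b → Measurable H →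
      (∀ z, ‖H z‖ ≤ M) → LPBound b N V → ∀ m y,
        ‖mollify η ((2 : ℝ) ^ m)⁻¹ H y * V (m + 2) y‖ ≤ C * M * N * ((2 : ℝ) ^ m) ^ (-b) := by
  obtain ⟨C, hC, h⟩ := exists_mollify_bound η
  refine ⟨C, hC, fun H M b N V hb hm hM hV m y => ?_⟩
  have hM0 : 0 ≤ M := (norm_nonneg _).trans (hM 0)
  have hN := hV.nonneg
  have h1 := (h H M 0 ((2 : ℝ) ^ m)⁻¹ 0 hM0 le_rfl zero_le_one (by positivity) hm ⟨M, hM⟩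
    (by simpa using hM)).1 y
  rw [Real.rpow_zero, mul_one] at h1
  rw [norm_mul]
  calc _ ≤ (C * M) * (N * ((2 : ℝ) ^ m) ^ (-b)) :=
        mul_le_mul h1 ((hV.norm_le _ _).trans (by
          gcongr ?_ * ?_; exact two_pow_add_two_rpow_le hb.le m)) (norm_nonneg _) (by positivity)
    _ = _ := by ring

theorem summable_paraFun (η : 𝓢(Sp d, ℂ)) {H : Sp d → ℂ} {M b N : ℝ} {V : ℕ → Sp d → ℂ}
    (hb : 0 < b) (hm : Measurable H) (hM : ∀ z, ‖H z‖ ≤ M) (hV : LPBound b N V) (y : Sp d) :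
    Summable fun m : ℕ => mollify η ((2 : ℝ) ^ m)⁻¹ H y * V (m + 2) y := by
  obtain ⟨C, hC, h⟩ := exists_norm_mollify_mul_le η
  exact .of_norm_bounded ((summable_two_pow_rpow_neg hb).mul_left _) fun m =>
    h H M b N V hb hm hM hV m y

theorem continuous_paraFun (η : 𝓢(Sp d, ℂ)) {H : Sp d → ℂ} {M b N : ℝ} {V : ℕ → Sp d → ℂ}
    (hb : 0 < b) (hm : Measurable H) (hM : ∀ z, ‖H z‖ ≤ M) (hV : LPBound b N V) :
    Continuous (paraFun η H V) := by
  obtain ⟨C, hC, h⟩ := exists_norm_mollify_mul_le η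
  refine continuous_tsum (fun m => ?_) ((summable_two_pow_rpow_neg hb).mul_left _)
    fun m y => h H M b N V hb hm hM hV m y
  exact (hasTemperateGrowth_mollify η hm hM (by positivity)).1.continuous.mul (hV.continuous _)

theorem exists_norm_paraFun_le (η : 𝓢(Sp d, ℂ)) {b : ℝ} (hb : 0 < b) : ∃ C, 0 ≤ C ∧
    ∀ (H : Sp d → ℂ) (M N : ℝ) (V : ℕ → Sp d → ℂ), Measurable H →
      (∀ z, ‖H z‖ ≤ M) → LPBound b N V → ∀ y, ‖paraFun η H V y‖ ≤ C * M * N := by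
  obtain ⟨C, hC, h⟩ := exists_norm_mollify_mul_le η
  refine ⟨C * ∑' m : ℕ, ((2 : ℝ) ^ m) ^ (-b),
    mul_nonneg hC (tsum_nonneg fun m => by positivity), fun H M N V hm hM hV y => ?_⟩
  have hs := ((summable_two_pow_rpow_neg hb).mul_left (C * M * N))
  refine (tsum_of_norm_bounded hs.hasSum fun m => h H M b N V hb hm hM hV m y).trans (le_of_eq ?_)
  rw [tsum_mul_left]; ring

theorem paraFun_sub_left (η : 𝓢(Sp d, ℂ)) {H H' : Sp d → ℂ} {M M' b N : ℝ} {V : ℕ → Sp d → ℂ}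
    (hb : 0 < b) (hm : Measurable H) (hM : ∀ z, ‖H z‖ ≤ M) (hm' : Measurable H')
    (hM' : ∀ z, ‖H' z‖ ≤ M') (hV : LPBound b N V) (y : Sp d) :
    paraFun η (fun z => H z - H' z) V y = paraFun η H V y - paraFun η H' V y := by
  unfold paraFun
  rw [← (summable_paraFun η hb hm hM hV y).tsum_sub (summable_paraFun η hb hm' hM' hV y)]
  simp only [mollify_sub η hm hm' hM hM', sub_mul]

theorem paraFun_sub_right (η : 𝓢(Sp d, ℂ)) {H : Sp d → ℂ} {M b N N' : ℝ} {V V' : ℕ → Sp d → ℂ}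
    (hb : 0 < b) (hm : Measurable H) (hM : ∀ z, ‖H z‖ ≤ M) (hV : LPBound b N V)
    (hV' : LPBound b N' V') (y : Sp d) :
    paraFun η H (fun m z => V m z - V' m z) y = paraFun η H V y - paraFun η H V' y := by
  unfold paraFun
  rw [← (summable_paraFun η hb hm hM hV y).tsum_sub (summable_paraFun η hb hm hM hV' y)]
  simp only [mul_sub]

theorem paraFun_finset_sum {ι : Type*} (s : Finset ι) (η : 𝓢(Sp d, ℂ)) {H : ι → Sp d → ℂ}
    (hH : ∀ i, Measurable (H i)) {B : ι → ℝ} (hB : ∀ i z, ‖H i z‖ ≤ B i) (c : ι → ℂ) {b N : ℝ}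
    {V : ℕ → Sp d → ℂ} (hb : 0 < b) (hV : LPBound b N V) (y : Sp d) :
    paraFun η (fun z => ∑ i ∈ s, H i z * c i) V y = ∑ i ∈ s, paraFun η (H i) V y * c i := by
  unfold paraFun
  simp only [mollify_finset_sum s η hH hB]
  simp only [← tsum_mul_right]
  rw [← Summable.tsum_finsetSum fun i _ =>
    (summable_paraFun η hb (hH i) (hB i) hV y).mul_right (c i)]
  congr 1; ext m
  rw [Finset.sum_mul]
  exact Finset.sum_congr rfl fun i _ => by ring

/-- The increments of a paraproduct `H ≺ v` at `x` are of order `A + b` as soon as `H` is of order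
`A` at `x` and `v` is of regularity `b`, provided that `A + b < 1`. No regularity of `H` is needed:
at the scales larger than the increment, the mollification of `H` is smooth, and at the smaller ones
the sizes of its values suffice. -/
theorem exists_norm_paraFun_sub_le (η : 𝓢(Sp d, ℂ)) {A b : ℝ} (hA : 0 ≤ A) (hb : 0 < b)
    (hAb : A + b < 1) : ∃ C, 0 ≤ C ∧
    ∀ (H : Sp d → ℂ) (M N : ℝ) (x : Sp d) (V : ℕ → Sp d → ℂ), Measurable H →
      (∃ B, ∀ z, ‖H z‖ ≤ B) → 0 ≤ M → (∀ z, ‖H z‖ ≤ M * ‖z - x‖ ^ A) → LPBound b N V →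
        ∀ y, ‖paraFun η H V y - paraFun η H V x‖ ≤ C * M * N * ‖y - x‖ ^ (A + b) := by
  obtain ⟨C, hC, h⟩ := exists_mollify_bound η
  set δ := min (1 - A - b) b with hδ
  have hδ0 : 0 < δ := lt_min (by linarith) hb
  obtain ⟨D, hD, hs⟩ := exists_tsum_min_rpow_le hδ0
  refine ⟨5 * C * D, by positivity, ?_⟩
  intro H M N x V hm ⟨B, hB⟩ hM0 hM hV y
  have hN := hV.nonneg
  rcases eq_or_ne y x with rfl | hyx
  · simp; positivity
  set t := ‖y - x‖ with ht
  have ht0 : 0 < t := norm_pos_iff.2 (sub_ne_zero.2 hyx)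
  obtain ⟨hs1, hs2⟩ := hs t ht0
  have key : ∀ m : ℕ, ‖mollify η ((2 : ℝ) ^ m)⁻¹ H y * V (m + 2) y -
      mollify η ((2 : ℝ) ^ m)⁻¹ H x * V (m + 2) x‖ ≤
      5 * C * M * N * t ^ (A + b) * min (((2 : ℝ) ^ m * t) ^ δ) (((2 : ℝ) ^ m * t) ^ (-δ)) := by
    intro m
    have hV1 := fun y => (hV.norm_le (m + 2) y).trans
      (mul_le_mul_of_nonneg_left (two_pow_add_two_rpow_le hb.le m) hN)
    have hV2 : ‖V (m + 2) y - V (m + 2) x‖ ≤ N * (4 * ((2 : ℝ) ^ m) ^ (1 - b)) * t := by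
      refine (hV.lip (m + 2) y x).trans ?_
      have : ((2 : ℝ) ^ (m + 2)) ^ (1 - b) ≤ 4 * ((2 : ℝ) ^ m) ^ (1 - b) := by
        rw [pow_add, Real.mul_rpow (by positivity) (by positivity), mul_comm]
        gcongr
        calc ((2 : ℝ) ^ 2) ^ (1 - b) ≤ ((2 : ℝ) ^ 2) ^ (1 : ℝ) :=
              Real.rpow_le_rpow_of_exponent_le (by norm_num) (by linarith)
          _ = 4 := by norm_num
      gcongr
    have hs0 : (0 : ℝ) < 2 ^ m := by positivity
    generalize (2 : ℝ) ^ m = s at *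
    obtain ⟨h1, h2⟩ := h H M A s⁻¹ x hM0 hA (by linarith) (by positivity) hm ⟨B, hB⟩ hM
    have h1x := h1 x
    rw [sub_self, norm_zero, zero_add] at h1x
    have hst : 0 < s * t := by positivity
    have es : s⁻¹ ^ A = s ^ (-A) := by rw [Real.inv_rpow hs0.le, Real.rpow_neg hs0.le]
    rw [es] at h1x
    rcases le_or_gt (s * t) 1 with hlow | hhigh
    · -- scales larger than the increment
      have h3 := h2 x y (by
        rw [norm_sub_rev, ← ht, ← one_div, le_div_iff₀ hs0]; linarith)
      rw [sub_self, norm_zero, zero_add, es, norm_sub_rev, norm_sub_rev x y, ← ht, div_inv_eq_mul]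
        at h3
      have hmin : (s * t) ^ (1 - A - b) ≤ min ((s * t) ^ δ) ((s * t) ^ (-δ)) := by
        refine le_min (Real.rpow_le_rpow_of_exponent_ge hst hlow (min_le_left _ _)) ?_
        exact Real.rpow_le_rpow_of_exponent_ge hst hlow (by linarith)
      calc _ = ‖(mollify η s⁻¹ H y - mollify η s⁻¹ H x) * V (m + 2) y +
            mollify η s⁻¹ H x * (V (m + 2) y - V (m + 2) x)‖ := by congr 1; ring
        _ ≤ (C * M * (t * s) * s ^ (-A)) * (N * s ^ (-b)) +
            (C * M * s ^ (-A)) * (N * (4 * s ^ (1 - b)) * t) := by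
          refine (norm_add_le _ _).trans (add_le_add ?_ ?_)
          · rw [norm_mul]
            exact mul_le_mul h3 (hV1 y) (norm_nonneg _) (by positivity)
          · rw [norm_mul]
            exact mul_le_mul h1x hV2 (norm_nonneg _) (by positivity)
        _ = 5 * C * M * N * t ^ (A + b) * (s * t) ^ (1 - A - b) := by
          have e1 : s ^ (1 - b) = s * s ^ (-b) := by
            rw [sub_eq_add_neg, Real.rpow_add hs0, Real.rpow_one]
          have e2 : (s * t) ^ (1 - A - b) = s * s ^ (-A) * s ^ (-b) * t ^ (1 - A - b) := by
            rw [Real.mul_rpow hs0.le ht0.le, sub_eq_add_neg, sub_eq_add_neg, Real.rpow_add hs0,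
              Real.rpow_add hs0, Real.rpow_one]
          have e3 : t ^ (A + b) * t ^ (1 - A - b) = t := by
            rw [← Real.rpow_add ht0]; simp
          rw [e1, e2]
          linear_combination (-5 * C * M * N * s * s ^ (-A) * s ^ (-b)) * e3
        _ ≤ _ := by gcongr
    · -- scales smaller than the increment
      have hinv : s⁻¹ ≤ t := by rw [inv_le_iff_one_le_mul₀ hs0]; linarith
      have hmin : (s * t) ^ (-b) ≤ min ((s * t) ^ δ) ((s * t) ^ (-δ)) := by
        refine le_min (Real.rpow_le_rpow_of_exponent_le hhigh.le (by linarith)) ?_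
        exact Real.rpow_le_rpow_of_exponent_le hhigh.le (by
          have := min_le_right (1 - A - b) b; linarith)
      have h1y : ‖mollify η s⁻¹ H y‖ ≤ C * M * (2 * t ^ A) := by
        refine (h1 y).trans ?_
        gcongr
        calc (t + s⁻¹) ^ A ≤ (2 * t) ^ A := by gcongr; linarith
          _ = 2 ^ A * t ^ A := Real.mul_rpow zero_le_two ht0.le
          _ ≤ 2 * t ^ A := by
            gcongr
            simpa using Real.rpow_le_rpow_of_exponent_le one_le_two (show A ≤ 1 by linarith)
      have h1x' : ‖mollify η s⁻¹ H x‖ ≤ C * M * t ^ A := by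
        refine h1x.trans ?_
        rw [← es]
        gcongr
      have hr : 0 ≤ C * M * N * t ^ (A + b) * (s * t) ^ (-b) := by positivity
      calc _ ≤ ‖mollify η s⁻¹ H y‖ * ‖V (m + 2) y‖ + ‖mollify η s⁻¹ H x‖ * ‖V (m + 2) x‖ := by
            refine (norm_sub_le _ _).trans ?_
            rw [norm_mul, norm_mul]
        _ ≤ (C * M * (2 * t ^ A)) * (N * s ^ (-b)) + (C * M * t ^ A) * (N * s ^ (-b)) :=
          add_le_add (mul_le_mul h1y (hV1 y) (norm_nonneg _) (by positivity))
            (mul_le_mul h1x' (hV1 x) (norm_nonneg _) (by positivity))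
        _ = 3 * (C * M * N * t ^ (A + b) * (s * t) ^ (-b)) := by
          rw [Real.mul_rpow hs0.le ht0.le]
          have e3 : t ^ (A + b) * t ^ (-b) = t ^ A := by
            rw [← Real.rpow_add ht0]; simp
          linear_combination (-3 * C * M * N * s ^ (-b)) * e3
        _ ≤ 5 * (C * M * N * t ^ (A + b) * (s * t) ^ (-b)) := by linarith
        _ = 5 * C * M * N * t ^ (A + b) * (s * t) ^ (-b) := by ring
        _ ≤ _ := by gcongr
  unfold paraFun
  rw [← (summable_paraFun η hb hm hB hV y).tsum_sub (summable_paraFun η hb hm hB hV x)]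
  refine (tsum_of_norm_bounded (hs1.mul_left _).hasSum key).trans ?_
  rw [tsum_mul_left]
  calc _ ≤ 5 * C * M * N * t ^ (A + b) * D := by gcongr
    _ = _ := by ring

end Paraproduct

/-! ### Fourier multipliers of bounded functions -/

section Multiplier

open FourierTransform

variable {d : ℕ}

theorem hasTemperateGrowth_comp_smul (G : 𝓢(Sp d, ℂ)) (ε : ℝ) :
    Function.HasTemperateGrowth fun ξ => G (ε • ξ) :=
  G.hasTemperateGrowth.comp ((ε • ContinuousLinearMap.id ℝ (Sp d)).hasTemperateGrowth)

/-- The inverse Fourier transform can be moved to an integrable factor, which need not be a Schwartz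
function. -/
theorem integral_fourierInv_mul_of_integrable (G : 𝓢(Sp d, ℂ)) {ψ : Sp d → ℂ}
    (hψ : Integrable ψ) : ∫ w, 𝓕⁻ G w * ψ w = ∫ ξ, G ξ * 𝓕⁻ ψ ξ := by
  have h := VectorFourier.integral_bilin_fourierIntegral_eq_flip (ContinuousLinearMap.mul ℂ ℂ)
    (L := innerₗ (Sp d)) (μ := volume) (ν := volume) Real.continuous_fourierChar continuous_inner
    G.integrable.comp_neg hψ
  have h' : ∫ w, 𝓕 (fun x => G (-x)) w * ψ w = ∫ x, G (-x) * 𝓕 ψ x := by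
    simpa using! h
  rw [SchwartzMap.fourierInv_coe, Real.fourierInv_eq_fourier_comp_neg, h',
    ← integral_neg_eq_self]
  simp only [neg_neg, Real.fourierInv_eq_fourier_neg]

theorem fourierInv_comp_add_smul (φ : Sp d → ℂ) {ε : ℝ} (hε : 0 < ε) (z ξ : Sp d) :
    𝓕⁻ (fun w => φ (z + ε • w)) ξ =
      ((ε ^ d)⁻¹ : ℝ) • (Real.fourierChar (-inner ℝ (ε⁻¹ • ξ) z) • 𝓕⁻ φ (ε⁻¹ • ξ)) := by
  rw [Real.fourierInv_eq, Real.fourierInv_eq]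
  have h1 := Measure.integral_comp_smul (volume : Measure (Sp d))
    (fun v => Real.fourierChar (inner ℝ v (ε⁻¹ • ξ)) • φ (z + v)) ε
  have h2 := integral_add_left_eq_self (μ := volume)
    (fun v : Sp d => Real.fourierChar (inner ℝ (v - z) (ε⁻¹ • ξ)) • φ v) z
  simp only [add_sub_cancel_left] at h2
  rw [h2] at h1
  simp only [finrank_euclideanSpace, Fintype.card_fin, abs_of_pos (inv_pos.2 (pow_pos hε d))] at h1
  have e : ∀ v : Sp d, inner ℝ (ε • v) (ε⁻¹ • ξ) = inner ℝ v ξ := by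
    intro v
    rw [real_inner_smul_left, real_inner_smul_right]
    field_simp
  simp only [e] at h1
  rw [h1]
  congr 1
  rw [Circle.smul_def, ← integral_smul]
  congr 1; ext v
  rw [← Circle.smul_def, ← mul_smul, ← AddChar.map_add_eq_mul, inner_sub_left, real_inner_comm z]
  congr 2
  ring_nf

/-- On test functions, a Fourier multiplier acts by integration against its kernel. -/
theorem fourier_smulLeftCLM_fourierInv_apply (G : 𝓢(Sp d, ℂ)) {ε : ℝ} (hε : 0 < ε)
    (φ : 𝓢(Sp d, ℂ)) (z : Sp d) :
    𝓕 (SchwartzMap.smulLeftCLM ℂ (fun ξ => G (ε • ξ)) (𝓕⁻ φ)) z =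
      ∫ w, 𝓕⁻ G w * φ (z + ε • w) := by
  rw [integral_fourierInv_mul_of_integrable G ((φ.integrable.comp_add_left z).comp_smul hε.ne'),
    SchwartzMap.fourier_coe, Real.fourier_eq]
  have h1 := Measure.integral_comp_smul (volume : Measure (Sp d))
    (fun ξ => Real.fourierChar (-inner ℝ (ε⁻¹ • ξ) z) • (G ξ * 𝓕⁻ φ (ε⁻¹ • ξ))) ε
  simp only [finrank_euclideanSpace, Fintype.card_fin, abs_of_pos (inv_pos.2 (pow_pos hε d)),
    smul_smul, inv_mul_cancel₀ hε.ne', one_smul] at h1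
  simp only [SchwartzMap.smulLeftCLM_apply_apply (hasTemperateGrowth_comp_smul G ε), smul_eq_mul]
  rw [h1, ← integral_smul]
  congr 1; ext ξ
  rw [fourierInv_comp_add_smul _ hε, ← SchwartzMap.fourierInv_coe, mul_smul_comm, mul_smul_comm]

theorem integrable_schwartz_mul (φ : 𝓢(Sp d, ℂ)) {H : Sp d → ℂ} (hH : Measurable H) {B : ℝ}
    (hB : ∀ z, ‖H z‖ ≤ B) : Integrable fun z => φ z * H z :=
  φ.integrable.mul_bdd (c := B) hH.aestronglyMeasurable (.of_forall hB)

theorem integral_integral_mul_eq_mollify (κ φ : 𝓢(Sp d, ℂ)) (ε : ℝ) {H : Sp d → ℂ}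
    (hH : Measurable H) {B : ℝ} (hB : ∀ z, ‖H z‖ ≤ B) :
    ∫ z, (∫ w, κ w * φ (z + ε • w)) * H z = ∫ y, φ y * mollify κ ε H y := by
  have hint : Integrable (Function.uncurry fun z w : Sp d => κ w * φ (z + ε • w) * H z)
      (volume.prod volume) := by
    have hm : AEStronglyMeasurable (Function.uncurry fun z w : Sp d => κ w * φ (z + ε • w))
        (volume.prod volume) := by
      refine Continuous.aestronglyMeasurable ?_
      have := κ.continuous
      have := φ.continuous
      unfold Function.uncurry
      fun_prop
    refine Integrable.mul_bdd (c := B) ?_ (hH.comp measurable_fst).aestronglyMeasurable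
      (.of_forall fun _ => hB _)
    refine (integrable_prod_iff' hm).2 ?_
    constructor
    · exact .of_forall fun w => ((φ.integrable.comp_add_right (ε • w)).const_mul (κ w))
    · simp only [Function.uncurry, norm_mul, integral_const_mul]
      have : ∀ w : Sp d, ∫ z, ‖φ (z + ε • w)‖ = ∫ z, ‖φ z‖ := fun w =>
        integral_add_right_eq_self (fun z => ‖φ z‖) (ε • w)
      simp only [this]
      exact κ.integrable.norm.mul_const _
  have hint2 : Integrable (Function.uncurry fun y w : Sp d => φ y * (κ w * H (y - ε • w)))
      (volume.prod volume) := by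
    have h1 : Integrable (fun p : Sp d × Sp d => φ p.1 * κ p.2 * H (p.1 - ε • p.2))
        (volume.prod volume) :=
      (φ.integrable.mul_prod κ.integrable).mul_bdd (c := B)
        (hH.comp (by fun_prop)).aestronglyMeasurable (.of_forall fun _ => hB _)
    refine h1.congr (.of_forall fun p => ?_)
    simp only [Function.uncurry]; ring
  simp only [← integral_mul_const, mollify, ← integral_const_mul]
  rw [integral_integral_swap hint, integral_integral_swap hint2]
  congr 1; ext w
  rw [← integral_sub_right_eq_self _ (ε • w)]
  congr 1; ext y
  simp only [sub_add_cancel]; ring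

/-- The Fourier multiplier with symbol `G (ε ·)` acts on bounded functions as a mollification. -/
theorem fourierMultiplierCLM_apply_eq_mollify (G : 𝓢(Sp d, ℂ)) {ε : ℝ} (hε : 0 < ε)
    {u : 𝓢'(Sp d, ℂ)} {H : Sp d → ℂ} (hH : Measurable H) {B : ℝ} (hB : ∀ z, ‖H z‖ ≤ B)
    (hu : ∀ φ : 𝓢(Sp d, ℂ), u φ = ∫ x, φ x * H x) (φ : 𝓢(Sp d, ℂ)) :
    TemperedDistribution.fourierMultiplierCLM ℂ (fun ξ => G (ε • ξ)) u φ =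
      ∫ y, φ y * mollify (𝓕⁻ G) ε H y := by
  rw [TemperedDistribution.fourierMultiplierCLM_apply_apply, hu]
  simp only [fourier_smulLeftCLM_fourierInv_apply G hε]
  exact integral_integral_mul_eq_mollify (𝓕⁻ G) φ ε hH hB

end Multiplier

/-! ### Distributions given by bounded continuous functions -/

section Represents

variable {d : ℕ}

theorem Represents.of_bounded {u : 𝓢'(Sp d, ℂ)} {H : Sp d → ℂ} (hH : Continuous H) {B : ℝ}
    (hB : ∀ z, ‖H z‖ ≤ B) (hu : ∀ φ : 𝓢(Sp d, ℂ), u φ = ∫ x, φ x * H x) : Represents u H :=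
  ⟨hH, ⟨B, 0, by simpa using hB⟩, hu⟩

theorem continuous_eq_of_integral_eq {H H' : Sp d → ℂ} (hH : Continuous H) (hH' : Continuous H')
    (h : ∀ φ : 𝓢(Sp d, ℂ), ∫ x, φ x * H x = ∫ x, φ x * H' x) : H = H' := by
  have h0 : ∀ᵐ x ∂(volume : Measure (Sp d)), H x = H' x := by
    refine ae_eq_of_integral_contDiff_smul_eq hH.locallyIntegrable hH'.locallyIntegrable
      fun g hg hgc => ?_
    have hg₁ : HasCompactSupport (Complex.ofRealCLM ∘ g) := hgc.comp_left rfl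
    have hg₂ : ContDiff ℝ ∞ (Complex.ofRealCLM ∘ g) := by fun_prop
    have := h (hg₁.toSchwartzMap hg₂)
    simpa using this
  exact Measure.eq_of_ae_eq h0 hH hH'

theorem Represents.unique {u : 𝓢'(Sp d, ℂ)} {H H' : Sp d → ℂ} (h : Represents u H)
    (h' : Represents u H') : H = H' :=
  continuous_eq_of_integral_eq h.1 h'.1 fun φ => (h.2.2 φ).symm.trans (h'.2.2 φ)

theorem Represents.toFun_eq {u : 𝓢'(Sp d, ℂ)} {H : Sp d → ℂ} (h : Represents u H) :
    toFun u = H := by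
  have hex : ∃ v, Represents u v := ⟨H, h⟩
  rw [toFun, dif_pos hex]
  exact hex.choose_spec.unique h

/-- A real distribution given by a bounded continuous function is given by a real one. -/
theorem Represents.im_eq_zero {u : 𝓢'(Sp d, ℂ)} {H : Sp d → ℂ} (h : Represents u H)
    {B : ℝ} (hB : ∀ z, ‖H z‖ ≤ B) (hu : IsRealDistribution u) (x : Sp d) : (H x).im = 0 := by
  have key : (fun x => (H x).im) = fun _ => (0 : ℝ) := by
    have hc : Continuous fun x => (H x).im := Complex.continuous_im.comp h.1
    refine Measure.eq_of_ae_eq (μ := volume) ?_ hc continuous_const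
    refine ae_eq_of_integral_contDiff_smul_eq hc.locallyIntegrable
      continuous_const.locallyIntegrable fun g hg hgc => ?_
    have hg₁ : HasCompactSupport (Complex.ofRealCLM ∘ g) := hgc.comp_left rfl
    have hg₂ : ContDiff ℝ ∞ (Complex.ofRealCLM ∘ g) := by fun_prop
    have h1 := hu (hg₁.toSchwartzMap hg₂) (by simp)
    have hi := integrable_schwartz_mul (hg₁.toSchwartzMap hg₂) h.1.measurable hB
    rw [h.2.2, ← Complex.imCLM_apply, ← ContinuousLinearMap.integral_comp_comm _ hi] at h1
    simpa using h1
  exact congrFun key x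

theorem Represents.add {u v : 𝓢'(Sp d, ℂ)} {H K : Sp d → ℂ} {B B' : ℝ} (h : Represents u H)
    (hB : ∀ z, ‖H z‖ ≤ B) (h' : Represents v K) (hB' : ∀ z, ‖K z‖ ≤ B') :
    Represents (u + v) (fun x => H x + K x) := by
  refine .of_bounded (h.1.add h'.1) (B := B + B')
    (fun z => (norm_add_le _ _).trans (add_le_add (hB z) (hB' z))) fun φ => ?_
  have : (u + v) φ = u φ + v φ := rfl
  rw [this, h.2.2, h'.2.2, ← integral_add (integrable_schwartz_mul φ h.1.measurable hB)
    (integrable_schwartz_mul φ h'.1.measurable hB')]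
  simp only [mul_add]

theorem Represents.sub {u v : 𝓢'(Sp d, ℂ)} {H K : Sp d → ℂ} {B B' : ℝ} (h : Represents u H)
    (hB : ∀ z, ‖H z‖ ≤ B) (h' : Represents v K) (hB' : ∀ z, ‖K z‖ ≤ B') :
    Represents (u - v) (fun x => H x - K x) := by
  refine .of_bounded (h.1.sub h'.1) (B := B + B')
    (fun z => (norm_sub_le _ _).trans (add_le_add (hB z) (hB' z))) fun φ => ?_
  have : (u - v) φ = u φ - v φ := rfl
  rw [this, h.2.2, h'.2.2, ← integral_sub (integrable_schwartz_mul φ h.1.measurable hB)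
    (integrable_schwartz_mul φ h'.1.measurable hB')]
  simp only [mul_sub]

theorem represents_one :
    Represents (Measure.toTemperedDistribution (volume : Measure (Sp d))) fun _ => 1 :=
  .of_bounded continuous_const (B := 1) (by simp) fun φ => by
    simp [Measure.toTemperedDistribution_apply]

end Represents

/-! ### Littlewood-Paley projections -/

section Cutoff

variable {d : ℕ}

theorem norm_iteratedFDeriv_comp_smul_le {θ : Sp d → ℂ} (hθ : ContDiff ℝ ∞ θ) (i : ℕ) {C : ℝ}
    (hC : ∀ x, ‖iteratedFDeriv ℝ i θ x‖ ≤ C) {ε : ℝ} (hε0 : 0 ≤ ε) (hε1 : ε ≤ 1) (x : Sp d) :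
    ‖iteratedFDeriv ℝ i (fun x => θ (ε • x)) x‖ ≤ C := by
  have h := (ε • ContinuousLinearMap.id ℝ (Sp d)).iteratedFDeriv_comp_right hθ x (i := i)
    (by exact_mod_cast le_top)
  have e : θ ∘ (ε • ContinuousLinearMap.id ℝ (Sp d)) = fun x => θ (ε • x) := by
    ext x; simp
  rw [e] at h
  rw [h]
  refine (ContinuousMultilinearMap.norm_compContinuousLinearMap_le _ _).trans ?_
  have hL : ‖ε • ContinuousLinearMap.id ℝ (Sp d)‖ ≤ 1 := by
    rw [norm_smul, Real.norm_of_nonneg hε0]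
    exact mul_le_one₀ hε1 (norm_nonneg _) ContinuousLinearMap.norm_id_le
  refine (mul_le_of_le_one_right (norm_nonneg _) ?_).trans (hC _)
  exact Finset.prod_le_one (fun _ _ => norm_nonneg _) fun _ _ => hL

/-- Smooth cutoffs at infinity converge to the identity on the Schwartz space. -/
theorem tendsto_smulLeftCLM_comp_smul (G : 𝓢(Sp d, ℂ)) {a : ℝ} (ha : 0 < a)
    (hG : ∀ x, ‖x‖ < a → G x = 1) (ψ : 𝓢(Sp d, ℂ)) :
    Filter.Tendsto (fun M : ℕ => SchwartzMap.smulLeftCLM ℂ (fun ξ => G (((2 : ℝ) ^ M)⁻¹ • ξ)) ψ)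
      Filter.atTop (nhds ψ) := by
  rw [(schwartz_withSeminorms ℝ (Sp d) ℂ).tendsto_nhds]
  rintro ⟨k, n⟩ r hr
  set θ : Sp d → ℂ := fun x => G x - 1 with hθ
  have hθs : ContDiff ℝ ∞ θ := (G.smooth ⊤).sub contDiff_const
  have hθb : ∀ i, ∃ C, ∀ x, ‖iteratedFDeriv ℝ i θ x‖ ≤ C := by
    intro i
    obtain ⟨C, hC⟩ := G.decay 0 i
    refine ⟨C + 1, fun x => ?_⟩
    have e : iteratedFDeriv ℝ i θ x =
        iteratedFDeriv ℝ i G x - iteratedFDeriv ℝ i (fun _ => (1 : ℂ)) x :=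
      iteratedFDeriv_sub_apply (G.smooth i).contDiffAt contDiff_const.contDiffAt
    rw [e]
    refine (norm_sub_le _ _).trans (add_le_add (by simpa using hC.2 x) ?_)
    rcases Nat.eq_zero_or_pos i with rfl | hi
    · simp
    · rw [iteratedFDeriv_const_of_ne hi.ne']; simp
  choose Cθ hCθ using hθb
  have hCθ0 : ∀ i, 0 ≤ Cθ i := fun i => (norm_nonneg _).trans (hCθ i 0)
  set D := ∑ i ∈ Finset.range (n + 1), (n.choose i : ℝ) * Cθ i *
    SchwartzMap.seminorm ℝ (k + 1) (n - i) ψ with hD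
  have hD0 : 0 ≤ D := Finset.sum_nonneg fun i _ => by
    have := hCθ0 i; positivity
  have key : ∀ M : ℕ, SchwartzMap.seminorm ℝ k n
      (SchwartzMap.smulLeftCLM ℂ (fun ξ => G (((2 : ℝ) ^ M)⁻¹ • ξ)) ψ - ψ) ≤
        ((2 : ℝ)⁻¹) ^ M * (D / a) := by
    intro M
    refine SchwartzMap.seminorm_le_bound ℝ k n _ (by positivity) fun x => ?_
    set ε : ℝ := ((2 : ℝ) ^ M)⁻¹ with hε
    have hε0 : 0 < ε := by positivity
    have hε1 : ε ≤ 1 := inv_le_one_of_one_le₀ (one_le_pow₀ one_le_two)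
    have e : ((SchwartzMap.smulLeftCLM ℂ (fun ξ => G (ε • ξ)) ψ - ψ : 𝓢(Sp d, ℂ)) : Sp d → ℂ) =
        fun x => θ (ε • x) * ψ x := by
      ext x
      rw [sub_apply,
        SchwartzMap.smulLeftCLM_apply_apply (hasTemperateGrowth_comp_smul G ε)]
      simp [hθ, sub_mul]
    rw [e]
    rcases lt_or_ge ‖ε • x‖ a with hx | hx
    · have hz : (fun x => θ (ε • x) * ψ x) =ᶠ[nhds x] fun _ => 0 := by
        have : ∀ᶠ y in nhds x, ‖ε • y‖ < a :=
          (Continuous.tendsto (by fun_prop : Continuous fun y : Sp d => ‖ε • y‖) x).eventually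
            (gt_mem_nhds hx)
        filter_upwards [this] with y hy
        simp [hθ, hG _ hy]
      rw [(Filter.EventuallyEq.iteratedFDeriv ℝ hz n).eq_of_nhds]
      simp only [iteratedFDeriv_fun_zero, Pi.zero_apply, norm_zero, mul_zero]
      positivity
    · rw [norm_smul, Real.norm_of_nonneg hε0.le] at hx
      have h1 := norm_iteratedFDeriv_mul_le (𝕜 := ℝ) (N := ∞) (f := fun x => θ (ε • x)) (g := ψ)
        (hθs.comp (by fun_prop)) (ψ.smooth ⊤) x (n := n) (by exact_mod_cast le_top)
      have h2 : ‖x‖ ^ k ≤ ε / a * ‖x‖ ^ (k + 1) := by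
        rw [pow_succ, div_mul_eq_mul_div, le_div_iff₀ ha]
        have : 0 ≤ ‖x‖ ^ k := by positivity
        nlinarith
      calc ‖x‖ ^ k * _ ≤ (ε / a * ‖x‖ ^ (k + 1)) * ∑ i ∈ Finset.range (n + 1), (n.choose i : ℝ) *
            ‖iteratedFDeriv ℝ i (fun x => θ (ε • x)) x‖ * ‖iteratedFDeriv ℝ (n - i) ψ x‖ :=
          mul_le_mul h2 h1 (norm_nonneg _) (by positivity)
        _ = ε / a * ∑ i ∈ Finset.range (n + 1), (n.choose i : ℝ) *
            ‖iteratedFDeriv ℝ i (fun x => θ (ε • x)) x‖ *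
              (‖x‖ ^ (k + 1) * ‖iteratedFDeriv ℝ (n - i) ψ x‖) := by
          rw [mul_assoc, Finset.mul_sum]
          congr 1
          exact Finset.sum_congr rfl fun i _ => by ring
        _ ≤ ε / a * D := by
          rw [hD]
          gcongr with i
          · exact mul_nonneg (by positivity) (hCθ0 i)
          · exact norm_iteratedFDeriv_comp_smul_le hθs i (hCθ i) hε0.le hε1 x
          · exact SchwartzMap.le_seminorm ℝ _ _ _ _
        _ = _ := by rw [hε, inv_pow]; ring
  have hlim : Filter.Tendsto (fun M : ℕ => ((2 : ℝ)⁻¹) ^ M * (D / a)) Filter.atTop (nhds 0) := by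
    simpa using (tendsto_pow_atTop_nhds_zero_of_lt_one (r := (2 : ℝ)⁻¹) (by norm_num)
      (by norm_num)).mul_const (D / a)
  filter_upwards [hlim.eventually (gt_mem_nhds hr)] with M hM
  exact (key M).trans_lt hM

end Cutoff

namespace DyadicPartition

open FourierTransform

variable {d : ℕ} (P : DyadicPartition d)

theorem χ_eq_zero {ξ : Sp d} (h : 4 / 3 ≤ ‖ξ‖) : P.χ ξ = 0 :=
  image_eq_zero_of_notMem_tsupport fun hξ => absurd (P.supp_χ hξ) (not_lt.2 h)

theorem ρ_eq_zero {ξ : Sp d} (h : ‖ξ‖ ≤ 3 / 4 ∨ 8 / 3 ≤ ‖ξ‖) : P.ρ ξ = 0 :=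
  image_eq_zero_of_notMem_tsupport fun hξ => by
    have := P.supp_ρ hξ
    rcases h with h | h
    · exact absurd this.1 (not_lt.2 h)
    · exact absurd this.2 (not_lt.2 h)

theorem χ_eq_one {ξ : Sp d} (h : ‖ξ‖ ≤ 3 / 4) : P.χ ξ = 1 := by
  have h1 := P.sum_eq ξ
  have h2 : (fun j : ℕ => P.ρ (((2 : ℝ) ^ j)⁻¹ • ξ)) = fun _ => 0 := by
    ext j
    refine P.ρ_eq_zero (.inl ?_)
    rw [norm_smul, norm_inv, norm_pow, Real.norm_of_nonneg zero_le_two]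
    refine (mul_le_of_le_one_left (norm_nonneg _) ?_).trans h
    exact inv_le_one_of_one_le₀ (one_le_pow₀ one_le_two)
  rw [h2] at h1
  linarith [h1.unique hasSum_zero]

/-- Comparing the partition of unity at `ξ` and at `ξ / 2`: the function `χ` determines `ρ`. -/
theorem χ_half (ξ : Sp d) : P.χ ((2 : ℝ)⁻¹ • ξ) = P.χ ξ + P.ρ ξ := by
  have h1 := P.sum_eq ξ
  have h2 := P.sum_eq ((2 : ℝ)⁻¹ • ξ)
  rw [← hasSum_nat_add_iff' 1] at h1
  have e : (fun j : ℕ => P.ρ (((2 : ℝ) ^ (j + 1))⁻¹ • ξ)) =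
      fun j : ℕ => P.ρ (((2 : ℝ) ^ j)⁻¹ • (2 : ℝ)⁻¹ • ξ) := by
    ext j
    rw [smul_smul, pow_succ, mul_inv]
  rw [e] at h1
  have := h1.unique h2
  simp at this
  linarith

/-- The function `χ` as a Schwartz function. -/
def chi : 𝓢(Sp d, ℂ) :=
  HasCompactSupport.toSchwartzMap (f := fun ξ => (P.χ ξ : ℂ))
    (HasCompactSupport.intro (isCompact_closedBall 0 (4 / 3)) fun ξ hξ => by
      rw [P.χ_eq_zero (by simpa using (not_le.1 (by simpa using hξ)).le)]; simp)
    (Complex.ofRealCLM.contDiff.comp P.smooth_χ)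

@[simp] theorem chi_apply (ξ : Sp d) : P.chi ξ = P.χ ξ := rfl

/-- The convolution kernel of the lowest Littlewood-Paley block. -/
def kernel : 𝓢(Sp d, ℂ) := 𝓕⁻ P.chi

theorem integral_kernel : ∫ w, P.kernel w = 1 := by
  have h : 𝓕 P.kernel 0 = P.chi 0 := by
    rw [kernel, FourierTransform.fourier_fourierInv_eq]
  rw [SchwartzMap.fourier_coe, Real.fourier_eq] at h
  simpa [P.χ_eq_one (ξ := 0) (by rw [norm_zero]; norm_num)] using h

theorem kernel_im (w : Sp d) : (P.kernel w).im = 0 := by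
  rw [← Complex.conj_eq_iff_im, kernel, SchwartzMap.fourierInv_coe, Real.fourierInv_eq',
    ← integral_conj, ← integral_neg_eq_self]
  congr 1; ext v
  have h2 : P.χ (-v) = P.χ v := P.radial_χ _ _ (norm_neg v)
  simp only [smul_eq_mul, map_mul, chi_apply, Complex.conj_ofReal, h2, ← Complex.exp_conj,
    inner_neg_left, Complex.conj_I]
  congr 2
  push_cast; ring

/-- The operator `∑_{-1 ≤ j < M} Δ_j`, which is the Fourier multiplier with symbol `χ (2^{-M} ·)`. -/
def lowPass (M : ℕ) (u : 𝓢'(Sp d, ℂ)) : 𝓢'(Sp d, ℂ) :=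
  TemperedDistribution.fourierMultiplierCLM ℂ (fun ξ => P.chi (((2 : ℝ) ^ M)⁻¹ • ξ)) u

theorem symbol_zero_eq :
    (fun ξ => (P.symbol 0 ξ : ℂ)) = fun ξ => P.chi (((2 : ℝ) ^ 0)⁻¹ • ξ) := by
  ext ξ; simp [symbol]

theorem symbol_succ_eq (j : ℕ) : (fun ξ => (P.symbol (j + 1) ξ : ℂ)) =
    (fun ξ => P.chi (((2 : ℝ) ^ (j + 1))⁻¹ • ξ)) - fun ξ => P.chi (((2 : ℝ) ^ j)⁻¹ • ξ) := by
  ext ξ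
  have := P.χ_half (((2 : ℝ) ^ j)⁻¹ • ξ)
  rw [smul_smul, ← mul_inv, ← pow_succ'] at this
  simp [symbol, this]

theorem block_zero_eq (u : 𝓢'(Sp d, ℂ)) : block P 0 u = P.lowPass 0 u := by
  rw [block, symbol_zero_eq, lowPass]

theorem block_succ_eq (j : ℕ) (u : 𝓢'(Sp d, ℂ)) :
    block P (j + 1) u = P.lowPass (j + 1) u - P.lowPass j u := by
  rw [block, symbol_succ_eq, lowPass, lowPass]
  simp only [TemperedDistribution.fourierMultiplierCLM_apply]
  rw [TemperedDistribution.smulLeftCLM_sub (hasTemperateGrowth_comp_smul _ _)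
    (hasTemperateGrowth_comp_smul _ _)]
  exact map_sub (FourierTransform.fourierInvCLM ℂ 𝓢'(Sp d, ℂ)) _ _

theorem sum_block_eq (M : ℕ) (u : 𝓢'(Sp d, ℂ)) :
    ∑ j ∈ Finset.range (M + 1), block P j u = P.lowPass M u := by
  induction M with
  | zero => simp [block_zero_eq]
  | succ M ih => rw [Finset.sum_range_succ, ih, block_succ_eq]; abel

theorem hasTemperateGrowth_symbol (m : ℕ) :
    Function.HasTemperateGrowth fun ξ => (P.symbol m ξ : ℂ) := by
  cases m with
  | zero => rw [symbol_zero_eq]; exact hasTemperateGrowth_comp_smul _ _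
  | succ j =>
    rw [symbol_succ_eq]
    exact (hasTemperateGrowth_comp_smul _ _).sub (hasTemperateGrowth_comp_smul _ _)

/-- The function `χ (2^{-(m+1)} ·)` is `1` on the support of the symbol of the block `m`. -/
theorem lowPass_block (m : ℕ) (u : 𝓢'(Sp d, ℂ)) :
    P.lowPass (m + 1) (block P m u) = block P m u := by
  rw [lowPass, block, TemperedDistribution.fourierMultiplierCLM_fourierMultiplierCLM_apply
    (P.hasTemperateGrowth_symbol m) (hasTemperateGrowth_comp_smul _ _)]
  congr 2
  ext ξ
  simp only [Pi.mul_apply, chi_apply]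
  rcases eq_or_ne (P.symbol m ξ) 0 with h | h
  · simp [h]
  · suffices hs : ‖((2 : ℝ) ^ (m + 1))⁻¹ • ξ‖ ≤ 3 / 4 by rw [P.χ_eq_one hs]; simp
    rw [norm_smul, norm_inv, norm_pow, Real.norm_of_nonneg zero_le_two]
    cases m with
    | zero =>
      have : ‖ξ‖ < 4 / 3 := by
        by_contra hc
        exact h (P.χ_eq_zero (not_lt.1 hc))
      norm_num; linarith
    | succ j =>
      have : ‖((2 : ℝ) ^ j)⁻¹ • ξ‖ < 8 / 3 := by
        by_contra hc
        exact h (P.ρ_eq_zero (.inr (not_lt.1 hc)))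
      rw [norm_smul, norm_inv, norm_pow, Real.norm_of_nonneg zero_le_two] at this
      rw [pow_succ, pow_succ, mul_inv, mul_inv]
      linarith

theorem tendsto_lowPass (u : 𝓢'(Sp d, ℂ)) (φ : 𝓢(Sp d, ℂ)) :
    Filter.Tendsto (fun M => P.lowPass M u φ) Filter.atTop (nhds (u φ)) := by
  have h1 := tendsto_smulLeftCLM_comp_smul P.chi (a := 3 / 4) (by norm_num)
    (fun x hx => by simp [P.χ_eq_one hx.le]) (𝓕⁻ φ)
  have h2 := (u.continuous.comp (FourierTransform.fourierCLM ℂ 𝓢(Sp d, ℂ)).continuous).tendsto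
    (𝓕⁻ φ)
  have h3 := h2.comp h1
  have e : (⇑u ∘ ⇑(FourierTransform.fourierCLM ℂ 𝓢(Sp d, ℂ))) (𝓕⁻ φ) = u φ := by
    simp [FourierTransform.fourier_fourierInv_eq]
  exact e ▸ h3

theorem lowPass_apply_of_bounded (M : ℕ) {u : 𝓢'(Sp d, ℂ)} {H : Sp d → ℂ} (hH : Measurable H)
    {B : ℝ} (hB : ∀ z, ‖H z‖ ≤ B) (hu : ∀ φ : 𝓢(Sp d, ℂ), u φ = ∫ x, φ x * H x)
    (φ : 𝓢(Sp d, ℂ)) :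
    P.lowPass M u φ = ∫ y, φ y * mollify P.kernel ((2 : ℝ) ^ M)⁻¹ H y :=
  fourierMultiplierCLM_apply_eq_mollify P.chi (by positivity) hH hB hu φ

/-- The symbol `χ` is real and even, so its kernel is real. -/
theorem isReal_lowPass (M : ℕ) {u : 𝓢'(Sp d, ℂ)} (hu : IsRealDistribution u) :
    IsRealDistribution (P.lowPass M u) := by
  intro φ hφ
  rw [lowPass, TemperedDistribution.fourierMultiplierCLM_apply_apply]
  refine hu _ fun z => ?_
  rw [fourier_smulLeftCLM_fourierInv_apply P.chi (by positivity), ← Complex.conj_eq_iff_im,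
    ← integral_conj]
  congr 1; ext w
  rw [map_mul, ← kernel, Complex.conj_eq_iff_im.2 (P.kernel_im w), Complex.conj_eq_iff_im.2 (hφ _)]

theorem isReal_block (m : ℕ) {u : 𝓢'(Sp d, ℂ)} (hu : IsRealDistribution u) :
    IsRealDistribution (block P m u) := by
  cases m with
  | zero => rw [block_zero_eq]; exact P.isReal_lowPass 0 hu
  | succ j =>
    rw [block_succ_eq]
    intro φ hφ
    have : (P.lowPass (j + 1) u - P.lowPass j u) φ = P.lowPass (j + 1) u φ - P.lowPass j u φ := rfl
    rw [this, Complex.sub_im, P.isReal_lowPass _ hu φ hφ, P.isReal_lowPass _ hu φ hφ, sub_zero]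

end DyadicPartition

/-! ### The `L^∞` norm of a distribution -/

section Linfty

variable {d : ℕ}

theorem memLp_top_of_bounded {H : Sp d → ℂ} (hH : Measurable H) {B : ℝ} (hB : ∀ z, ‖H z‖ ≤ B) :
    MemLp H ⊤ (volume : Measure (Sp d)) :=
  memLp_top_of_bound hH.aestronglyMeasurable B (.of_forall hB)

theorem toTemperedDistribution_toLp_apply {H : Sp d → ℂ} (hH : Measurable H) {B : ℝ}
    (hB : ∀ z, ‖H z‖ ≤ B) (φ : 𝓢(Sp d, ℂ)) :
    Lp.toTemperedDistribution ((memLp_top_of_bounded hH hB).toLp H) φ = ∫ x, φ x * H x := by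
  rw [Lp.toTemperedDistribution_apply]
  refine integral_congr_ae ?_
  filter_upwards [(memLp_top_of_bounded hH hB).coeFn_toLp] with x hx
  rw [hx, smul_eq_mul]

/-- Every bounded continuous function is a tempered distribution. -/
theorem exists_represents {H : Sp d → ℂ} (hH : Continuous H) {B : ℝ} (hB : ∀ z, ‖H z‖ ≤ B) :
    ∃ u, Represents u H :=
  ⟨_, .of_bounded hH hB (toTemperedDistribution_toLp_apply hH.measurable hB)⟩

theorem linftyNorm_le {u : 𝓢'(Sp d, ℂ)} {H : Sp d → ℂ} (hH : Measurable H) {B : ℝ}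
    (hB : ∀ z, ‖H z‖ ≤ B) (hu : ∀ φ : 𝓢(Sp d, ℂ), u φ = ∫ x, φ x * H x) :
    linftyNorm u ≤ ENNReal.ofReal B := by
  have h : Lp.toTemperedDistribution ((memLp_top_of_bounded hH hB).toLp H) = u := by
    ext φ
    rw [toTemperedDistribution_toLp_apply hH hB, hu]
  refine (iInf₂_le (f := fun (h : Lp ℂ ⊤ (volume : Measure (Sp d)))
    (_ : Lp.toTemperedDistribution h = u) => ‖h‖ₑ) _ h).trans ?_
  rw [Lp.enorm_toLp, eLpNorm_exponent_top]
  exact eLpNormEssSup_le_of_ae_bound (.of_forall hB)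

/-- A distribution with finite `L^∞` norm is given by a function that is bounded everywhere. -/
theorem exists_bounded_of_linftyNorm_le {u : 𝓢'(Sp d, ℂ)} {B : ℝ} (hB : 0 ≤ B)
    (hu : linftyNorm u ≤ ENNReal.ofReal B) : ∃ H : Sp d → ℂ, Measurable H ∧ (∀ z, ‖H z‖ ≤ B) ∧
      ∀ φ : 𝓢(Sp d, ℂ), u φ = ∫ x, φ x * H x := by
  have hlt : linftyNorm u < ⊤ := hu.trans_lt ENNReal.ofReal_lt_top
  obtain ⟨h, hh⟩ := iInf_lt_iff.1 hlt
  obtain ⟨hhu, -⟩ := iInf_lt_iff.1 hh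
  have hinj : ∀ h' : Lp ℂ ⊤ (volume : Measure (Sp d)),
      Lp.toTemperedDistribution h' = u → h' = h := by
    intro h' hh'
    have hk := Lp.ker_toTemperedDistributionCLM_eq_bot (E := Sp d) (F := ℂ) (μ := volume) (p := ⊤)
    exact LinearMap.ker_eq_bot.1 hk (hh'.trans hhu.symm)
  have hn : ‖h‖ₑ ≤ ENNReal.ofReal B := by
    refine le_trans (le_iInf₂ fun h' hh' => ?_) hu
    rw [hinj h' hh']
  have hn' : ‖h‖ ≤ B := by
    rw [← ofReal_norm] at hn
    exact (ENNReal.ofReal_le_ofReal_iff hB).1 hn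
  have hae : ∀ᵐ x ∂(volume : Measure (Sp d)), ‖h x‖ ≤ B := by
    have h1 := ae_le_eLpNormEssSup (f := h) (μ := (volume : Measure (Sp d)))
    filter_upwards [h1] with x hx
    rw [← eLpNorm_exponent_top, ← Lp.enorm_def] at hx
    have := hx.trans hn
    rw [← ofReal_norm] at this
    exact (ENNReal.ofReal_le_ofReal_iff hB).1 this
  have hmeas := (Lp.stronglyMeasurable h).measurable
  have hset : MeasurableSet {x | ‖h x‖ ≤ B} := measurableSet_le hmeas.norm measurable_const
  refine ⟨Set.indicator {x | ‖h x‖ ≤ B} h, hmeas.indicator hset, fun z => ?_, fun φ => ?_⟩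
  · by_cases hz : ‖h z‖ ≤ B
    · rwa [Set.indicator_of_mem (by exact hz)]
    · rw [Set.indicator_of_notMem (by exact hz)]; simpa using hB
  · rw [← hhu, Lp.toTemperedDistribution_apply]
    refine integral_congr_ae ?_
    filter_upwards [hae] with x hx
    rw [Set.indicator_of_mem (by exact hx), smul_eq_mul]

end Linfty

/-! ### Littlewood-Paley blocks and paraproducts as functions -/

section Letters

variable {d : ℕ} (P : DyadicPartition d)

/-- The Littlewood-Paley blocks of a distribution, as functions. -/
def lpFun (u : 𝓢'(Sp d, ℂ)) (m : ℕ) : Sp d → ℂ := toFun (block P m u)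

theorem continuous_mollify (η : 𝓢(Sp d, ℂ)) {H : Sp d → ℂ} (hH : Measurable H) {B : ℝ}
    (hB : ∀ z, ‖H z‖ ≤ B) {ε : ℝ} (hε : ε ≠ 0) : Continuous (mollify η ε H) :=
  (hasTemperateGrowth_mollify η hH hB hε).1.continuous

theorem exists_norm_mollify_le (η : 𝓢(Sp d, ℂ)) : ∃ C, 0 ≤ C ∧ ∀ (H : Sp d → ℂ) (B ε : ℝ),
    0 < ε → Measurable H → (∀ z, ‖H z‖ ≤ B) → (∀ y, ‖mollify η ε H y‖ ≤ C * B) ∧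
      ∀ y y', ‖mollify η ε H y - mollify η ε H y'‖ ≤ 2 * C * B * (‖y - y'‖ / ε) := by
  obtain ⟨C, hC, h⟩ := exists_mollify_bound η
  refine ⟨C, hC, fun H B ε hε hH hB => ?_⟩
  have hB0 : 0 ≤ B := (norm_nonneg _).trans (hB 0)
  obtain ⟨h1, h2⟩ := h H B 0 ε 0 hB0 le_rfl zero_le_one hε hH ⟨B, hB⟩ (by simpa using hB)
  simp only [Real.rpow_zero, mul_one] at h1 h2
  refine ⟨h1, fun y y' => ?_⟩
  rcases le_total ‖y - y'‖ ε with hy | hy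
  · refine (h2 y y' hy).trans ?_
    have : 0 ≤ C * B * (‖y - y'‖ / ε) := by positivity
    linarith
  · have h3 : 1 ≤ ‖y - y'‖ / ε := (one_le_div hε).2 hy
    have h4 : 0 ≤ C * B := by positivity
    calc _ ≤ C * B + C * B := (norm_sub_le _ _).trans (add_le_add (h1 y) (h1 y'))
      _ ≤ _ := by nlinarith

/-- The blocks of an element of a Besov space satisfy `LPBound`: a block is given by a bounded
function and equals its own mollification at the inverse of its frequency, whence the Lipschitz
bound. -/
theorem exists_lpBound (b : ℝ) : ∃ C, 0 ≤ C ∧ ∀ (u : 𝓢'(Sp d, ℂ)) (N : ℝ), 0 ≤ N →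
    besovNorm P b u ≤ ENNReal.ofReal N →
      (∀ m, Represents (block P m u) (lpFun P u m)) ∧ LPBound b (C * N) (lpFun P u) := by
  obtain ⟨C, hC, h⟩ := exists_norm_mollify_le P.kernel
  refine ⟨4 * C * 2 ^ b, by positivity, fun u N hN hu => ?_⟩
  have key : ∀ m : ℕ, Represents (block P m u) (lpFun P u m) ∧
      (∀ y, ‖lpFun P u m y‖ ≤ C * (N * (2 ^ b * ((2 : ℝ) ^ m) ^ (-b)))) ∧
      ∀ y y', ‖lpFun P u m y - lpFun P u m y'‖ ≤
        2 * C * (N * (2 ^ b * ((2 : ℝ) ^ m) ^ (-b))) * (‖y - y'‖ * 2 ^ (m + 1)) := by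
    intro m
    have hc : (2 : ℝ) ^ (((m : ℝ) - 1) * b) * (2 ^ b * ((2 : ℝ) ^ m) ^ (-b)) = 1 := by
      rw [← Real.rpow_natCast, ← Real.rpow_mul zero_le_two, ← Real.rpow_add two_pos,
        ← Real.rpow_add two_pos]
      convert Real.rpow_zero _ using 2
      ring
    have h1 : linftyNorm (block P m u) ≤
        ENNReal.ofReal (N * (2 ^ b * ((2 : ℝ) ^ m) ^ (-b))) := by
      have h2 := (le_iSup (fun m : ℕ => ENNReal.ofReal ((2 : ℝ) ^ (((m : ℝ) - 1) * b)) *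
        linftyNorm (block P m u)) m).trans hu
      have h3 := mul_le_mul_right h2 (ENNReal.ofReal (2 ^ b * ((2 : ℝ) ^ m) ^ (-b)))
      rw [← mul_assoc, ← ENNReal.ofReal_mul (by positivity), mul_comm (2 ^ b * _) ((2 : ℝ) ^ _), hc,
        ENNReal.ofReal_one, one_mul, ← ENNReal.ofReal_mul (by positivity), mul_comm _ N] at h3
      exact h3
    obtain ⟨H, hH, hB, hrep⟩ := exists_bounded_of_linftyNorm_le (by positivity) h1
    have hε : (0 : ℝ) < ((2 : ℝ) ^ (m + 1))⁻¹ := by positivity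
    obtain ⟨h4, h5⟩ := h H _ _ hε hH hB
    have hR : Represents (block P m u) (mollify P.kernel ((2 : ℝ) ^ (m + 1))⁻¹ H) := by
      refine .of_bounded (continuous_mollify _ hH hB hε.ne') h4 fun φ => ?_
      rw [← P.lowPass_block]
      exact P.lowPass_apply_of_bounded (m + 1) hH hB hrep φ
    rw [lpFun, hR.toFun_eq]
    refine ⟨hR, h4, fun y y' => ?_⟩
    simpa using h5 y y'
  refine ⟨fun m => (key m).1, fun m y => ?_, fun m y x => ?_⟩
  · refine ((key m).2.1 y).trans ?_
    have : 0 ≤ C * 2 ^ b * N * ((2 : ℝ) ^ m) ^ (-b) := by positivity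
    calc _ = C * 2 ^ b * N * ((2 : ℝ) ^ m) ^ (-b) := by ring
      _ ≤ 4 * (C * 2 ^ b * N * ((2 : ℝ) ^ m) ^ (-b)) := by linarith
      _ = _ := by ring
  · refine ((key m).2.2 y x).trans (le_of_eq ?_)
    have hs : (0 : ℝ) < 2 ^ m := by positivity
    rw [sub_eq_add_neg 1 b, Real.rpow_add hs, Real.rpow_one, pow_succ]
    ring

theorem block_sub (m : ℕ) (u v : 𝓢'(Sp d, ℂ)) : block P m (u - v) = block P m u - block P m v :=
  map_sub _ u v

theorem lpFun_sub {u v : 𝓢'(Sp d, ℂ)} {b N N' : ℝ}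
    (hu : ∀ m, Represents (block P m u) (lpFun P u m)) (hu' : LPBound b N (lpFun P u))
    (hv : ∀ m, Represents (block P m v) (lpFun P v m)) (hv' : LPBound b N' (lpFun P v)) :
    lpFun P (u - v) = fun m z => lpFun P u m z - lpFun P v m z := by
  ext1 m
  rw [lpFun, block_sub]
  exact ((hu m).sub (hu'.norm_le m) (hv m) (hv'.norm_le m)).toFun_eq

theorem hasSum_integral_mul {V : ℕ → Sp d → ℂ} {a : ℕ → ℝ} (hc : ∀ m, Continuous (V m))
    (ha : Summable a) (hV : ∀ m y, ‖V m y‖ ≤ a m) (φ : 𝓢(Sp d, ℂ)) :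
    HasSum (fun m => ∫ x, φ x * V m x) (∫ x, φ x * ∑' m, V m x) := by
  have h := hasSum_integral_of_summable_integral_norm (F := fun m x => φ x * V m x)
    (μ := (volume : Measure (Sp d)))
    (fun m => integrable_schwartz_mul φ (hc m).measurable (hV m)) (by
      refine Summable.of_nonneg_of_le (fun m => by positivity) (fun m => ?_)
        (ha.mul_left (∫ x, ‖φ x‖))
      rw [← integral_mul_const]
      refine integral_mono (integrable_schwartz_mul φ (hc m).measurable (hV m)).norm
        (φ.integrable.norm.mul_const _) fun x => ?_
      simp only [norm_mul]
      exact mul_le_mul_of_nonneg_left (hV m x) (norm_nonneg _))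
  simpa only [tsum_mul_left] using h

/-- An element of a Besov space of positive regularity is the sum of its two lowest blocks and of
its paraproduct with the constant `1`. -/
theorem represents_of_lpBound {u : 𝓢'(Sp d, ℂ)} {b N : ℝ} (hb : 0 < b)
    (hu : ∀ m, Represents (block P m u) (lpFun P u m)) (hV : LPBound b N (lpFun P u)) :
    Represents u fun y => lpFun P u 0 y + lpFun P u 1 y +
      paraFun P.kernel (fun _ => 1) (lpFun P u) y := by
  have hone : ∀ z : Sp d, ‖(1 : ℂ)‖ ≤ 1 := by simp
  have ha := (summable_two_pow_rpow_neg hb).mul_left N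
  have hsum : ∀ y, ∑' m, lpFun P u m y = lpFun P u 0 y + lpFun P u 1 y +
      paraFun P.kernel (fun _ => 1) (lpFun P u) y := by
    intro y
    have hs : Summable fun m => lpFun P u m y := .of_norm_bounded ha fun m => hV.norm_le m y
    rw [← hs.sum_add_tsum_nat_add 2, paraFun]
    simp only [mollify_one, P.integral_kernel, one_mul, Finset.sum_range_succ,
      Finset.sum_range_zero, zero_add]
  have hcont : Continuous fun y => lpFun P u 0 y + lpFun P u 1 y +
      paraFun P.kernel (fun _ => 1) (lpFun P u) y :=
    ((hV.continuous 0).add (hV.continuous 1)).add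
      (continuous_paraFun P.kernel hb measurable_const hone hV)
  refine .of_bounded hcont (B := ∑' m : ℕ, N * ((2 : ℝ) ^ m) ^ (-b)) (fun y => ?_) fun φ => ?_
  · rw [← hsum]
    exact tsum_of_norm_bounded ha.hasSum fun m => hV.norm_le m y
  · simp only [← hsum]
    have h1 := ((hasSum_integral_mul hV.continuous ha hV.norm_le φ).tendsto_sum_nat).comp
      (Filter.tendsto_add_atTop_nat 1)
    refine tendsto_nhds_unique (P.tendsto_lowPass u φ) (h1.congr fun M => ?_)
    rw [← P.sum_block_eq]
    have : (∑ j ∈ Finset.range (M + 1), block P j u) φ =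
        ∑ j ∈ Finset.range (M + 1), block P j u φ := by
      rw [sum_apply]
    rw [this, Function.comp_apply]
    exact Finset.sum_congr rfl fun m _ => ((hu m).2.2 φ).symm

theorem represents_lowPass (M : ℕ) {u : 𝓢'(Sp d, ℂ)} {H : Sp d → ℂ} {B : ℝ} (hu : Represents u H)
    (hB : ∀ z, ‖H z‖ ≤ B) :
    Represents (P.lowPass M u) (mollify P.kernel ((2 : ℝ) ^ M)⁻¹ H) := by
  obtain ⟨C, hC, h⟩ := exists_norm_mollify_le P.kernel
  exact .of_bounded (continuous_mollify _ hu.1.measurable hB (by positivity))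
    (h H B _ (by positivity) hu.1.measurable hB).1
    (P.lowPass_apply_of_bounded M hu.1.measurable hB hu.2.2)

theorem represents_block_succ (j : ℕ) {u : 𝓢'(Sp d, ℂ)} {H : Sp d → ℂ} {B : ℝ}
    (hu : Represents u H) (hB : ∀ z, ‖H z‖ ≤ B) :
    Represents (block P (j + 1) u) fun y => mollify P.kernel ((2 : ℝ) ^ (j + 1))⁻¹ H y -
      mollify P.kernel ((2 : ℝ) ^ j)⁻¹ H y := by
  obtain ⟨C, hC, h⟩ := exists_norm_mollify_le P.kernel
  have hb := fun M : ℕ => (h H B ((2 : ℝ) ^ M)⁻¹ (by positivity) hu.1.measurable hB).1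
  rw [P.block_succ_eq]
  exact (represents_lowPass P _ hu hB).sub (hb _) (represents_lowPass P _ hu hB) (hb _)

/-- The Littlewood-Paley blocks are bounded on `L^∞`. -/
theorem exists_linftyNorm_block_le : ∃ C, 0 ≤ C ∧ ∀ (u : 𝓢'(Sp d, ℂ)) (H : Sp d → ℂ) (B : ℝ),
    Represents u H → (∀ z, ‖H z‖ ≤ B) → ∀ m, linftyNorm (block P m u) ≤ ENNReal.ofReal (C * B) := by
  obtain ⟨C, hC, h⟩ := exists_norm_mollify_le P.kernel
  refine ⟨2 * C, by positivity, fun u H B hu hB m => ?_⟩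
  have hB0 : 0 ≤ B := (norm_nonneg _).trans (hB 0)
  have hb := fun M : ℕ => (h H B ((2 : ℝ) ^ M)⁻¹ (by positivity) hu.1.measurable hB).1
  cases m with
  | zero =>
    have hr := represents_lowPass P 0 hu hB
    rw [P.block_zero_eq]
    refine linftyNorm_le hr.1.measurable (fun z => (hb 0 z).trans ?_) hr.2.2
    nlinarith [mul_nonneg hC hB0]
  | succ j =>
    have hr := represents_block_succ P j hu hB
    refine linftyNorm_le hr.1.measurable (fun z => (norm_sub_le _ _).trans
      ((add_le_add (hb _ z) (hb _ z)).trans (le_of_eq ?_))) hr.2.2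
    ring

/-- The blocks of a bounded continuous function are smooth and of temperate growth, and their
partial sums, which occur in the paraproduct, are mollifications. -/
theorem toFun_block_of_bounded {u : 𝓢'(Sp d, ℂ)} {H : Sp d → ℂ} {B : ℝ} (hu : Represents u H)
    (hB : ∀ z, ‖H z‖ ≤ B) (M : ℕ) :
    (∀ j, Function.HasTemperateGrowth (toFun (block P j u))) ∧
      (fun y => ∑ j ∈ Finset.range (M + 1), toFun (block P j u) y) =
        mollify P.kernel ((2 : ℝ) ^ M)⁻¹ H := by
  have h0 : toFun (block P 0 u) = mollify P.kernel ((2 : ℝ) ^ 0)⁻¹ H := by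
    rw [P.block_zero_eq]
    exact (represents_lowPass P 0 hu hB).toFun_eq
  have hs := fun j => (represents_block_succ P j hu hB).toFun_eq
  have hg := fun M : ℕ => hasTemperateGrowth_mollify P.kernel hu.1.measurable hB
    (ε := ((2 : ℝ) ^ M)⁻¹) (by positivity)
  constructor
  · intro j
    cases j with
    | zero => rw [h0]; exact hg 0
    | succ j => rw [hs]; exact (hg (j + 1)).sub (hg j)
  · induction M with
    | zero => ext y; simp [h0]
    | succ M ih =>
      ext y
      rw [Finset.sum_range_succ, congrFun ih y, hs]
      ring

theorem paraTerm_apply {u v : 𝓢'(Sp d, ℂ)} {H : Sp d → ℂ} {B : ℝ} (hu : Represents u H)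
    (hB : ∀ z, ‖H z‖ ≤ B) (hv : ∀ m, Represents (block P m v) (lpFun P v m)) (m : ℕ)
    (φ : 𝓢(Sp d, ℂ)) : paraTerm P u v (m + 2) φ =
      ∫ y, φ y * (mollify P.kernel ((2 : ℝ) ^ m)⁻¹ H y * lpFun P v (m + 2) y) := by
  obtain ⟨hg, hs⟩ := toFun_block_of_bounded P hu hB m
  have e : paraTerm P u v (m + 2) = TemperedDistribution.smulLeftCLM ℂ
      (mollify P.kernel ((2 : ℝ) ^ m)⁻¹ H) (block P (m + 2) v) := by
    rw [paraTerm, ← hs, TemperedDistribution.smulLeftCLM_sum fun j _ => hg j, sum_apply]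
    rfl
  rw [e, TemperedDistribution.smulLeftCLM_apply_apply, (hv _).2.2]
  congr 1; ext y
  rw [SchwartzMap.smulLeftCLM_apply_apply (hasTemperateGrowth_mollify P.kernel hu.1.measurable hB
    (by positivity)), smul_eq_mul]
  ring

/-- The paraproduct of a bounded continuous function and an element of a Besov space of positive
regularity converges unconditionally, to the function `paraFun`. -/
theorem summable_and_represents_para {u v : 𝓢'(Sp d, ℂ)} {H : Sp d → ℂ} {B b N : ℝ} (hb : 0 < b)
    (hu : Represents u H) (hB : ∀ z, ‖H z‖ ≤ B)
    (hv : ∀ m, Represents (block P m v) (lpFun P v m)) (hV : LPBound b N (lpFun P v)) :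
    Summable (paraTerm P u v) ∧ Represents (para P u v) (paraFun P.kernel H (lpFun P v)) := by
  have hc := continuous_paraFun P.kernel hb hu.1.measurable hB hV
  obtain ⟨C, hC, h⟩ := exists_norm_paraFun_le P.kernel hb
  obtain ⟨T, hT⟩ := exists_represents hc (h H B N _ hu.1.measurable hB hV)
  obtain ⟨C', hC', h'⟩ := exists_norm_mollify_mul_le P.kernel
  have hsum : HasSum (paraTerm P u v) T := by
    refine PointwiseConvergenceCLM.tendsto_iff_forall_tendsto.2 fun φ => ?_
    have h1 : HasSum (fun m => paraTerm P u v m φ) (T φ) := by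
      rw [← hasSum_nat_add_iff' 2]
      have e0 : ∑ i ∈ Finset.range 2, paraTerm P u v i φ = 0 := by
        simp [Finset.sum_range_succ, paraTerm]
      rw [e0, sub_zero, hT.2.2]
      simp only [paraTerm_apply P hu hB hv]
      exact hasSum_integral_mul (fun m => (continuous_mollify _ hu.1.measurable hB
        (by positivity)).mul (hV.continuous _)) ((summable_two_pow_rpow_neg hb).mul_left _)
        (fun m y => h' H B b N _ hb hu.1.measurable hB hV m y) φ
    refine h1.congr fun s => ?_
    rw [sum_apply]
  refine ⟨hsum.summable, ?_⟩
  rw [para, hsum.tsum_eq]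
  exact hT

end Letters

/-! ### Characters on words -/

section Characters

variable {n : ℕ} {α : Fin n → Set.Ioo (0 : ℝ) 1}

theorem weight_append_singleton (l : List (Fin n)) (j : Fin n) :
    weight α (l ++ [j]) = weight α l + α j := by
  simp [weight]

theorem mul_word (g h : CharGroup α) {l : List (Fin n)} (hl : weight α l < 1) :
    (g * h) (word α l) = ∑ k ∈ Finset.range (l.length + 1),
      g (word α (l.drop k)) * h (word α (l.take k)) := by
  rw [AlgHom.convMul_apply]
  have e : CoalgebraStruct.comul (R := ℝ) (word α l) = coprod α (word α l) := rfl
  rw [e, coprod_word hl, map_sum]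
  simp

theorem one_word {l : List (Fin n)} (hl : l ≠ []) : (1 : CharGroup α) (word α l) = 0 := by
  rw [AlgHom.convOne_apply]
  exact coun_word hl

theorem apply_word_nil (g : CharGroup α) : g (word α []) = 1 := by simp

/-- Recursion for the inverse of a character, from `g * g⁻¹ = 1`. -/
theorem inv_word (g : CharGroup α) {l : List (Fin n)} (hl : l ≠ []) (hw : weight α l < 1) :
    g⁻¹ (word α l) = -∑ k ∈ Finset.range l.length,
      g (word α (l.drop k)) * g⁻¹ (word α (l.take k)) := by
  have h := mul_word g g⁻¹ hw
  rw [mul_inv_cancel, one_word hl, Finset.sum_range_succ, List.drop_length, List.take_length,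
    apply_word_nil, one_mul] at h
  linarith

theorem incr_self_word (g : Sp d → CharGroup α) (x : Sp d) {l : List (Fin n)} (hl : l ≠ []) :
    incr g x x (word α l) = 0 := by
  rw [incr, mul_inv_cancel, one_word hl]

/-- The term of the coproduct with the full word on the right is split off; in the other ones, the
last letter stays in the left factor. -/
theorem incr_append_singleton (g : Sp d → CharGroup α) (y x : Sp d) (l : List (Fin n)) (j : Fin n)
    (hw : weight α (l ++ [j]) < 1) :
    incr g y x (word α (l ++ [j])) = (∑ k ∈ Finset.range (l.length + 1),
      g y (word α (l.drop k ++ [j])) * (g x)⁻¹ (word α (l.take k))) +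
        (g x)⁻¹ (word α (l ++ [j])) := by
  rw [incr, mul_word _ _ hw, List.length_append, List.length_singleton, Finset.sum_range_succ]
  congr 1
  · refine Finset.sum_congr rfl fun k hk => ?_
    have hk' : k ≤ l.length := by simpa [Nat.lt_succ_iff] using hk
    rw [List.drop_append_of_le_length hk', List.take_append_of_le_length hk']
  · rw [List.drop_of_length_le (by simp), List.take_of_length_le (by simp), apply_word_nil, one_mul]

theorem apply_mono (g : CharGroup α) (m : LowWord α →₀ ℕ) :
    g (mono m) = m.prod fun w k => g (word α w.1) ^ k := by
  have h : mono m = m.prod fun w k => gen α w ^ k := by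
    have := MvPolynomial.monomial_eq (s := m) (a := (1 : ℝ))
    rw [MvPolynomial.C_1, one_mul] at this
    exact this
  rw [h]
  simp only [Finsupp.prod, gen_eq_word]
  rw [map_prod]
  simp only [map_pow]

end Characters

/-! ### Joint bounds for pairs -/

section PairBound

variable {R : Type*} [SeminormedRing R]

/-- The elements `a` and `a'` have size at most `A` and distance at most `A ε`. -/
def PairBound (A ε : ℝ) (a a' : R) : Prop := ‖a‖ ≤ A ∧ ‖a'‖ ≤ A ∧ ‖a - a'‖ ≤ A * ε

theorem PairBound.nonneg {A ε : ℝ} {a a' : R} (h : PairBound A ε a a') : 0 ≤ A :=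
  (norm_nonneg _).trans h.1

theorem PairBound.mono {A B ε : ℝ} {a a' : R} (h : PairBound A ε a a') (hε : 0 ≤ ε) (hAB : A ≤ B) :
    PairBound B ε a a' :=
  ⟨h.1.trans hAB, h.2.1.trans hAB, h.2.2.trans (mul_le_mul_of_nonneg_right hAB hε)⟩

theorem PairBound.add {A B ε : ℝ} {a a' b b' : R} (h : PairBound A ε a a')
    (h' : PairBound B ε b b') : PairBound (A + B) ε (a + b) (a' + b') := by
  refine ⟨(norm_add_le _ _).trans (add_le_add h.1 h'.1),
    (norm_add_le _ _).trans (add_le_add h.2.1 h'.2.1), ?_⟩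
  rw [add_sub_add_comm, add_mul]
  exact (norm_add_le _ _).trans (add_le_add h.2.2 h'.2.2)

theorem PairBound.neg {A ε : ℝ} {a a' : R} (h : PairBound A ε a a') :
    PairBound A ε (-a) (-a') := by
  refine ⟨by rw [norm_neg]; exact h.1, by rw [norm_neg]; exact h.2.1, ?_⟩
  rw [neg_sub_neg, norm_sub_rev]
  exact h.2.2

theorem PairBound.mul {A B ε : ℝ} {a a' b b' : R} (hε : 0 ≤ ε) (h : PairBound A ε a a')
    (h' : PairBound B ε b b') : PairBound (2 * (A * B)) ε (a * b) (a' * b') := by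
  have hA := h.nonneg
  have hB := h'.nonneg
  have hAB : A * B ≤ 2 * (A * B) := by nlinarith [mul_nonneg hA hB]
  refine ⟨((norm_mul_le _ _).trans (mul_le_mul h.1 h'.1 (norm_nonneg _) hA)).trans hAB,
    ((norm_mul_le _ _).trans (mul_le_mul h.2.1 h'.2.1 (norm_nonneg _) hA)).trans hAB, ?_⟩
  have e : a * b - a' * b' = (a - a') * b + a' * (b - b') := by noncomm_ring
  rw [e]
  calc _ ≤ (A * ε) * B + A * (B * ε) := (norm_add_le _ _).trans (add_le_add
        ((norm_mul_le _ _).trans (mul_le_mul h.2.2 h'.1 (norm_nonneg _) (by positivity)))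
        ((norm_mul_le _ _).trans (mul_le_mul h.2.1 h'.2.2 (norm_nonneg _) hA)))
    _ = _ := by ring

theorem pairBound_ofReal {A ε : ℝ} {a a' : ℝ} :
    PairBound A ε (a : ℂ) (a' : ℂ) ↔ PairBound A ε a a' := by
  simp only [PairBound, ← Complex.ofReal_sub, Complex.norm_real]

theorem pairBound_const (c : R) {ε : ℝ} (hε : 0 ≤ ε) : PairBound ‖c‖ ε c c :=
  ⟨le_rfl, le_rfl, by rw [sub_self, norm_zero]; positivity⟩

end PairBound

/-! ### Joint bounds for paraproducts -/

section PairPara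

variable {d : ℕ} (η : 𝓢(Sp d, ℂ))

/-- Increments of the sum of the two lowest blocks. It is Lipschitz and bounded, so its increments
are of any order between `0` and `1`. -/
theorem PairBound.lpFun_sub {b M ε t w : ℝ} {V V' : ℕ → Sp d → ℂ} (hε : 0 ≤ ε) (hM : 0 ≤ M)
    (hb : 0 < b) (hV : LPBound b M V) (hV' : LPBound b M V')
    (hVV : LPBound b ε fun m z => V m z - V' m z) (y x : Sp d) (hw0 : 0 ≤ w) (hw1 : w ≤ 1)
    (ht : t = ‖y - x‖) :
    PairBound (4 * (M + 1) * t ^ w) ε (V 0 y + V 1 y - (V 0 x + V 1 x))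
      (V' 0 y + V' 1 y - (V' 0 x + V' 1 x)) := by
  have key : ∀ (N : ℝ) (W : ℕ → Sp d → ℂ), 0 ≤ N → LPBound b N W →
      ‖W 0 y + W 1 y - (W 0 x + W 1 x)‖ ≤ 4 * N * t ^ w := by
    intro N W hN hW
    have ht0 : 0 ≤ t := ht ▸ norm_nonneg _
    have hone : ((2 : ℝ) ^ 1) ^ (-b) ≤ 1 :=
      Real.rpow_le_one_of_one_le_of_nonpos (by norm_num) (by linarith)
    have htwo : ((2 : ℝ) ^ 1) ^ (1 - b) ≤ 2 := by
      rw [pow_one]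
      simpa using Real.rpow_le_rpow_of_exponent_le one_le_two (show 1 - b ≤ 1 by linarith)
    have e : W 0 y + W 1 y - (W 0 x + W 1 x) = (W 0 y - W 0 x) + (W 1 y - W 1 x) := by ring
    rcases le_total t 1 with h1 | h1
    · have htw : t ≤ t ^ w := by
        rcases ht0.eq_or_lt with h0 | h0
        · rw [← h0]; positivity
        · simpa using Real.rpow_le_rpow_of_exponent_ge h0 h1 hw1
      have l0 := hW.lip 0 y x
      have l1 := hW.lip 1 y x
      rw [← ht] at l0 l1
      rw [pow_zero, Real.one_rpow, mul_one] at l0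
      have l1' : ‖W 1 y - W 1 x‖ ≤ N * 2 * t := l1.trans (by gcongr)
      rw [e]
      have hNt : N * t ≤ N * t ^ w := by gcongr
      have : 0 ≤ N * t := by positivity
      linarith [norm_add_le (W 0 y - W 0 x) (W 1 y - W 1 x)]
    · have htw : 1 ≤ t ^ w := Real.one_le_rpow h1 hw0
      have b0 : ∀ z, ‖W 0 z‖ ≤ N := fun z => by simpa using hW.norm_le 0 z
      have b1 : ∀ z, ‖W 1 z‖ ≤ N := fun z => (hW.norm_le 1 z).trans (by nlinarith)
      have hNt : N * 1 ≤ N * t ^ w := by gcongr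
      rw [e]
      linarith [norm_add_le (W 0 y - W 0 x) (W 1 y - W 1 x), norm_sub_le (W 0 y) (W 0 x),
        norm_sub_le (W 1 y) (W 1 x), b0 x, b0 y, b1 x, b1 y]
  have htw : 0 ≤ t ^ w := Real.rpow_nonneg (ht ▸ norm_nonneg _) _
  have h1 : 4 * M * t ^ w ≤ 4 * (M + 1) * t ^ w := by gcongr; linarith
  refine ⟨(key M V hM hV).trans h1, (key M V' hM hV').trans h1, ?_⟩
  have h2 := key ε _ hε hVV
  refine le_trans (le_of_eq ?_) (h2.trans ?_)
  · congr 1; ring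
  · have : 0 ≤ 4 * M * t ^ w * ε := by positivity
    nlinarith

theorem PairBound.exists_paraFun {b : ℝ} (hb : 0 < b) : ∃ C, 0 ≤ C ∧
    ∀ (A M ε : ℝ) (H H' : Sp d → ℂ) (V V' : ℕ → Sp d → ℂ), 0 ≤ ε → 0 ≤ M → Measurable H →
      Measurable H' → (∀ z, PairBound A ε (H z) (H' z)) → LPBound b M V → LPBound b M V' →
      LPBound b ε (fun m z => V m z - V' m z) → ∀ y,
        PairBound (C * A * (M + 1)) ε (paraFun η H V y) (paraFun η H' V' y) := by
  obtain ⟨C, hC, h⟩ := exists_norm_paraFun_le η hb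
  refine ⟨C, hC, fun A M ε H H' V V' hε hM hH hH' hHH hV hV' hVV y => ?_⟩
  have hA := (hHH 0).nonneg
  have h0 : C * A * M ≤ C * A * (M + 1) := by nlinarith [mul_nonneg hC hA]
  refine ⟨(h H A M V hH (fun z => (hHH z).1) hV y).trans h0,
    (h H' A M V' hH' (fun z => (hHH z).2.1) hV' y).trans h0, ?_⟩
  have h1 := h (fun z => H z - H' z) (A * ε) M V (hH.sub hH') (fun z => (hHH z).2.2) hV y
  have h2 := h H' A ε _ hH' (fun z => (hHH z).2.1) hVV y
  rw [paraFun_sub_left η hb hH (fun z => (hHH z).1) hH' (fun z => (hHH z).2.1) hV] at h1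
  rw [paraFun_sub_right η hb hH' (fun z => (hHH z).2.1) hV hV'] at h2
  calc _ = ‖(paraFun η H V y - paraFun η H' V y) + (paraFun η H' V y - paraFun η H' V' y)‖ := by
        congr 1; ring
    _ ≤ C * (A * ε) * M + C * A * ε := (norm_add_le _ _).trans (add_le_add h1 h2)
    _ = _ := by ring

theorem PairBound.exists_paraFun_sub {a b : ℝ} (ha : 0 ≤ a) (hb : 0 < b) (hab : a + b < 1) :
    ∃ C, 0 ≤ C ∧ ∀ (A B M ε : ℝ) (H H' : Sp d → ℂ) (V V' : ℕ → Sp d → ℂ) (x : Sp d), 0 ≤ ε →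
      0 ≤ A → 0 ≤ M → Measurable H → Measurable H' → (∀ z, ‖H z‖ ≤ B) → (∀ z, ‖H' z‖ ≤ B) →
      (∀ z, PairBound (A * ‖z - x‖ ^ a) ε (H z) (H' z)) → LPBound b M V → LPBound b M V' →
      LPBound b ε (fun m z => V m z - V' m z) → ∀ y,
        PairBound (C * A * (M + 1) * ‖y - x‖ ^ (a + b)) ε (paraFun η H V y - paraFun η H V x)
          (paraFun η H' V' y - paraFun η H' V' x) := by
  obtain ⟨C, hC, h⟩ := exists_norm_paraFun_sub_le η ha hb hab
  refine ⟨C, hC, fun A B M ε H H' V V' x hε hA hM hH hH' hB hB' hHH hV hV' hVV y => ?_⟩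
  have hX : 0 ≤ ‖y - x‖ ^ (a + b) := by positivity
  have h0 : C * A * M * ‖y - x‖ ^ (a + b) ≤ C * A * (M + 1) * ‖y - x‖ ^ (a + b) := by
    gcongr; linarith
  refine ⟨(h H A M x V hH ⟨B, hB⟩ hA (fun z => (hHH z).1) hV y).trans h0,
    (h H' A M x V' hH' ⟨B, hB'⟩ hA (fun z => (hHH z).2.1) hV' y).trans h0, ?_⟩
  have h1 := h (fun z => H z - H' z) (A * ε) M x V (hH.sub hH')
    ⟨B + B, fun z => (norm_sub_le _ _).trans (add_le_add (hB z) (hB' z))⟩ (by positivity)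
    (fun z => (hHH z).2.2.trans (le_of_eq (by ring))) hV y
  have h2 := h H' A ε x _ hH' ⟨B, hB'⟩ hA (fun z => (hHH z).2.1) hVV y
  simp only [paraFun_sub_left η hb hH hB hH' hB' hV] at h1
  simp only [paraFun_sub_right η hb hH' hB' hV hV'] at h2
  calc _ = ‖(paraFun η H V y - paraFun η H' V y - (paraFun η H V x - paraFun η H' V x)) +
          (paraFun η H' V y - paraFun η H' V' y - (paraFun η H' V x - paraFun η H' V' x))‖ := by
        congr 1; ring
    _ ≤ C * (A * ε) * M * ‖y - x‖ ^ (a + b) + C * A * ε * ‖y - x‖ ^ (a + b) :=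
      (norm_add_le _ _).trans (add_le_add h1 h2)
    _ = _ := by ring

end PairPara

/-! ### Estimates on iterated paraproducts -/

section Systems

variable {d n : ℕ}

/-- A function to the character group given on words by iterated paraproducts, together with the
Littlewood-Paley blocks `V j` of the letters; the blocks are bounded by `M`. For one-letter words,
the paraproduct with the constant `1` misses the two lowest blocks, which are added. -/
structure ParaSystem (η : 𝓢(Sp d, ℂ)) (α : Fin n → Set.Ioo (0 : ℝ) 1) (M : ℝ) where
  g : Sp d → CharGroup α
  V : Fin n → ℕ → Sp d → ℂ
  lp : ∀ j, LPBound (α j) M (V j)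
  cont : ∀ l, weight α l < 1 → Continuous fun x => g x (word α l)
  append_eq : ∀ l j, weight α (l ++ [j]) < 1 → ∀ y, ((g y (word α (l ++ [j])) : ℝ) : ℂ) =
    (if l = [] then V j 0 y + V j 1 y else 0) +
      paraFun η (fun z => ((g z (word α l) : ℝ) : ℂ)) (V j) y

variable {η : 𝓢(Sp d, ℂ)} {α : Fin n → Set.Ioo (0 : ℝ) 1} {M : ℝ}

/-- The letters of the two systems are at distance at most `ε`. -/
def ParaSystem.Close (ε : ℝ) (S S' : ParaSystem η α M) : Prop :=
  0 ≤ ε ∧ ∀ j, LPBound (α j) ε fun m z => S.V j m z - S'.V j m z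

theorem ParaSystem.close_self (S : ParaSystem η α M) : S.Close 0 S :=
  ⟨le_rfl, fun j => ⟨fun m y => by simp, fun m y x => by simp⟩⟩

/-- The family of numbers `F S i` is bounded by a multiple of `w i` and Lipschitz continuous in the
letters of the system `S`, with a Lipschitz constant of the same form. -/
def LipBound {ι : Type*} (w : ι → ℝ) (F : ParaSystem η α M → ι → ℝ) : Prop :=
  ∃ C, 0 ≤ C ∧ ∀ (ε : ℝ) (S S' : ParaSystem η α M), S.Close ε S' → ∀ i,
    PairBound (C * w i) ε (F S i) (F S' i)

theorem LipBound.add {ι : Type*} {w : ι → ℝ} {F F' : ParaSystem η α M → ι → ℝ}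
    (h : LipBound w F) (h' : LipBound w F') : LipBound w fun S i => F S i + F' S i := by
  obtain ⟨C, hC, h⟩ := h
  obtain ⟨C', hC', h'⟩ := h'
  refine ⟨C + C', by positivity, fun ε S S' hS i => ?_⟩
  rw [add_mul]
  exact (h ε S S' hS i).add (h' ε S S' hS i)

theorem LipBound.neg {ι : Type*} {w : ι → ℝ} {F : ParaSystem η α M → ι → ℝ}
    (h : LipBound w F) : LipBound w fun S i => -F S i := by
  obtain ⟨C, hC, h⟩ := h
  exact ⟨C, hC, fun ε S S' hS i => (h ε S S' hS i).neg⟩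

theorem LipBound.mul {ι : Type*} {w w' : ι → ℝ} {F F' : ParaSystem η α M → ι → ℝ}
    (h : LipBound w F) (h' : LipBound w' F') :
    LipBound (fun i => w i * w' i) fun S i => F S i * F' S i := by
  obtain ⟨C, hC, h⟩ := h
  obtain ⟨C', hC', h'⟩ := h'
  refine ⟨2 * (C * C'), by positivity, fun ε S S' hS i => ?_⟩
  have := (h ε S S' hS i).mul hS.1 (h' ε S S' hS i)
  rwa [show 2 * (C * w i * (C' * w' i)) = 2 * (C * C') * (w i * w' i) by ring] at this

theorem lipBound_const {ι : Type*} {w : ι → ℝ} (hw : ∀ i, 1 ≤ w i) (c : ℝ) :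
    LipBound w fun (_ : ParaSystem η α M) _ => c :=
  ⟨‖c‖, norm_nonneg _, fun _ _ _ hS i => (pairBound_const c hS.1).mono hS.1 (by
    nlinarith [norm_nonneg c, hw i])⟩

theorem lipBound_zero {ι : Type*} {w : ι → ℝ} :
    LipBound w fun (_ : ParaSystem η α M) _ => (0 : ℝ) :=
  ⟨0, le_rfl, fun ε _ _ hS i => by simp [PairBound]⟩

theorem LipBound.sum {ι κ : Type*} {w : ι → ℝ} {F : κ → ParaSystem η α M → ι → ℝ} (s : Finset κ)
    (h : ∀ k ∈ s, LipBound w (F k)) : LipBound w fun S i => ∑ k ∈ s, F k S i := by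
  classical
  induction s using Finset.induction_on with
  | empty => simpa using lipBound_zero
  | insert a s ha ih =>
    simp only [Finset.sum_insert ha]
    exact (h a (Finset.mem_insert_self a s)).add
      (ih fun k hk => h k (Finset.mem_insert_of_mem hk))

theorem LipBound.pow {ι : Type*} {w : ι → ℝ} {F : ParaSystem η α M → ι → ℝ}
    (h : LipBound w F) (k : ℕ) : LipBound (fun i => w i ^ k) fun S i => F S i ^ k := by
  induction k with
  | zero => simpa using lipBound_const (fun _ => le_rfl) 1
  | succ k ih => simpa only [pow_succ] using ih.mul h

theorem LipBound.prod {ι κ : Type*} {w : κ → ι → ℝ} {F : κ → ParaSystem η α M → ι → ℝ}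
    (s : Finset κ) (h : ∀ k ∈ s, LipBound (w k) (F k)) :
    LipBound (fun i => ∏ k ∈ s, w k i) fun S i => ∏ k ∈ s, F k S i := by
  classical
  induction s using Finset.induction_on with
  | empty => simpa using lipBound_const (fun _ => le_rfl) 1
  | insert a s ha ih =>
    simp only [Finset.prod_insert ha]
    exact (h a (Finset.mem_insert_self a s)).mul
      (ih fun k hk => h k (Finset.mem_insert_of_mem hk))

theorem LipBound.comp {ι κ : Type*} {w : ι → ℝ} {F : ParaSystem η α M → ι → ℝ}
    (h : LipBound w F) (e : κ → ι) : LipBound (fun k => w (e k)) fun S k => F S (e k) := by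
  obtain ⟨C, hC, h⟩ := h
  exact ⟨C, hC, fun ε S S' hS i => h ε S S' hS (e i)⟩

/-- The iterated paraproducts are bounded functions. -/
theorem lipBound_word (hM : 0 ≤ M) (l : List (Fin n)) (hl : weight α l < 1) :
    LipBound (fun _ : Sp d => 1) fun (S : ParaSystem η α M) x => S.g x (word α l) := by
  induction l using List.reverseRecOn with
  | nil => simpa only [apply_word_nil] using lipBound_const (fun _ => le_rfl) 1
  | append_singleton l j ih =>
    have hj := (α j).2
    have hl' : weight α l < 1 := by
      rw [weight_append_singleton] at hl; linarith [hj.1]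
    obtain ⟨C, hC, h⟩ := ih hl'
    obtain ⟨D, hD, hp⟩ := PairBound.exists_paraFun η hj.1
    refine ⟨2 * (M + 1) + D * C * (M + 1), by positivity, fun ε S S' hS x => ?_⟩
    rw [← pairBound_ofReal, S.append_eq l j hl, S'.append_eq l j hl, mul_one]
    refine PairBound.add ?_ ?_
    · split_ifs
      · have key : ∀ N W, 0 ≤ N → LPBound (α j) N W → ‖W 0 x + W 1 x‖ ≤ 2 * N := by
          intro N W hN hW
          have h0 := hW.norm_le 0 x
          have h1 := hW.norm_le 1 x
          have hone : ((2 : ℝ) ^ 1) ^ (-(α j : ℝ)) ≤ 1 :=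
            Real.rpow_le_one_of_one_le_of_nonpos (by norm_num) (by linarith [hj.1])
          rw [pow_zero, Real.one_rpow, mul_one] at h0
          have h1' : ‖W 1 x‖ ≤ N := h1.trans (by nlinarith)
          linarith [norm_add_le (W 0 x) (W 1 x)]
        refine ⟨(key M _ hM (S.lp j)).trans (by linarith),
          (key M _ hM (S'.lp j)).trans (by linarith), ?_⟩
        refine le_trans (le_of_eq ?_) ((key ε _ hS.1 (hS.2 j)).trans ?_)
        · congr 1; ring
        · nlinarith [hS.1, mul_nonneg hM hS.1]
      · exact ⟨by simp; positivity, by simp; positivity, by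
          have := hS.1
          simp; positivity⟩
    · refine hp C M ε _ _ _ _ hS.1 hM (Complex.measurable_ofReal.comp (S.cont l hl').measurable)
        (Complex.measurable_ofReal.comp (S'.cont l hl').measurable) (fun z => ?_) (S.lp j) (S'.lp j)
        (hS.2 j) x
      refine pairBound_ofReal.2 ?_
      simpa using h ε S S' hS z

theorem lipBound_inv_word (hM : 0 ≤ M) (N : ℕ) : ∀ l : List (Fin n), l.length ≤ N →
    weight α l < 1 →
      LipBound (fun _ : Sp d => 1) fun (S : ParaSystem η α M) x => (S.g x)⁻¹ (word α l) := by
  induction N with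
  | zero =>
    intro l hl _
    obtain rfl : l = [] := by simpa using hl
    simpa only [apply_word_nil] using lipBound_const (fun _ => le_rfl) 1
  | succ N ih =>
    intro l hl hw
    rcases eq_or_ne l [] with rfl | hne
    · simpa only [apply_word_nil] using lipBound_const (fun _ => le_rfl) 1
    · simp only [inv_word _ hne hw]
      refine LipBound.neg (LipBound.sum _ fun k hk => ?_)
      have hk' := Finset.mem_range.1 hk
      have h1 := lipBound_word (η := η) hM (l.drop k) ((weight_drop_le l k).trans_lt hw)
      have h2 := ih (l.take k) (by simp only [List.length_take]; omega)
        ((weight_take_le l k).trans_lt hw)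
      simpa using h1.mul h2

theorem incr_word_eq (g : Sp d → CharGroup α) (y x : Sp d) {l : List (Fin n)}
    (hw : weight α l < 1) : incr g y x (word α l) = ∑ k ∈ Finset.range (l.length + 1),
      g y (word α (l.drop k)) * (g x)⁻¹ (word α (l.take k)) := mul_word _ _ hw

theorem continuous_incr_word (S : ParaSystem η α M) (x : Sp d) {l : List (Fin n)}
    (hw : weight α l < 1) : Continuous fun z => incr S.g z x (word α l) := by
  simp only [incr_word_eq _ _ _ hw]
  exact continuous_finsetSum _ fun k _ =>
    (S.cont _ ((weight_drop_le l k).trans_lt hw)).mul continuous_const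

/-- The increments on a word are bounded. -/
theorem lipBound_incr_word_one (hM : 0 ≤ M) {l : List (Fin n)} (hw : weight α l < 1) :
    LipBound (fun _ : Sp d × Sp d => 1)
      fun (S : ParaSystem η α M) p => incr S.g p.1 p.2 (word α l) := by
  simp only [incr_word_eq _ _ _ hw]
  refine LipBound.sum _ fun k _ => ?_
  have h1 := (lipBound_word (η := η) hM (l.drop k) ((weight_drop_le l k).trans_lt hw)).comp
    (Prod.fst : Sp d × Sp d → Sp d)
  have h2 := (lipBound_inv_word (η := η) hM _ (l.take k) le_rfl
    ((weight_take_le l k).trans_lt hw)).comp (Prod.snd : Sp d × Sp d → Sp d)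
  simpa using h1.mul h2

/-- The algebraic identity that reduces the increments on a word to a paraproduct with the
increments on the shortened word. -/
theorem ParaSystem.incr_append_singleton_eq (hM : 0 ≤ M) (S : ParaSystem η α M) (y x : Sp d)
    (l : List (Fin n)) (j : Fin n) (hw : weight α (l ++ [j]) < 1) :
    ((incr S.g y x (word α (l ++ [j])) : ℝ) : ℂ) =
      paraFun η (fun z => ((incr S.g z x (word α l) : ℝ) : ℂ)) (S.V j) y +
        (S.V j 0 y + S.V j 1 y) * (((S.g x)⁻¹ (word α l) : ℝ) : ℂ) +
          (((S.g x)⁻¹ (word α (l ++ [j])) : ℝ) : ℂ) := by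
  have hj := (α j).2
  have hl' : weight α l < 1 := by
    rw [weight_append_singleton] at hw; linarith [hj.1]
  have hwk : ∀ k, weight α (l.drop k ++ [j]) < 1 := fun k => by
    rw [weight_append_singleton] at hw ⊢
    linarith [weight_drop_le (α := α) l k]
  have hdk := fun k => (weight_drop_le (α := α) l k).trans_lt hl'
  have hB : ∀ k, ∃ B : ℝ, ∀ z, ‖((S.g z (word α (l.drop k)) : ℝ) : ℂ)‖ ≤ B := by
    intro k
    obtain ⟨C, hC, h⟩ := lipBound_word (η := η) hM _ (hdk k)
    refine ⟨C, fun z => ?_⟩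
    rw [Complex.norm_real]
    simpa using (h 0 S S S.close_self z).1
  choose B hB using hB
  have hp := paraFun_finset_sum (Finset.range (l.length + 1)) η
    (H := fun k z => ((S.g z (word α (l.drop k)) : ℝ) : ℂ))
    (fun k => Complex.measurable_ofReal.comp (S.cont _ (hdk k)).measurable) hB
    (fun k => (((S.g x)⁻¹ (word α (l.take k)) : ℝ) : ℂ)) hj.1 (S.lp j) y
  rw [incr_append_singleton _ _ _ _ _ hw, Complex.ofReal_add]
  congr 1
  simp only [incr_word_eq _ _ _ hl', Complex.ofReal_sum, Complex.ofReal_mul,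
    S.append_eq _ _ (hwk _), add_mul]
  rw [hp, Finset.sum_add_distrib, add_comm]
  congr 1
  -- Only the full prefix leaves the empty word, whose paraproduct misses the two lowest blocks.
  rw [Finset.sum_eq_single l.length]
  · simp [add_mul]
  · intro k hk hne
    have : l.drop k ≠ [] := by
      simp only [Finset.mem_range] at hk
      simp; omega
    rw [if_neg this, zero_mul]
  · simp

/-- The increments on a word are of the order of its homogeneity. -/
theorem lipBound_incr_word (hM : 0 ≤ M) (l : List (Fin n)) (hl : weight α l < 1) :
    LipBound (fun p : Sp d × Sp d => dist p.1 p.2 ^ weight α l)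
      fun (S : ParaSystem η α M) p => incr S.g p.1 p.2 (word α l) := by
  induction l using List.reverseRecOn with
  | nil =>
    have : weight α ([] : List (Fin n)) = 0 := by simp [weight]
    simpa only [apply_word_nil, this, Real.rpow_zero] using lipBound_const (fun _ => le_rfl) 1
  | append_singleton l j ih =>
    have hj := (α j).2
    have hlj := hl
    rw [weight_append_singleton] at hlj
    have hl' : weight α l < 1 := by linarith [hj.1]
    have hw0 := weight_nonneg (α := α) l
    obtain ⟨C, hC, h⟩ := ih hl'
    obtain ⟨B, hB, hb⟩ := lipBound_incr_word_one (d := d) (η := η) hM hl'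
    obtain ⟨E, hE, he⟩ := lipBound_inv_word (d := d) (η := η) hM _ l le_rfl hl'
    obtain ⟨D, hD, hp⟩ := PairBound.exists_paraFun_sub η hw0 hj.1 hlj
    refine ⟨D * C * (M + 1) + 2 * (4 * (M + 1) * E), by positivity, fun ε S S' hS p => ?_⟩
    obtain ⟨y, x⟩ := p
    have e : ∀ S : ParaSystem η α M, ((incr S.g y x (word α (l ++ [j])) : ℝ) : ℂ) =
        (paraFun η (fun z => ((incr S.g z x (word α l) : ℝ) : ℂ)) (S.V j) y -
          paraFun η (fun z => ((incr S.g z x (word α l) : ℝ) : ℂ)) (S.V j) x) +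
        (S.V j 0 y + S.V j 1 y - (S.V j 0 x + S.V j 1 x)) *
          (((S.g x)⁻¹ (word α l) : ℝ) : ℂ) := by
      intro S
      have h1 := S.incr_append_singleton_eq hM y x l j hl
      have h2 := S.incr_append_singleton_eq hM x x l j hl
      rw [incr_self_word _ _ (by simp), Complex.ofReal_zero] at h2
      linear_combination h1 - h2
    -- The increments vanish on the diagonal, so the value at `y = x` may be subtracted.
    rw [← pairBound_ofReal, e S, e S', weight_append_singleton, add_mul]
    simp only [dist_eq_norm] at h ⊢
    refine PairBound.add ?_ ?_
    · refine hp C B M ε _ _ _ _ x hS.1 hC hM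
        (Complex.measurable_ofReal.comp (continuous_incr_word S x hl').measurable)
        (Complex.measurable_ofReal.comp (continuous_incr_word S' x hl').measurable)
        (fun z => ?_) (fun z => ?_) (fun z => ?_) (S.lp j) (S'.lp j) (hS.2 j) y
      · refine (Complex.norm_real _).trans_le ?_
        simpa using (hb ε S S' hS (z, x)).1
      · refine (Complex.norm_real _).trans_le ?_
        simpa using (hb ε S S' hS (z, x)).2.1
      · exact pairBound_ofReal.2 (h ε S S' hS (z, x))
    · have h1 := PairBound.lpFun_sub (w := weight α l + α j) hS.1 hM hj.1 (S.lp j) (S'.lp j)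
        (hS.2 j) y x (by linarith [hj.1]) hlj.le rfl
      have h2 := pairBound_ofReal.2 (he ε S S' hS x)
      have h3 := h1.mul hS.1 h2
      rwa [show 2 * (4 * (M + 1) * ‖y - x‖ ^ (weight α l + (α j : ℝ)) * (E * 1)) =
        2 * (4 * (M + 1) * E) * ‖y - x‖ ^ (weight α l + (α j : ℝ)) by ring] at h3

/-- The values on monomials are bounded. -/
theorem lipBound_mono (hM : 0 ≤ M) (m : LowWord α →₀ ℕ) :
    LipBound (fun _ : Sp d => 1) fun (S : ParaSystem η α M) x => S.g x (mono m) := by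
  simp only [apply_mono, Finsupp.prod]
  simpa using LipBound.prod m.support fun w _ => (lipBound_word (η := η) hM w.1 w.2.2).pow (m w)

theorem prod_rpow_weight (m : LowWord α →₀ ℕ) {t : ℝ} (ht : 0 ≤ t) :
    ∏ w ∈ m.support, (t ^ weight α w.1) ^ m w = t ^ hom m := by
  rw [hom, Finsupp.sum, Real.rpow_sum_of_nonneg ht fun w _ =>
    mul_nonneg (Nat.cast_nonneg _) (weight_nonneg _)]
  refine Finset.prod_congr rfl fun w _ => ?_
  rw [← Real.rpow_natCast, ← Real.rpow_mul ht, mul_comm]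

/-- The increments on a monomial are of the order of its homogeneity. -/
theorem lipBound_incr_mono (hM : 0 ≤ M) (m : LowWord α →₀ ℕ) :
    LipBound (fun p : Sp d × Sp d => dist p.1 p.2 ^ hom m)
      fun (S : ParaSystem η α M) p => incr S.g p.1 p.2 (mono m) := by
  simp only [apply_mono, Finsupp.prod]
  simp only [← prod_rpow_weight m dist_nonneg]
  exact LipBound.prod m.support fun w _ => (lipBound_incr_word (η := η) hM w.1 w.2.2).pow (m w)

end Systems

/-! ### Iterated paraproducts of elements of Besov spaces -/

section Canonical

variable {d n : ℕ} (P : DyadicPartition d) {α : Fin n → Set.Ioo (0 : ℝ) 1}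

theorem mollify_im {η : 𝓢(Sp d, ℂ)} (hη : ∀ w, (η w).im = 0) {H : Sp d → ℂ}
    (hH : ∀ z, (H z).im = 0) (ε : ℝ) (y : Sp d) : (mollify η ε H y).im = 0 := by
  have e : ∀ w, η w * H (y - ε • w) = (((η w * H (y - ε • w)).re : ℝ) : ℂ) := fun w =>
    Complex.ext (by simp) (by simp [hη, hH])
  rw [mollify, integral_congr_ae (.of_forall e), integral_complex_ofReal, Complex.ofReal_im]

theorem paraFun_im {η : 𝓢(Sp d, ℂ)} (hη : ∀ w, (η w).im = 0) {H : Sp d → ℂ}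
    (hH : ∀ z, (H z).im = 0) {V : ℕ → Sp d → ℂ} (hV : ∀ m z, (V m z).im = 0) (y : Sp d) :
    (paraFun η H V y).im = 0 := by
  have e : ∀ m : ℕ, mollify η ((2 : ℝ) ^ m)⁻¹ H y * V (m + 2) y =
      (((mollify η ((2 : ℝ) ^ m)⁻¹ H y * V (m + 2) y).re : ℝ) : ℂ) := fun m =>
    Complex.ext (by simp) (by simp [mollify_im hη hH, hV])
  rw [paraFun, tsum_congr e, ← Complex.ofReal_tsum, Complex.ofReal_im]

theorem exists_lpBound_of_mem {b : ℝ} {u : 𝓢'(Sp d, ℂ)} (hu : u ∈ besovSpace P b) :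
    (∀ m, Represents (block P m u) (lpFun P u m)) ∧ ∃ N, LPBound b N (lpFun P u) := by
  obtain ⟨C, hC, h⟩ := exists_lpBound P b
  obtain ⟨h1, h2⟩ := h u (besovNorm P b u).toReal ENNReal.toReal_nonneg
    (ENNReal.ofReal_toReal hu.2.ne).ge
  exact ⟨h1, _, h2⟩

theorem lpFun_im {b : ℝ} {u : 𝓢'(Sp d, ℂ)} (hu : u ∈ besovSpace P b) (m : ℕ) (z : Sp d) :
    (lpFun P u m z).im = 0 := by
  obtain ⟨h1, N, h2⟩ := exists_lpBound_of_mem P hu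
  exact (h1 m).im_eq_zero (h2.norm_le m) (P.isReal_block m hu.1) z

theorem iterPara_append_singleton (f : Fin n → 𝓢'(Sp d, ℂ)) {l : List (Fin n)} (hl : l ≠ [])
    (j : Fin n) : iterPara P f (l ++ [j]) = para P (iterPara P f l) (f j) := by
  cases l with
  | nil => exact absurd rfl hl
  | cons i l => simp [iterPara]

theorem Represents.canonicalModel_word {f : Fin n → 𝓢'(Sp d, ℂ)} {l : List (Fin n)} (hl : l ≠ [])
    (hw : weight α l < 1) {H : Sp d → ℂ} (h : Represents (iterPara P f l) H)
    (him : ∀ x, (H x).im = 0) (x : Sp d) :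
    ((canonicalModel α P f x (word α l) : ℝ) : ℂ) = H x := by
  have e : canonicalModel α P f x (word α l) = (H x).re := by
    rw [word_of ⟨hl, hw⟩]
    refine (evalHom_gen _ _).trans ?_
    rw [h.toFun_eq]
  rw [e]
  exact Complex.ext (by simp) (by simp [him])

/-- The iterated paraproducts are real, bounded and continuous functions, and the canonical model
satisfies the recursion of `ParaSystem`. The three facts are proved by one induction, since the
recursion step needs the shorter word to be given by a bounded function. -/
theorem represents_iterPara {f : Fin n → 𝓢'(Sp d, ℂ)} (hf : ∀ i, f i ∈ besovSpace P (α i))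
    (l : List (Fin n)) (hw : weight α l < 1) :
    (Represents (iterPara P f l) fun x => ((canonicalModel α P f x (word α l) : ℝ) : ℂ)) ∧
      (∃ B, ∀ x, ‖((canonicalModel α P f x (word α l) : ℝ) : ℂ)‖ ≤ B) ∧
      ∀ l' j, l = l' ++ [j] → (l' ≠ [] → Summable (paraTerm P (iterPara P f l') (f j))) ∧
        ∀ y, ((canonicalModel α P f y (word α l) : ℝ) : ℂ) =
          (if l' = [] then lpFun P (f j) 0 y + lpFun P (f j) 1 y else 0) +
            paraFun P.kernel (fun z => ((canonicalModel α P f z (word α l') : ℝ) : ℂ))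
              (lpFun P (f j)) y := by
  induction l using List.reverseRecOn with
  | nil =>
    simp only [apply_word_nil, Complex.ofReal_one]
    exact ⟨represents_one, ⟨1, by simp⟩, fun l' j h => by simp at h⟩
  | append_singleton l j ih =>
    have hj := (α j).2
    have hl' : weight α l < 1 := by
      rw [weight_append_singleton] at hw; linarith [hj.1]
    obtain ⟨h1, ⟨B, hB⟩, -⟩ := ih hl'
    obtain ⟨hu, N, hV⟩ := exists_lpBound_of_mem P (hf j)
    obtain ⟨C, hC, hp⟩ := exists_norm_paraFun_le P.kernel hj.1
    have hpb := hp _ B N _ h1.1.measurable hB hV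
    obtain ⟨hs, hr⟩ := summable_and_represents_para P hj.1 h1 hB hu hV
    have hpim := paraFun_im P.kernel_im (fun z => Complex.ofReal_im _) (lpFun_im P (hf j))
      (H := fun z => ((canonicalModel α P f z (word α l) : ℝ) : ℂ))
    have key : ∃ H : Sp d → ℂ, Represents (iterPara P f (l ++ [j])) H ∧ (∃ B, ∀ x, ‖H x‖ ≤ B) ∧
        (∀ x, (H x).im = 0) ∧ ∀ y, H y =
          (if l = [] then lpFun P (f j) 0 y + lpFun P (f j) 1 y else 0) +
            paraFun P.kernel (fun z => ((canonicalModel α P f z (word α l) : ℝ) : ℂ))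
              (lpFun P (f j)) y := by
      rcases eq_or_ne l [] with rfl | hl
      · simp only [apply_word_nil, Complex.ofReal_one] at hpb hpim ⊢
        refine ⟨fun y => lpFun P (f j) 0 y + lpFun P (f j) 1 y +
            paraFun P.kernel (fun _ => 1) (lpFun P (f j)) y, represents_of_lpBound P hj.1 hu hV,
          ⟨_, fun x => (norm_add_le _ _).trans (add_le_add ((norm_add_le _ _).trans
            (add_le_add (hV.norm_le 0 x) (hV.norm_le 1 x))) (hpb x))⟩, fun x => ?_, fun y => ?_⟩
        · simp [hpim, lpFun_im P (hf j)]
        · simp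
      · refine ⟨_, ?_, ⟨_, hpb⟩, hpim, fun y => ?_⟩
        · rw [iterPara_append_singleton P f hl]; exact hr
        · simp [hl]
    obtain ⟨H, hH, ⟨B', hB'⟩, him, hHe⟩ := key
    have e := hH.canonicalModel_word P (by simp) hw him
    refine ⟨by rwa [funext e], ⟨B', fun x => by rw [e]; exact hB' x⟩, fun l' j' h => ?_⟩
    obtain ⟨rfl, h⟩ := List.append_inj' h rfl
    obtain rfl : j = j' := by simpa using h
    exact ⟨fun _ => hs, fun y => (e y).trans (hHe y)⟩

/-- The iterated paraproducts of `f`, as a system of functions. -/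
def canonicalSystem {f : Fin n → 𝓢'(Sp d, ℂ)} (hf : ∀ i, f i ∈ besovSpace P (α i)) {M : ℝ}
    (hM : ∀ i, LPBound (α i) M (lpFun P (f i))) : ParaSystem P.kernel α M where
  g := canonicalModel α P f
  V i := lpFun P (f i)
  lp := hM
  cont l hl := by
    have := Complex.continuous_re.comp (represents_iterPara P hf l hl).1.1
    simpa only [Function.comp_def, Complex.ofReal_re] using this
  append_eq l j hl := ((represents_iterPara P hf _ hl).2.2 l j rfl).2

theorem LPBound.mono {b N N' : ℝ} {V : ℕ → Sp d → ℂ} (h : LPBound b N V) (hN : N ≤ N') :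
    LPBound b N' V :=
  ⟨fun m y => (h.norm_le m y).trans (by gcongr), fun m y x => (h.lip m y x).trans (by gcongr)⟩

theorem LPBound.sub {b N N' : ℝ} {V V' : ℕ → Sp d → ℂ} (h : LPBound b N V)
    (h' : LPBound b N' V') : LPBound b (N + N') fun m z => V m z - V' m z := by
  refine ⟨fun m y => ?_, fun m y x => ?_⟩
  · refine ((norm_sub_le _ _).trans (add_le_add (h.norm_le m y) (h'.norm_le m y))).trans_eq ?_
    ring
  · rw [sub_sub_sub_comm]
    refine ((norm_sub_le _ _).trans (add_le_add (h.lip m y x) (h'.lip m y x))).trans_eq ?_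
    ring

end Canonical

/-! ### The second component of the model -/

section Realization

variable {d n : ℕ} {α : Fin n → Set.Ioo (0 : ℝ) 1} {η : 𝓢(Sp d, ℂ)} {M : ℝ}

theorem Represents.ext {u v : 𝓢'(Sp d, ℂ)} {H : Sp d → ℂ} (h : Represents u H)
    (h' : Represents v H) : u = v := by
  ext φ
  rw [h.2.2, h'.2.2]

theorem Represents.real_smul {u : 𝓢'(Sp d, ℂ)} {H : Sp d → ℂ} {B : ℝ} (c : ℝ)
    (h : Represents u H) (hB : ∀ z, ‖H z‖ ≤ B) : Represents (c • u) fun x => (c : ℂ) * H x := by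
  refine .of_bounded (continuous_const.mul h.1) (B := |c| * B) (fun z => ?_) fun φ => ?_
  · rw [norm_mul, Complex.norm_real]
    exact mul_le_mul_of_nonneg_left (hB z) (norm_nonneg _)
  · have : (c • u) φ = c • u φ := rfl
    rw [this, h.2.2, Complex.real_smul, ← integral_const_mul]
    congr 1; ext x; ring

theorem wordAlg_induction {p : WordAlg α → Prop} (hmono : ∀ m, p (mono m))
    (hadd : ∀ a b, p a → p b → p (a + b)) (hsmul : ∀ (c : ℝ) a, p a → p (c • a)) (τ : WordAlg α) :
    p τ := by
  refine MvPolynomial.induction_on' (P := p) τ (fun m c => ?_) hadd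
  have e : c • mono m = MvPolynomial.monomial m c := by
    refine (MvPolynomial.smul_monomial (S₁ := ℝ) c).trans ?_
    rw [smul_eq_mul, mul_one]
  rw [← e]
  exact hsmul c _ (hmono m)

theorem ParaSystem.exists_bound_and_continuous (hM : 0 ≤ M) (S : ParaSystem η α M)
    (τ : WordAlg α) : (∃ B, ∀ x, ‖((S.g x τ : ℝ) : ℂ)‖ ≤ B) ∧
      Continuous fun x => ((S.g x τ : ℝ) : ℂ) := by
  simp only [Complex.norm_real]
  refine wordAlg_induction (p := fun τ => (∃ B, ∀ x, ‖S.g x τ‖ ≤ B) ∧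
    Continuous fun x => ((S.g x τ : ℝ) : ℂ)) ?_ ?_ ?_ τ
  · intro m
    obtain ⟨C, hC, h⟩ := lipBound_mono (d := d) (η := η) hM m
    refine ⟨⟨C, fun x => by simpa using (h 0 S S S.close_self x).1⟩, ?_⟩
    simp only [apply_mono, Finsupp.prod]
    exact Complex.continuous_ofReal.comp
      (continuous_finsetProd _ fun w _ => (S.cont w.1 w.2.2).pow _)
  · rintro a b ⟨⟨B, hB⟩, ha⟩ ⟨⟨B', hB'⟩, hb⟩
    simp only [map_add, Complex.ofReal_add]
    exact ⟨⟨B + B', fun x => (norm_add_le _ _).trans (add_le_add (hB x) (hB' x))⟩, ha.add hb⟩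
  · rintro c a ⟨⟨B, hB⟩, ha⟩
    simp only [map_smul, smul_eq_mul, Complex.ofReal_mul, norm_mul]
    exact ⟨⟨‖c‖ * B, fun x => mul_le_mul_of_nonneg_left (hB x) (norm_nonneg _)⟩,
      continuous_const.mul ha⟩

theorem ParaSystem.exists_realizes (hM : 0 ≤ M) (S : ParaSystem η α M) :
    ∃ Q, Realizes S.g Q := by
  have h := S.exists_bound_and_continuous hM
  choose B hB using fun τ => (h τ).1
  have hex : ∀ τ, ∃ u, Represents u fun x => ((S.g x τ : ℝ) : ℂ) :=
    fun τ => exists_represents (h τ).2 (hB τ)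
  choose Q hQ using hex
  refine ⟨⟨⟨Q, fun a b => ?_⟩, fun c a => ?_⟩, hQ⟩
  · refine (hQ (a + b)).ext ?_
    have := (hQ a).add (hB a) (hQ b) (hB b)
    simpa using this
  · refine (hQ (c • a)).ext ?_
    have := (hQ a).real_smul c (hB a)
    simpa using this

theorem ParaSystem.represents_Pi (hM : 0 ≤ M) (S : ParaSystem η α M) (τ : WordAlg α) :
    Represents ((selfPair S.g).Pi τ) fun x => ((S.g x τ : ℝ) : ℂ) := by
  have h := S.exists_realizes hM
  simp only [selfPair, dif_pos h]
  exact h.choose_spec τ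

/-- The distribution `Π_x τ` is given by the increments of `g` based at `x`. -/
theorem ParaSystem.represents_PiAt (hM : 0 ≤ M) (S : ParaSystem η α M) (x : Sp d)
    (τ : WordAlg α) :
    (Represents ((selfPair S.g).PiAt x τ) fun y => ((incr S.g y x τ : ℝ) : ℂ)) ∧
      ∃ B, ∀ y, ‖((incr S.g y x τ : ℝ) : ℂ)‖ ≤ B := by
  have key : ∀ t : WordAlg α ⊗[ℝ] WordAlg α,
      (Represents ((TensorProduct.rid ℝ 𝓢'(Sp d, ℂ)) (TensorProduct.map (selfPair S.g).Pi
        ((S.g x)⁻¹).ofConv.toLinearMap t)) fun y => ((Algebra.TensorProduct.lift (S.g y).ofConv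
          ((S.g x)⁻¹).ofConv (fun _ _ => Commute.all _ _) t : ℝ) : ℂ)) ∧
        ∃ B, ∀ y, ‖((Algebra.TensorProduct.lift (S.g y).ofConv
          ((S.g x)⁻¹).ofConv (fun _ _ => Commute.all _ _) t : ℝ) : ℂ)‖ ≤ B := by
    intro t
    induction t using TensorProduct.induction_on with
    | zero =>
      simp only [map_zero, Complex.ofReal_zero]
      exact ⟨.of_bounded continuous_const (B := 0) (by simp) fun φ => by
        have : (0 : 𝓢'(Sp d, ℂ)) φ = 0 := rfl
        simp [this], 0, by simp⟩
    | tmul a b =>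
      obtain ⟨⟨B, hB⟩, -⟩ := S.exists_bound_and_continuous hM a
      have h := (S.represents_Pi hM a).real_smul (((S.g x)⁻¹).ofConv b) hB
      simp only [TensorProduct.map_tmul, TensorProduct.rid_tmul, Algebra.TensorProduct.lift_tmul,
        Complex.ofReal_mul, AlgHom.toLinearMap_apply]
      refine ⟨by simpa only [mul_comm] using h, B * ‖((S.g x)⁻¹).ofConv b‖, fun y => ?_⟩
      rw [norm_mul, Complex.norm_real (((S.g x)⁻¹).ofConv b)]
      exact mul_le_mul_of_nonneg_right (hB y) (norm_nonneg _)
    | add s t hs ht =>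
      obtain ⟨h1, B, hB⟩ := hs
      obtain ⟨h2, B', hB'⟩ := ht
      simp only [map_add, Complex.ofReal_add]
      exact ⟨h1.add hB h2 hB', B + B', fun y =>
        (norm_add_le _ _).trans (add_le_add (hB y) (hB' y))⟩
  have e : ∀ y, incr S.g y x τ = Algebra.TensorProduct.lift (S.g y).ofConv ((S.g x)⁻¹).ofConv
      (fun _ _ => Commute.all _ _) (CoalgebraStruct.comul (R := ℝ) τ) :=
    fun y => AlgHom.convMul_apply _ _ _
  simp only [e]
  exact key _

end Realization

/-! ### Finiteness of the index set -/

section Finiteness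

variable {n : ℕ} (α : Fin n → Set.Ioo (0 : ℝ) 1)

theorem exists_length_mul_le_weight : ∃ a : ℝ, 0 < a ∧ ∀ l : List (Fin n),
    l.length * a ≤ weight α l := by
  have : ∃ a : ℝ, 0 < a ∧ ∀ i, a ≤ α i := by
    rcases isEmpty_or_nonempty (Fin n) with h | h
    · exact ⟨1, one_pos, fun i => isEmptyElim i⟩
    · obtain ⟨i, hi⟩ := Finite.exists_min fun i => (α i : ℝ)
      exact ⟨α i, (α i).2.1, hi⟩
  obtain ⟨a, ha, h⟩ := this
  refine ⟨a, ha, fun l => ?_⟩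
  induction l with
  | nil => simp [weight]
  | cons i l ih =>
    have e : weight α (i :: l) = α i + weight α l := by simp [weight]
    rw [e, List.length_cons]
    push_cast
    linarith [h i]

instance : Finite (LowWord α) := by
  obtain ⟨a, ha, h⟩ := exists_length_mul_le_weight α
  refine ((List.finite_length_le (Fin n) ⌈a⁻¹⌉₊).subset ?_).to_subtype
  rintro l ⟨-, hl⟩
  have h1 : (l.length : ℝ) ≤ a⁻¹ := by
    rw [← one_div, le_div_iff₀ ha]
    exact (h l).trans hl.le
  exact Nat.cast_le.1 (h1.trans (Nat.le_ceil _))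

theorem hom_nonneg (m : LowWord α →₀ ℕ) : 0 ≤ hom m :=
  Finset.sum_nonneg fun _ _ => mul_nonneg (Nat.cast_nonneg _) (weight_nonneg _)

/-- The homogeneities of the letters are bounded below by a positive number, so only finitely many
monomials have homogeneity less than `γ`. -/
theorem finite_hom_lt (γ : ℝ) : {m : LowWord α →₀ ℕ | hom m < γ}.Finite := by
  obtain ⟨a, ha, h⟩ := exists_length_mul_le_weight α
  refine (Set.finite_Icc 0 (Finsupp.equivFunOnFinite.symm fun _ => ⌈γ / a⌉₊)).subset ?_
  intro m hm
  refine ⟨zero_le, fun w => ?_⟩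
  by_cases hw : m w = 0
  · simp [hw]
  have h1 : (m w : ℝ) * weight α w.1 ≤ hom m :=
    Finset.single_le_sum (f := fun w => (m w : ℝ) * weight α w.1)
      (fun _ _ => mul_nonneg (Nat.cast_nonneg _) (weight_nonneg _)) (Finsupp.mem_support_iff.2 hw)
  have h2 : a ≤ weight α w.1 := by
    refine le_trans ?_ (h w.1)
    have : 1 ≤ w.1.length := List.length_pos_iff.2 w.2.1
    have : (1 : ℝ) ≤ w.1.length := by exact_mod_cast this
    nlinarith
  have h3 : (m w : ℝ) ≤ γ / a := by
    rw [le_div_iff₀ ha]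
    have hm' : hom m < γ := hm
    nlinarith [(Nat.cast_nonneg (m w) : (0 : ℝ) ≤ m w)]
  exact Nat.cast_le.1 (h3.trans (Nat.le_ceil _))

end Finiteness

/-! ### Sizes of models -/

section Sizes

variable {d n : ℕ} {α : Fin n → Set.Ioo (0 : ℝ) 1}

theorem gSize_le {γ K : ℝ} {a : Sp d → WordAlg α → ℝ} {b : Sp d → Sp d → WordAlg α → ℝ}
    (hK : 0 ≤ K) (ha : ∀ m : LowWord α →₀ ℕ, hom m < γ → ∀ x, ‖a x (mono m)‖ ≤ K)
    (hb : ∀ m : LowWord α →₀ ℕ, hom m < γ → ∀ x y, ‖b y x (mono m)‖ ≤ K * dist y x ^ hom m) :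
    gSize γ a b ≤ ENNReal.ofReal (2 * K) := by
  rw [two_mul, ENNReal.ofReal_add hK hK]
  refine add_le_add (iSup₂_le fun m hm => iSup_le fun x => ?_)
    (iSup₂_le fun m hm => iSup₂_le fun x y => ?_)
  · rw [← ofReal_norm]
    exact ENNReal.ofReal_le_ofReal (ha m hm x)
  · -- On the diagonal this covers the convention `0 / 0 = 0`.
    refine ENNReal.div_le_of_le_mul ?_
    rw [← ofReal_norm, ← ENNReal.ofReal_mul hK]
    exact ENNReal.ofReal_le_ofReal (hb m hm x y)

theorem norm_le_one_of_mem_testClass {r : ℕ} {φ : Sp d → ℝ} (hφ : φ ∈ testClass d r) (x : Sp d) :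
    ‖φ x‖ ≤ 1 := by
  simpa using hφ.2.2 0 (Nat.zero_le r) Fin.elim0 x

/-- On the support of a test function at `x` of scale `l`, the distance to `x` is at most `l`. -/
theorem norm_integral_rescaled_le {r : ℕ} {x : Sp d} {l h K : ℝ} (hl : 0 < l) (hh : 0 ≤ h)
    (hK : 0 ≤ K) {ψ : 𝓢(Sp d, ℂ)} (hψ : ψ ∈ rescaled d r x l) {D : Sp d → ℂ}
    (hD : ∀ y, ‖D y‖ ≤ K * dist y x ^ h) :
    ‖∫ y, ψ y * D y‖ ≤ K * l ^ h * volume.real (Metric.ball (0 : Sp d) 1) := by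
  obtain ⟨φ, hφ, hψ⟩ := hψ
  have h0 : ∀ y ∉ Metric.closedBall x l, ψ y * D y = 0 := by
    intro y hy
    have : φ (l⁻¹ • (y - x)) = 0 := by
      refine image_eq_zero_of_notMem_tsupport fun hmem => hy ?_
      have := hφ.2.1 hmem
      rw [mem_closedBall_zero_iff, norm_smul, norm_inv, Real.norm_of_nonneg hl.le,
        inv_mul_le_iff₀ hl, mul_one] at this
      rwa [Metric.mem_closedBall, dist_eq_norm]
    rw [hψ, this]
    simp
  rw [← setIntegral_eq_integral_of_forall_compl_eq_zero h0]
  have hld : 0 < l ^ d := pow_pos hl d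
  refine (norm_setIntegral_le_of_norm_le_const (C := (l ^ d)⁻¹ * (K * l ^ h))
    measure_closedBall_lt_top fun y hy => ?_).trans (le_of_eq ?_)
  · have hy' : dist y x ≤ l := hy
    rw [norm_mul, hψ, Complex.norm_real, norm_mul, Real.norm_of_nonneg (by positivity)]
    have h1 := norm_le_one_of_mem_testClass hφ (l⁻¹ • (y - x))
    have h2 : ‖D y‖ ≤ K * l ^ h := (hD y).trans (by gcongr)
    refine mul_le_mul ?_ h2 (norm_nonneg _) (by positivity)
    exact mul_le_of_le_one_right (by positivity) h1
  · rw [Measure.addHaar_real_closedBall _ _ hl.le]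
    simp only [finrank_euclideanSpace, Fintype.card_fin]
    field_simp

theorem exists_PiSize_le (P : DyadicPartition d) (r : ℕ) : ∃ C, 0 ≤ C ∧ ∀ (γ K : ℝ)
    (A : WordAlg α → 𝓢'(Sp d, ℂ)) (B : Sp d → WordAlg α → 𝓢'(Sp d, ℂ))
    (H : WordAlg α → Sp d → ℂ) (D : Sp d → WordAlg α → Sp d → ℂ), 0 ≤ K →
    (∀ τ, Represents (A τ) (H τ)) → (∀ x τ, Represents (B x τ) (D x τ)) →
    (∀ m : LowWord α →₀ ℕ, hom m < γ → ∀ z, ‖H (mono m) z‖ ≤ K) →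
    (∀ m : LowWord α →₀ ℕ, hom m < γ → ∀ x y, ‖D x (mono m) y‖ ≤ K * dist y x ^ hom m) →
    PiSize P r γ A B ≤ ENNReal.ofReal (C * K) := by
  obtain ⟨C, hC, h⟩ := exists_linftyNorm_block_le P
  refine ⟨C + volume.real (Metric.ball (0 : Sp d) 1), by positivity,
    fun γ K A B H D hK hA hB hH hD => ?_⟩
  rw [add_mul, ENNReal.ofReal_add (by positivity) (by positivity)]
  refine add_le_add (iSup₂_le fun m hm => iSup_le fun k => ?_) (iSup₂_le fun m hm =>
    iSup₂_le fun x l => iSup₂_le fun ψ hψ => ?_)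
  · -- In `𝓒^0` the dyadic weights are `1`.
    rw [mul_zero, Real.rpow_zero, ENNReal.ofReal_one, one_mul]
    exact h _ _ _ (hA _) (hH m hm) k
  · obtain ⟨l, hl, hl1⟩ := l
    rw [(hB x _).2.2, ← ofReal_norm, ← ENNReal.ofReal_mul (by positivity)]
    refine ENNReal.ofReal_le_ofReal ?_
    have h1 := norm_integral_rescaled_le hl (hom_nonneg α m) hK hψ (hD m hm x)
    calc _ ≤ l ^ (-hom m) * (K * l ^ hom m * volume.real (Metric.ball (0 : Sp d) 1)) := by gcongr
      _ = (l ^ (-hom m) * l ^ hom m) * (volume.real (Metric.ball (0 : Sp d) 1) * K) := by ring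
      _ = _ := by rw [← Real.rpow_add hl, neg_add_cancel, Real.rpow_zero, one_mul]

end Sizes

/-! ### The canonical model and its continuity -/

section Conclusion

variable {d n : ℕ} {α : Fin n → Set.Ioo (0 : ℝ) 1}

/-- All components of the distance of two models are controlled by the increments, uniformly in
systems with the same bound; the constants are added up over the finitely many monomials of
homogeneity less than `γ`. -/
theorem exists_model_bound (P : DyadicPartition d) (r : ℕ) (γ : ℝ) (η : 𝓢(Sp d, ℂ)) {M : ℝ}
    (hM : 0 ≤ M) : ∃ K, 0 ≤ K ∧ ∀ (ε : ℝ) (S S' : ParaSystem η α M), S.Close ε S' →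
      modelNorm P r γ (selfPair S.g) ≤ ENNReal.ofReal K ∧
      modelDist P r γ (selfPair S.g) (selfPair S'.g) ≤ ENNReal.ofReal (K * ε) := by
  choose C hC h using lipBound_mono (d := d) (α := α) (η := η) hM
  choose C' hC' h' using lipBound_incr_mono (d := d) (α := α) (η := η) hM
  obtain ⟨E, hE, hP⟩ := exists_PiSize_le (α := α) P r
  set s := (finite_hom_lt α γ).toFinset with hs
  obtain ⟨L, hL⟩ : ∃ L, L = ∑ m ∈ s, (C m + C' m) := ⟨_, rfl⟩
  have hL0 : 0 ≤ L := hL ▸ Finset.sum_nonneg fun m _ => add_nonneg (hC m) (hC' m)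
  have hCL : ∀ m : LowWord α →₀ ℕ, hom m < γ → C m ≤ L ∧ C' m ≤ L := by
    intro m hm
    have h1 : C m + C' m ≤ L := hL ▸ Finset.single_le_sum (f := fun m => C m + C' m)
      (fun m _ => add_nonneg (hC m) (hC' m)) (by simpa [hs] using hm)
    exact ⟨by linarith [hC' m], by linarith [hC m]⟩
  have b : ∀ (ε : ℝ) (S S' : ParaSystem η α M), S.Close ε S' → ∀ m : LowWord α →₀ ℕ, hom m < γ →
      ∀ x, PairBound L ε (S.g x (mono m)) (S'.g x (mono m)) := fun ε S S' hS m hm x =>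
    (h m ε S S' hS x).mono hS.1 (by simpa using (hCL m hm).1)
  have b' : ∀ (ε : ℝ) (S S' : ParaSystem η α M), S.Close ε S' → ∀ m : LowWord α →₀ ℕ, hom m < γ →
      ∀ x y, PairBound (L * dist y x ^ hom m) ε (incr S.g y x (mono m)) (incr S'.g y x (mono m)) :=
    fun ε S S' hS m hm x y => (h' m ε S S' hS (y, x)).mono hS.1 (by
      have := (hCL m hm).2
      dsimp only
      gcongr)
  refine ⟨2 * L + E * L, by positivity, fun ε S S' hS => ⟨?_, ?_⟩⟩
  · rw [ENNReal.ofReal_add (by positivity) (by positivity)]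
    refine add_le_add (gSize_le hL0 (fun m hm x => (b ε S S' hS m hm x).1)
      fun m hm x y => (b' ε S S' hS m hm x y).1) ?_
    refine hP γ L _ _ (fun τ x => ((S.g x τ : ℝ) : ℂ)) (fun x τ y => ((incr S.g y x τ : ℝ) : ℂ)) hL0
      (S.represents_Pi hM) (fun x τ => (S.represents_PiAt hM x τ).1) (fun m hm x => ?_)
      fun m hm x y => ?_
    · rw [Complex.norm_real]; exact (b ε S S' hS m hm x).1
    · rw [Complex.norm_real]; exact (b' ε S S' hS m hm x y).1
  · have hLε : 0 ≤ L * ε := mul_nonneg hL0 hS.1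
    rw [add_mul, mul_assoc, mul_assoc,
      ENNReal.ofReal_add (by positivity) (by positivity)]
    have e : ∀ t : ℝ, L * t * ε = L * ε * t := fun t => by ring
    refine add_le_add (gSize_le hLε (fun m hm x => (b ε S S' hS m hm x).2.2)
      fun m hm x y => ((b' ε S S' hS m hm x y).2.2).trans_eq (e _)) ?_
    refine hP γ (L * ε) _ _ (fun τ x => ((S.g x τ : ℝ) : ℂ) - ((S'.g x τ : ℝ) : ℂ))
      (fun x τ y => ((incr S.g y x τ : ℝ) : ℂ) - ((incr S'.g y x τ : ℝ) : ℂ)) hLε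
      (fun τ => ?_) (fun x τ => ?_) (fun m hm x => ?_) fun m hm x y => ?_
    · obtain ⟨⟨B, hB⟩, -⟩ := S.exists_bound_and_continuous hM τ
      obtain ⟨⟨B', hB'⟩, -⟩ := S'.exists_bound_and_continuous hM τ
      exact (S.represents_Pi hM τ).sub hB (S'.represents_Pi hM τ) hB'
    · obtain ⟨h1, B, hB⟩ := S.represents_PiAt hM x τ
      obtain ⟨h2, B', hB'⟩ := S'.represents_PiAt hM x τ
      exact h1.sub hB h2 hB'
    · rw [← Complex.ofReal_sub, Complex.norm_real]; exact (b ε S S' hS m hm x).2.2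
    · rw [← Complex.ofReal_sub, Complex.norm_real, ← e]; exact (b' ε S S' hS m hm x y).2.2

theorem exists_common_lpBound (P : DyadicPartition d) {f : Fin n → 𝓢'(Sp d, ℂ)}
    (hf : ∀ i, f i ∈ besovSpace P (α i)) :
    ∃ M, 0 ≤ M ∧ ∀ i, LPBound (α i) M (lpFun P (f i)) := by
  choose N hN using fun i => (exists_lpBound_of_mem P (hf i)).2
  exact ⟨∑ i, N i, Finset.sum_nonneg fun i _ => (hN i).nonneg, fun i => (hN i).mono
    (Finset.single_le_sum (fun i _ => (hN i).nonneg) (Finset.mem_univ i))⟩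

theorem isWordModel_canonicalModel (P : DyadicPartition d) (r : ℕ) {f : Fin n → 𝓢'(Sp d, ℂ)}
    (hf : ∀ i, f i ∈ besovSpace P (α i)) : IsWordModel P r (canonicalModel α P f) := by
  obtain ⟨M, hM, h⟩ := exists_common_lpBound P hf
  let S := canonicalSystem P hf h
  refine ⟨S.exists_realizes hM, fun γ => ?_⟩
  obtain ⟨K, hK, hb⟩ := exists_model_bound (α := α) P r γ P.kernel hM
  exact (hb 0 S S S.close_self).1.trans_lt ENNReal.ofReal_lt_top

/-- The canonical model depends continuously on the letters. -/
theorem exists_modelDist_lt (P : DyadicPartition d) (r : ℕ) {f : Fin n → 𝓢'(Sp d, ℂ)}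
    (hf : ∀ i, f i ∈ besovSpace P (α i)) (γ : ℝ) {ε : ℝ} (hε : 0 < ε) :
    ∃ δ : ℝ, 0 < δ ∧ ∀ f' : Fin n → 𝓢'(Sp d, ℂ), (∀ i, f' i ∈ besovSpace P (α i)) →
      (∀ i, besovNorm P (α i) (f i - f' i) < ENNReal.ofReal δ) →
        modelDist P r γ (selfPair (canonicalModel α P f)) (selfPair (canonicalModel α P f'))
          < ENNReal.ofReal ε := by
  obtain ⟨M, hM, h⟩ := exists_common_lpBound P hf
  choose C hC hCb using fun i => exists_lpBound P (α i : ℝ)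
  obtain ⟨T, hT⟩ : ∃ T, T = ∑ i, C i := ⟨_, rfl⟩
  have hT0 : 0 ≤ T := hT ▸ Finset.sum_nonneg fun i _ => hC i
  have hCT : ∀ i, C i ≤ T := fun i => hT ▸ Finset.single_le_sum (fun i _ => hC i)
    (Finset.mem_univ i)
  have hMT : 0 ≤ M + T := by positivity
  obtain ⟨K, hK, hb⟩ := exists_model_bound (α := α) P r γ P.kernel hMT
  -- The radius is at most `1`, so that the blocks of the letters of `f'` are bounded by `M + T`.
  have hδ : 0 < min 1 (ε / (K * T + 1)) := lt_min one_pos (by positivity)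
  refine ⟨_, hδ, fun f' hf' hff => ?_⟩
  set δ := min 1 (ε / (K * T + 1)) with hδe
  have hd : ∀ i, LPBound (α i) (T * δ) fun m z => lpFun P (f i) m z - lpFun P (f' i) m z := by
    intro i
    obtain ⟨h1, N, h2⟩ := exists_lpBound_of_mem P (hf' i)
    have h3 := (hCb i (f i - f' i) δ hδ.le (hff i).le).2
    rw [lpFun_sub P (exists_lpBound_of_mem P (hf i)).1 (h i) h1 h2] at h3
    exact h3.mono (by gcongr; exact hCT i)
  have hTδ : T * δ ≤ T := mul_le_of_le_one_right hT0 (min_le_left _ _)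
  have h' : ∀ i, LPBound (α i) (M + T) (lpFun P (f' i)) := by
    intro i
    have := (h i).sub (hd i)
    simp only [sub_sub_cancel] at this
    exact this.mono (by linarith)
  let S := canonicalSystem P hf fun i => (h i).mono (le_add_of_nonneg_right hT0)
  let S' := canonicalSystem P hf' h'
  refine (hb (T * δ) S S' ⟨by positivity, hd⟩).2.trans_lt ?_
  refine (ENNReal.ofReal_lt_ofReal_iff hε).2 ?_
  have h4 : δ * (K * T + 1) ≤ ε := (le_div_iff₀ (by positivity)).1 (min_le_right _ _)
  nlinarith

end Conclusion

end WordModel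

end

open WordModel
open scoped SchwartzMap

theorem theorem3p13 {d n : ℕ} (P : DyadicPartition d) (r : ℕ) (hr : 0 < r)
    (α : Fin n → Set.Ioo (0 : ℝ) 1) :
    (∀ f : Fin n → 𝓢'(Sp d, ℂ), (∀ i, f i ∈ besovSpace P (α i)) →
      (∀ (l : List (Fin n)) (j : Fin n), l ≠ [] → weight α (l ++ [j]) < 1 →
        Summable (paraTerm P (iterPara P f l) (f j))) ∧
      (∀ l : List (Fin n), weight α l < 1 →
        Represents (iterPara P f l) fun x => ((canonicalModel α P f x (word α l) : ℝ) : ℂ)) ∧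
      IsWordModel P r (canonicalModel α P f)) ∧
    (∀ f : Fin n → 𝓢'(Sp d, ℂ), (∀ i, f i ∈ besovSpace P (α i)) →
      ∀ γ ε : ℝ, 0 < ε → ∃ δ : ℝ, 0 < δ ∧
        ∀ f' : Fin n → 𝓢'(Sp d, ℂ), (∀ i, f' i ∈ besovSpace P (α i)) →
          (∀ i, besovNorm P (α i) (f i - f' i) < ENNReal.ofReal δ) →
            modelDist P r γ (selfPair (canonicalModel α P f)) (selfPair (canonicalModel α P f'))
              < ENNReal.ofReal ε) := by
  refine ⟨fun f hf => ⟨fun l j hl hw => ?_, fun l hw => (represents_iterPara P hf l hw).1,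
    isWordModel_canonicalModel P r hf⟩, fun f hf γ ε hε => exists_modelDist_lt P r hf γ hε⟩
  exact ((represents_iterPara P hf _ hw).2.2 l j rfl).1 hl
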